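/- Let $p,q,r\in\mathbb{C}$ and $\gamma\in\mathbb{R}$ with $p\,r\,\gamma\,\mathrm{Im}(r/p)\neq 0$, let $c,\omega\in\mathbb{R}$, and write $1/p=s_r-i s_i$, $r/p=e_r+i e_i$ with $s_r,s_i,e_r,e_i$ real. Consider the travelling waves $A(x,t)=a(\xi)e^{-i\omega t}$, $\xi=x-ct$, of the cubic-quintic complex Ginzburg-Landau equation (CGL5) $$iA_t+pA_{xx}+q|A|^2A+r|A|^4A-i\gamma A=0 .$$ In terms of $\psi=(\log a)'$ and $M=a\bar a=|A|^2$ they satisfy, in the complex variable $\xi$, the closed system $$p(\psi'+\psi^2)+qM+rM^2-ic\psi+\omega-i\gamma=0,$$ $$\bar p\,(M''-2\psi M'-\psi'M+\psi^2M)+(\bar qM+\bar rM^2)M+ic(M'-\psi M)+(\omega+i\gamma)M=0 .$$ That is, if $a\neq 0$ is $C^2$ on a real interval, $A$ solves CGL5 where $\xi$ is in that interval, and $a'/a$ and $|a|^2$ are there the restrictions of functions $\psi$ and $M$ meromorphic on $\mathbb{C}$, then $(\psi,M)$ satisfies the system on $\mathbb{C}$. Call elliptic wave any pair $(\psi,M)$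 of functions meromorphic on $\mathbb{C}$, $M\not\equiv 0$, which satisfies the system and in which $\psi$ or $M$ is a nondegenerate elliptic function (doubly periodic and not constant). Then: (1) An elliptic wave exists if and only if $$q=0,\qquad \mathrm{Re}\Big(\frac rp\Big)=0,\qquad \mathrm{Im}\Big(\frac{\gamma+i\omega}{p}\Big)=-\frac14(cs_r)^2-\frac3{16}(cs_i)^2 .$$ (2) The elliptic wave is unique: any two elliptic waves (for the same $p,q,r,\gamma,c,\omega$) differ by a translation of $\xi$. (3) For a suitable choice of the origin of $\xi$ the elliptic wave is given by $$\psi(\xi)-\frac{i c s_r}{2}=\frac{c s_i}{2}+\sum_{k=1}^{3}e^{2i\pi k/3}\big(\zeta_\psi(\xi-x_k)+\zeta_\psi(x_k)\big),$$ $$M(\xi)=\frac{3^{1/4}}{\sqrt{-e_i}}\sum_{k=1}^{4}e^{2i\pi k/4}\big(\zeta_M(\xi-y_k)+\zeta_M(y_k)\big),$$ where $\zeta_\psi,\zeta_M$ are the Weierstrass zeta functions of two period lattices $\Lambda_\psi,\Lambda_M$, where $x_3=0$ (the pole of $\psi$ of residue $1$ is at the origin) and the term $\zeta_\psi(x_3)$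 is read as $0$, and where $y_k\notin\Lambda_M$. The function $\psi$ has the period lattice $\Lambda_\psi$, and in a period parallelogram its poles are exactly the three points $x_1,x_2,x_3$, distinct modulo $\Lambda_\psi$ and simple, with residues $\frac{-1+i\sqrt3}2,\ \frac{-1-i\sqrt3}2,\ 1$. The function $M$ has the period lattice $\Lambda_M$, and in a period parallelogram its poles are exactly the four points $y_1,\dots,y_4$, distinct modulo $\Lambda_M$ and simple, with residues $3^{1/4}(-e_i)^{-1/2}e^{2i\pi k/4}$. -/

import Mathlib

open Complex Filter Topology

namespace CGL5

noncomputable section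

/-! ### Elliptic functions

Meromorphic functions on `ℂ` are represented by functions `ℂ → ℂ` that are considered up to equality
outside a closed discrete set (`codiscrete ℂ`), so values at poles play no role. -/

/-- The Weierstrass zeta function of the lattice spanned by a pair of periods,
`ζ(z) = 1/z + ∑_{l ≠ 0} (1/(z - l) + 1/l + z/l²)`; since `1/0 = 0`, the term `l = 0` of the series
below is `1/z`. -/
def weierstrassZeta (L : PeriodPair) (z : ℂ) : ℂ :=
  ∑' l : L.lattice, (1 / (z - l) + 1 / (l : ℂ) + z / (l : ℂ) ^ 2)

/-- `f` has every element of the lattice of `L` as a period. -/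
def HasPeriods (f : ℂ → ℂ) (L : PeriodPair) : Prop :=
  ∀ l ∈ L.lattice, (fun z => f (z + l)) =ᶠ[codiscrete ℂ] f

/-- Nondegenerate elliptic functions: nonconstant, meromorphic on `ℂ` and doubly periodic. -/
def IsNondegenerateElliptic (f : ℂ → ℂ) : Prop :=
  Meromorphic f ∧ (∃ L : PeriodPair, HasPeriods f L) ∧
    ¬ ∃ a : ℂ, f =ᶠ[codiscrete ℂ] fun _ => a

/-- In a period parallelogram of the period lattice `L`, the poles of `f` are exactly `n` distinct
points, represented by `x 0, …, x (n-1)`; they are simple, with residues `ρ 0, …, ρ (n-1)`. -/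
def HasSimplePoles {n : ℕ} (f : ℂ → ℂ) (L : PeriodPair) (x ρ : Fin n → ℂ) : Prop :=
  HasPeriods f L ∧
  (∀ j k, j ≠ k → x j - x k ∉ L.lattice) ∧
  (∀ z, meromorphicOrderAt f z < 0 ↔ ∃ k, z - x k ∈ L.lattice) ∧
  ∀ k, Tendsto (fun z => (z - x k) * f z) (𝓝[≠] (x k)) (𝓝 (ρ k))

/-! ### The cubic-quintic complex Ginzburg-Landau equation -/

/-- The parameters of the equation: `p, q, r` complex, `γ` real, `p r γ Im(r/p) ≠ 0`, and the
parameters of the travelling wave reduction: the real velocity `c` and the real frequency `ω`. -/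
structure Params where
  p : ℂ
  q : ℂ
  r : ℂ
  γ : ℝ
  c : ℝ
  ω : ℝ
  hp : p ≠ 0
  hr : r ≠ 0
  hγ : γ ≠ 0
  him : (r / p).im ≠ 0

namespace Params

variable (P : Params)

/-- `1/p = s_r - i s_i`. -/
def sr : ℝ := (1 / P.p).re

/-- `1/p = s_r - i s_i`. -/
def si : ℝ := -(1 / P.p).im

/-- `r/p = e_r + i e_i`. -/
def ei : ℝ := (P.r / P.p).im

/-- The amplitude `A(x,t)` satisfies, at the point `(x,t)`, the equation
`i A_t + p A_xx + q |A|² A + r |A|⁴ A - i γ A = 0`. -/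
def SolvesPDEAt (A : ℝ → ℝ → ℂ) (x t : ℝ) : Prop :=
  I * deriv (fun s => A x s) t + P.p * iteratedDeriv 2 (fun y => A y t) x
    + P.q * ((‖A x t‖ ^ 2 : ℝ) : ℂ) * A x t + P.r * ((‖A x t‖ ^ 4 : ℝ) : ℂ) * A x t
    - I * P.γ * A x t = 0

/-- The travelling wave `A(x,t) = a(x - c t) exp(-i ω t)`. -/
def amplitude (a : ℝ → ℂ) (x t : ℝ) : ℂ := a (x - P.c * t) * exp (-(I * P.ω * t))

/-- Meromorphic solutions `(ψ, M)` of the closed system obeyed by the logarithmic derivative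
`ψ = a'/a` and the square modulus `M = a ā` of a travelling wave, in the complex variable `ξ`:
`p (ψ' + ψ²) + q M + r M² - i c ψ + ω - i γ = 0` and the complex conjugate equation, in which
`(log ā)' = -ψ + M'/M`. The solution `M = 0` is discarded. -/
structure IsMeromorphicWave (ψ M : ℂ → ℂ) : Prop where
  meromorphic_ψ : Meromorphic ψ
  meromorphic_M : Meromorphic M
  ne_zero : ¬ M =ᶠ[codiscrete ℂ] fun _ => 0
  eq : ∀ᶠ ξ in codiscrete ℂ,
    P.p * (deriv ψ ξ + ψ ξ ^ 2) + P.q * M ξ + P.r * M ξ ^ 2 - I * P.c * ψ ξ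
      + P.ω - I * P.γ = 0
  eq_conj : ∀ᶠ ξ in codiscrete ℂ,
    (starRingEnd ℂ P.p) * (deriv (deriv M) ξ - 2 * ψ ξ * deriv M ξ - deriv ψ ξ * M ξ
        + ψ ξ ^ 2 * M ξ)
      + ((starRingEnd ℂ P.q) * M ξ + (starRingEnd ℂ P.r) * M ξ ^ 2) * M ξ
      + I * P.c * (deriv M ξ - ψ ξ * M ξ) + (P.ω + I * P.γ) * M ξ = 0

/-- Nondegenerate elliptic travelling waves: meromorphic ones for which the logarithmic derivative
or the square modulus is a nondegenerate elliptic function. -/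
def IsEllipticWave (ψ M : ℂ → ℂ) : Prop :=
  P.IsMeromorphicWave ψ M ∧ (IsNondegenerateElliptic ψ ∨ IsNondegenerateElliptic M)

/-- The constraints `q = 0`, `Re(r/p) = 0`,
`Im((γ + i ω)/p) = -(c s_r)²/4 - 3 (c s_i)²/16`. -/
def Constraints : Prop :=
  P.q = 0 ∧ (P.r / P.p).re = 0 ∧
    ((P.γ + I * P.ω) / P.p).im = -(1 / 4) * (P.c * P.sr) ^ 2 - (3 / 16) * (P.c * P.si) ^ 2

/-- `exp(2 i π k / 3)`: for `k = 0, 1, 2` these are `1`, `(-1 + i √3)/2`, `(-1 - i √3)/2`. -/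
def residueψ (k : Fin 3) : ℂ := exp ((k : ℕ) * (2 * I * Real.pi / 3))

/-- `(3^{1/4} / √(-e_i)) exp(2 i π k / 4)`. The choice of the square root is immaterial, since the
opposite choice amounts to a permutation of the values `k = 0, 1, 2, 3`. -/
def residueM (k : Fin 4) : ℂ :=
  (((3 : ℝ) ^ (1 / 4 : ℝ) : ℝ) : ℂ) / (-(P.ei : ℂ)) ^ (1 / 2 : ℂ)
    * exp ((k : ℕ) * (2 * I * Real.pi / 4))

end Params

end

end CGL5

/-!
The translation `u = ψ - i c / (2 p)` and the companion function `v = M'/M - u - κ`, where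
`κ = c s_i`, turn the system for `(ψ, M)` into

  `u' = -(u² + d M + e M² + G)`,  `v' = -(v² + d̄ M + ē M² + Ḡ)`,  `M' = (u + v + κ) M`,

with `d = q/p`, `e = r/p`, `G = (ω - i γ)/p + c²/(4 p²)` (`ReducedParams.IsWave`,
`Params.IsMeromorphicWave.isWave`). In these terms the constraints are `d = 0`, `Re e = 0`,
`Re G = -(7/16) κ²`.

*Local analysis.* All poles of `u`, `v`, `M` are simple. At a pole of `M` the residues of `u` and
`v` are `-1/2 ± i α` with `α` one of two real numbers, elsewhere they are `0` or `1`. A resonance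
computation shows that the residue of `M` at a pole determines the wave
(`ReducedParams.IsGerm.eventually_eq`, `ReducedParams.IsWave.eq_comp_add`). This yields uniqueness
up to translation, and also converts coincidences of residues into periods.

*Necessity.* If `ψ` or `M` is elliptic, then `u`, `v`, `M` have a common period lattice. The residue
theorem for `u` and `M` forces `Re e = 0` and four poles of `M`, with the residues
`3^{1/4} (-e_i)^{-1/2} i^k` (`ReducedParams.IsWave.exists_poles`). Applied to `u M`, `u M²` and
`u v M²` it gives `d + d̄ = 0`, `G + Ḡ = -(7/8) κ²` and `κ d = 0`. It remains to exclude `κ = 0`,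
`d ≠ 0`, where residues give no more information. In this case the system is invariant under rotation
by a right angle, hence so is the wave, after a translation; this places double zeros of `M`
at half periods. Then `u² - v² + e M² + (5/4) d M` is constant, and comparing its values at the
poles and at these zeros of `M` gives `d = 0` (`ReducedParams.IsLatticeWave.d_eq_zero`).

*Closed form.* For `d = 0` the system is invariant under `M ↦ -M`, so that translations between
poles of `M` of opposite residues are periods of `u`. Modulo the periods of `u`, the poles of `u` are
therefore two poles of `M` and a single further point, of residue `1`. With this point as origin, the
expansions of `u` and `M` in zeta functions have constants determined by the vanishing of
`u - 1/ξ` and of `M` at the origin (`ReducedParams.IsLatticeWave.closed_form_of_residue_zero`).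

*Existence.* Under the constraints a solution is a rational function of `g` and `g'`, where
`g'² = (1 - α g²)(1 + β g²)` with `α, β > 0` (`ReducedParams.exists_isWave`); positivity uses
`γ ≠ 0`. The function `g` is built from its germ at the origin: the duplication formula continues it
to a meromorphic function on `ℂ`, inversion of an elliptic integral gives a real period, and the
symmetry exchanging `α` and `β` an imaginary one (`exists_isJacobi_periods`).

The tools from the theory of elliptic functions are the quasi-periodicity of the zeta function and
the residue theorem. The latter is proved without contour integration: subtracting a combination of
zeta functions and their derivatives from an elliptic function leaves an affine function, and the
quasi-periods of the zeta function are not proportional to the periods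
(`quasiPeriod_not_proportional`, `sum_residues_of_simple_poles`).
-/

namespace CGL5

/-! ### Meromorphic functions up to equality on a codiscrete set -/

theorem eventually_codiscrete_iff {p : ℂ → Prop} :
    (∀ᶠ z in codiscrete ℂ, p z) ↔ ∀ z, ∀ᶠ x in 𝓝[≠] z, p x := by
  have h : {z | p z} ∈ codiscrete ℂ ↔ _ := mem_codiscreteWithin_iff_forall_mem_nhdsNE
  simpa [Filter.Eventually] using h

theorem nhdsNE_of_codiscrete {p : ℂ → Prop} (h : ∀ᶠ z in codiscrete ℂ, p z) (z : ℂ) :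
    ∀ᶠ x in 𝓝[≠] z, p x :=
  eventually_codiscrete_iff.1 h z

theorem tendsto_affine_nhdsNE (a b z : ℂ) (ha : a ≠ 0) :
    Tendsto (fun x => a * x + b) (𝓝[≠] z) (𝓝[≠] (a * z + b)) := by
  refine tendsto_nhdsWithin_iff.2 ⟨?_, ?_⟩
  · exact (Continuous.tendsto (by fun_prop) z).mono_left nhdsWithin_le_nhds
  · filter_upwards [self_mem_nhdsWithin] with x hx
    simpa [ha] using hx

theorem tendsto_affine_codiscrete (a b : ℂ) (ha : a ≠ 0) :
    Tendsto (fun x => a * x + b) (codiscrete ℂ) (codiscrete ℂ) := by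
  intro s hs
  exact eventually_codiscrete_iff.2 fun z =>
    (tendsto_affine_nhdsNE a b z ha).eventually (nhdsNE_of_codiscrete hs (a * z + b))

theorem eventually_codiscrete_affine {p : ℂ → Prop} (h : ∀ᶠ z in codiscrete ℂ, p z) (a b : ℂ)
    (ha : a ≠ 0) : ∀ᶠ z in codiscrete ℂ, p (a * z + b) :=
  (tendsto_affine_codiscrete a b ha).eventually h

theorem eventually_codiscrete_add {p : ℂ → Prop} (h : ∀ᶠ z in codiscrete ℂ, p z) (b : ℂ) :
    ∀ᶠ z in codiscrete ℂ, p (z + b) := by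
  simpa using eventually_codiscrete_affine h 1 b one_ne_zero

theorem eventuallyEq_codiscrete_add {f g : ℂ → ℂ} (h : f =ᶠ[codiscrete ℂ] g) (b : ℂ) :
    (fun z => f (z + b)) =ᶠ[codiscrete ℂ] fun z => g (z + b) :=
  eventually_codiscrete_add h b

theorem eventually_nhdsNE_nhds {p : ℂ → Prop} {z : ℂ} (h : ∀ᶠ x in 𝓝[≠] z, p x) :
    ∀ᶠ x in 𝓝[≠] z, ∀ᶠ y in 𝓝 x, p y := by
  filter_upwards [eventually_eventually_nhdsWithin.2 h, self_mem_nhdsWithin] with x hx hxz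
  rwa [isOpen_compl_singleton.nhdsWithin_eq hxz] at hx

theorem eventually_codiscrete_nhds {p : ℂ → Prop} (h : ∀ᶠ z in codiscrete ℂ, p z) :
    ∀ᶠ z in codiscrete ℂ, ∀ᶠ y in 𝓝 z, p y :=
  eventually_codiscrete_iff.2 fun z => eventually_nhdsNE_nhds (nhdsNE_of_codiscrete h z)

theorem deriv_congr_codiscrete {f g : ℂ → ℂ} (h : f =ᶠ[codiscrete ℂ] g) :
    deriv f =ᶠ[codiscrete ℂ] deriv g := by
  filter_upwards [eventually_codiscrete_nhds h] with z hz
  exact EventuallyEq.deriv_eq hz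

theorem eventually_analyticAt_codiscrete {f : ℂ → ℂ} (hf : Meromorphic f) :
    ∀ᶠ z in codiscrete ℂ, AnalyticAt ℂ f z :=
  eventually_codiscrete_iff.2 fun z => (hf z).eventually_analyticAt

/-- The identity theorem for meromorphic functions on `ℂ`. -/
theorem eventuallyEq_codiscrete_of_frequently {f g : ℂ → ℂ} (hf : Meromorphic f)
    (hg : Meromorphic g) {z : ℂ} (h : ∃ᶠ x in 𝓝[≠] z, f x = g x) : f =ᶠ[codiscrete ℂ] g := by
  have hd : Meromorphic (f - g) := hf.sub hg
  have h0 : meromorphicOrderAt (f - g) z = ⊤ := by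
    rw [meromorphicOrderAt_eq_top_iff]
    refine (hd z).frequently_zero_iff_eventuallyEq_zero.1 (h.mono fun x hx => ?_)
    simp [hx]
  refine eventually_codiscrete_iff.2 fun y => ?_
  have hy : meromorphicOrderAt (f - g) y = ⊤ := by
    by_contra hne
    exact (hd.meromorphicOn (s := Set.univ)).meromorphicOrderAt_ne_top_of_isPreconnected
      isPreconnected_univ (Set.mem_univ y) (Set.mem_univ z) hne h0
  filter_upwards [meromorphicOrderAt_eq_top_iff.1 hy] with x hx
  simpa [sub_eq_zero] using hx

theorem eventuallyEq_codiscrete_of_nhdsNE {f g : ℂ → ℂ} (hf : Meromorphic f)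
    (hg : Meromorphic g) {z : ℂ} (h : ∀ᶠ x in 𝓝[≠] z, f x = g x) : f =ᶠ[codiscrete ℂ] g :=
  eventuallyEq_codiscrete_of_frequently hf hg h.frequently

theorem eventually_ne_codiscrete {f g : ℂ → ℂ} (hf : Meromorphic f) (hg : Meromorphic g)
    (h : ¬ f =ᶠ[codiscrete ℂ] g) : ∀ᶠ z in codiscrete ℂ, f z ≠ g z := by
  refine eventually_codiscrete_iff.2 fun z => ?_
  by_contra hz
  exact h (eventuallyEq_codiscrete_of_frequently hf hg (z := z) (by simpa using hz))

theorem eventuallyEq_zero_or_of_mul {f g : ℂ → ℂ} (hf : Meromorphic f)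
    (h : ∀ᶠ z in codiscrete ℂ, f z * g z = 0) :
    f =ᶠ[codiscrete ℂ] 0 ∨ g =ᶠ[codiscrete ℂ] 0 := by
  by_cases h1 : f =ᶠ[codiscrete ℂ] 0
  · exact Or.inl h1
  · right
    filter_upwards [h, eventually_ne_codiscrete hf (Meromorphic.const 0) h1] with z h2 h3
    exact (mul_eq_zero.1 h2).resolve_left h3

theorem meromorphic_of_differentiable {f : ℂ → ℂ} (hf : Differentiable ℂ f) : Meromorphic f :=
  fun z => (hf.analyticAt z).meromorphicAt

theorem meromorphic_comp_affine {f : ℂ → ℂ} (hf : Meromorphic f) (a b : ℂ) :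
    Meromorphic (fun z => f (a * z + b)) := by
  intro z
  have hg : AnalyticAt ℂ (fun x : ℂ => a * x + b) z := by fun_prop
  exact MeromorphicAt.comp_analyticAt (hf _) hg

theorem meromorphic_comp_add {f : ℂ → ℂ} (hf : Meromorphic f) (b : ℂ) :
    Meromorphic (fun z => f (z + b)) := by
  simpa using meromorphic_comp_affine hf 1 b

theorem meromorphic_comp_sub {f : ℂ → ℂ} (hf : Meromorphic f) (b : ℂ) :
    Meromorphic (fun z => f (z - b)) := by
  simpa [sub_eq_add_neg] using meromorphic_comp_add hf (-b)

/-- A meromorphic function without poles coincides with an entire function. -/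
theorem exists_differentiable_of_order_nonneg {f : ℂ → ℂ} (hf : Meromorphic f)
    (h : ∀ z, 0 ≤ meromorphicOrderAt f z) :
    ∃ g : ℂ → ℂ, Differentiable ℂ g ∧ f =ᶠ[codiscrete ℂ] g := by
  have hfu : MeromorphicOn f Set.univ := hf.meromorphicOn
  refine ⟨toMeromorphicNFOn f Set.univ, fun z => ?_, toMeromorphicNFOn_eqOn_codiscrete hfu⟩
  have h1 : MeromorphicNFAt (toMeromorphicNFOn f Set.univ) z :=
    meromorphicNFOn_toMeromorphicNFOn f Set.univ (Set.mem_univ z)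
  refine AnalyticAt.differentiableAt (h1.meromorphicOrderAt_nonneg_iff_analyticAt.1 ?_)
  rw [meromorphicOrderAt_toMeromorphicNFOn hfu (Set.mem_univ z)]
  exact h z

theorem eventuallyEq_nhds_of_nhdsNE {f g : ℂ → ℂ} {z : ℂ} (hf : ContinuousAt f z)
    (hg : ContinuousAt g z) (h : ∀ᶠ x in 𝓝[≠] z, f x = g x) : ∀ᶠ x in 𝓝 z, f x = g x := by
  have : f =ᶠ[𝓝 z] g := (hf.eventuallyEq_nhds_iff_eventuallyEq_nhdsNE hg).1 h
  exact this

theorem eq_of_eventually_nhdsNE {f g : ℂ → ℂ} {z : ℂ} (hf : ContinuousAt f z)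
    (hg : ContinuousAt g z) (h : ∀ᶠ x in 𝓝[≠] z, f x = g x) : f z = g z :=
  (eventuallyEq_nhds_of_nhdsNE hf hg h).self_of_nhds

theorem eq_of_eventuallyEq_codiscrete {f g : ℂ → ℂ} (hf : Continuous f) (hg : Continuous g)
    (h : f =ᶠ[codiscrete ℂ] g) : f = g :=
  funext fun z => eq_of_eventually_nhdsNE hf.continuousAt hg.continuousAt
    (nhdsNE_of_codiscrete h z)

theorem order_nonneg_of_eventuallyEq {f g : ℂ → ℂ} {z : ℂ} (hg : AnalyticAt ℂ g z)
    (h : ∀ᶠ x in 𝓝[≠] z, f x = g x) : 0 ≤ meromorphicOrderAt f z := by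
  rw [meromorphicOrderAt_congr h]
  exact hg.meromorphicOrderAt_nonneg

/-- A function meromorphic at `z` without a pole there extends analytically to `z`. -/
theorem exists_analyticAt_of_order_nonneg {f : ℂ → ℂ} {z : ℂ} (hf : MeromorphicAt f z)
    (h : 0 ≤ meromorphicOrderAt f z) :
    ∃ g : ℂ → ℂ, AnalyticAt ℂ g z ∧ ∀ᶠ x in 𝓝[≠] z, f x = g x :=
  hf.meromorphicOrderAt_nonneg_iff.1 h

/-! ### The Weierstrass zeta function -/

variable (L : PeriodPair)

/-- The series of the zeta function without its term of index `l₀`. -/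
noncomputable def zetaExcept (l₀ z : ℂ) : ℂ :=
  ∑' l : L.lattice, if (l : ℂ) = l₀ then 0 else (1 / (z - l) + 1 / (l : ℂ) + z / (l : ℂ) ^ 2)

theorem zeta_summand_bound (r : ℝ) (hr : 0 < r) (s : ℂ) (hs : ‖s‖ < r) (l : ℂ)
    (h : 2 * r ≤ ‖l‖) :
    ‖1 / (s - l) + 1 / l + s / l ^ 2‖ ≤ 2 * r ^ 2 * ‖l‖ ^ (-3 : ℝ) := by
  have h1 : s - l ≠ 0 := by
    rintro h0
    rw [sub_eq_zero] at h0
    subst h0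
    linarith
  have h2 : 0 < ‖l‖ := by linarith
  have h3 : l ≠ 0 := norm_pos_iff.1 h2
  have h4 : ‖l‖ / 2 ≤ ‖s - l‖ := by
    rw [norm_sub_rev]
    exact .trans (by linarith) (norm_sub_norm_le l s)
  have h5 : 1 / (s - l) + 1 / l + s / l ^ 2 = s ^ 2 / (l ^ 2 * (s - l)) := by
    field_simp
    ring
  rw [h5, norm_div, norm_mul, norm_pow, norm_pow]
  calc ‖s‖ ^ 2 / (‖l‖ ^ 2 * ‖s - l‖) ≤ r ^ 2 / (‖l‖ ^ 2 * (‖l‖ / 2)) := by gcongr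
    _ = 2 * r ^ 2 / ‖l‖ ^ 3 := by field_simp
    _ = 2 * r ^ 2 * ‖l‖ ^ (-3 : ℝ) := by
      rw [div_eq_mul_inv]
      norm_cast

theorem hasSumLocallyUniformly_zetaExcept (l₀ : ℂ) :
    HasSumLocallyUniformly
      (fun (l : L.lattice) (z : ℂ) => if (l : ℂ) = l₀ then 0 else
        (1 / (z - l) + 1 / (l : ℂ) + z / (l : ℂ) ^ 2)) (zetaExcept L l₀) := by
  refine L.hasSumLocallyUniformly_aux (u := fun r l => 2 * r ^ 2 * ‖l‖ ^ (-3 : ℝ)) _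
    (fun _ _ => (ZLattice.summable_norm_rpow _ _ (by simp; norm_num)).mul_left _) fun r hr =>
    Filter.eventually_atTop.mpr ⟨2 * r, ?_⟩
  rintro _ h s hs l rfl
  split_ifs
  · rw [norm_zero]
    positivity
  · exact zeta_summand_bound r hr s hs l h

theorem summable_zetaExcept (l₀ z : ℂ) :
    Summable (fun l : L.lattice => if (l : ℂ) = l₀ then 0 else
      (1 / (z - l) + 1 / (l : ℂ) + z / (l : ℂ) ^ 2)) :=
  ((hasSumLocallyUniformly_zetaExcept L l₀).hasSum (x := z)).summable

/-- The summand of the series of the zeta function. -/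
noncomputable def zetaSummand (z l : ℂ) : ℂ := 1 / (z - l) + 1 / l + z / l ^ 2

theorem summable_zeta (z : ℂ) : Summable (fun l : L.lattice => zetaSummand z l) := by
  obtain ⟨w, hw⟩ : ∃ w : ℂ, w ∉ L.lattice := ⟨_, L.ω₁_div_two_notMem_lattice⟩
  refine (summable_zetaExcept L w z).congr fun l => ?_
  rw [if_neg, zetaSummand]
  rintro rfl
  exact hw l.2

theorem analyticAt_zetaExcept (l₀ : ℂ) : AnalyticAt ℂ (zetaExcept L l₀) l₀ := by
  have h : DifferentiableOn ℂ (zetaExcept L l₀) (L.lattice \ {l₀})ᶜ := by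
    refine (hasSumLocallyUniformly_zetaExcept L l₀).hasSumLocallyUniformlyOn.differentiableOn
      (.of_forall fun s => .fun_sum fun i hi => ?_) L.isOpen_compl_lattice_sdiff
    split_ifs with hi0
    · simp
    · refine .add (.add (.div (by fun_prop) (by fun_prop) fun x hx h0 => hx ?_) (by fun_prop))
        (by fun_prop)
      rw [sub_eq_zero] at h0
      subst h0
      exact ⟨i.2, hi0⟩
  exact h.analyticAt (L.compl_lattice_sdiff_singleton_mem_nhds l₀)

theorem zeta_eq_zetaExcept_of_notMem {l₀ : ℂ} (h : l₀ ∉ L.lattice) (z : ℂ) :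
    weierstrassZeta L z = zetaExcept L l₀ z := by
  refine tsum_congr fun l => ?_
  rw [if_neg]
  rintro rfl
  exact h l.2

theorem zeta_eq_zetaExcept_add (l₀ : L.lattice) (z : ℂ) :
    weierstrassZeta L z
      = zetaExcept L l₀ z + (1 / (z - l₀) + 1 / (l₀ : ℂ) + z / (l₀ : ℂ) ^ 2) := by
  classical
  refine ((summable_zeta L z).tsum_eq_add_tsum_ite l₀).trans ?_
  rw [add_comm]
  congr 1
  refine tsum_congr fun l => ?_
  by_cases h : l = l₀
  · rw [if_pos h, if_pos (congrArg _ h)]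
  · rw [if_neg h, if_neg fun h' => h (Subtype.ext h'), zetaSummand]

theorem analyticAt_zeta {z : ℂ} (hz : z ∉ L.lattice) : AnalyticAt ℂ (weierstrassZeta L) z := by
  have h : weierstrassZeta L = zetaExcept L z :=
    funext fun w => zeta_eq_zetaExcept_of_notMem L hz w
  rw [h]
  exact analyticAt_zetaExcept L z

/-- At a lattice point the zeta function has a simple pole of residue `1`. -/
theorem exists_zeta_eq_inv_add {l : ℂ} (hl : l ∈ L.lattice) :
    ∃ E : ℂ → ℂ, AnalyticAt ℂ E l ∧ ∀ z, weierstrassZeta L z = 1 / (z - l) + E z := by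
  refine ⟨fun z => zetaExcept L l z + (1 / l + z / l ^ 2), ?_, fun z => ?_⟩
  · have := analyticAt_zetaExcept L l
    simp only [div_eq_mul_inv]
    fun_prop
  · rw [zeta_eq_zetaExcept_add L ⟨l, hl⟩ z]
    ring

theorem meromorphic_zeta : Meromorphic (weierstrassZeta L) := by
  intro z
  by_cases hz : z ∈ L.lattice
  · obtain ⟨E, hE, h⟩ := exists_zeta_eq_inv_add L hz
    have h2 : weierstrassZeta L = fun z' => 1 / (z' - z) + E z' := funext h
    rw [h2]
    have h3 : MeromorphicAt (fun z' => 1 / (z' - z)) z :=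
      (MeromorphicAt.const 1 z).fun_div (by fun_prop)
    exact h3.fun_add hE.meromorphicAt
  · exact (analyticAt_zeta L hz).meromorphicAt

theorem zeta_neg (z : ℂ) : weierstrassZeta L (-z) = -weierstrassZeta L z := by
  rw [weierstrassZeta, weierstrassZeta, ← tsum_neg, ← (Equiv.neg L.lattice).tsum_eq]
  refine tsum_congr fun l => ?_
  simp only [Equiv.neg_apply, Submodule.coe_neg]
  have : -z - -(l : ℂ) = -(z - l) := by ring
  rw [this, div_neg, div_neg, neg_sq]
  ring

/-- The quasi-period of the zeta function attached to a lattice element. -/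
noncomputable def quasiPeriod (l : ℂ) : ℂ := weierstrassZeta L l - weierstrassZeta L 0

/-- Reordering the series shows that `ζ(z + l) - ζ(z)` is affine in `z`, and the oddness of `ζ`
that its slope vanishes. -/
theorem zeta_add {l : ℂ} (hl : l ∈ L.lattice) (z : ℂ) :
    weierstrassZeta L (z + l) = weierstrassZeta L z + quasiPeriod L l := by
  have aff : ∃ A B : ℂ, ∀ z, weierstrassZeta L (z + l) - weierstrassZeta L z = A + B * z := by
    lift l to L.lattice using hl
    have shift : ∀ z (k : L.lattice),
        zetaSummand (z + l) ((k + l : L.lattice) : ℂ) - zetaSummand z k =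
        (1 / ((k : ℂ) + l) - 1 / (k : ℂ) + l / ((k : ℂ) + l) ^ 2)
          + z * (1 / ((k : ℂ) + l) ^ 2 - 1 / (k : ℂ) ^ 2) := by
      intro z k
      rw [zetaSummand, zetaSummand, Submodule.coe_add, show z + l - (k + l) = z - k by ring]
      ring
    have hsh : ∀ z, Summable fun k : L.lattice => zetaSummand (z + l) ((k + l : L.lattice) : ℂ) :=
      fun z => (Equiv.summable_iff (f := fun k : L.lattice => zetaSummand (z + l) k)
        (Equiv.addRight l)).2 (summable_zeta L (z + l))
    have hts : ∀ z, ∑' k : L.lattice, zetaSummand (z + l) ((k + l : L.lattice) : ℂ)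
        = weierstrassZeta L (z + l) := fun z =>
      Equiv.tsum_eq (Equiv.addRight l) (fun k : L.lattice => zetaSummand (z + l) k)
    have hs : ∀ z, weierstrassZeta L (z + l) - weierstrassZeta L z = ∑' k : L.lattice,
        ((1 / ((k : ℂ) + l) - 1 / (k : ℂ) + l / ((k : ℂ) + l) ^ 2)
          + z * (1 / ((k : ℂ) + l) ^ 2 - 1 / (k : ℂ) ^ 2)) := by
      intro z
      rw [← hts z]
      exact ((hsh z).tsum_sub (summable_zeta L z)).symm.trans (tsum_congr (shift z))
    have hsum : ∀ z, Summable fun k : L.lattice =>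
        ((1 / ((k : ℂ) + l) - 1 / (k : ℂ) + l / ((k : ℂ) + l) ^ 2)
          + z * (1 / ((k : ℂ) + l) ^ 2 - 1 / (k : ℂ) ^ 2)) := fun z =>
      ((hsh z).sub (summable_zeta L z)).congr (shift z)
    have h0 := hsum 0
    simp only [zero_mul, add_zero] at h0
    have h1 : Summable fun k : L.lattice => (1 / ((k : ℂ) + l) ^ 2 - 1 / (k : ℂ) ^ 2) := by
      refine ((hsum 1).sub h0).congr fun k => ?_
      ring
    refine ⟨∑' k : L.lattice, (1 / ((k : ℂ) + l) - 1 / (k : ℂ) + l / ((k : ℂ) + l) ^ 2),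
      ∑' k : L.lattice, (1 / ((k : ℂ) + l) ^ 2 - 1 / (k : ℂ) ^ 2), fun z => ?_⟩
    rw [hs z, h0.tsum_add (h1.mul_left z), tsum_mul_left, mul_comm z]
  obtain ⟨A, B, h⟩ := aff
  have hB : ∀ z, -2 * B * z = -B * l := by
    intro z
    have h1 := h (-z)
    have h2 := h (z - l)
    rw [zeta_neg, show -z + l = -(z - l) by ring, zeta_neg] at h1
    rw [sub_add_cancel] at h2
    linear_combination h2 - h1
  have hB0 : B = 0 := by
    have h1 := hB 0
    have h2 := hB 1
    linear_combination (-1 / 2 : ℂ) * (h2 - h1)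
  have h1 := h z
  have h2 := h 0
  rw [zero_add] at h2
  rw [quasiPeriod]
  rw [hB0] at h1 h2
  linear_combination h1 - h2

/-! ### Elliptic functions: Liouville's theorem and the residue theorem -/

variable {L}

theorem HasPeriods.of_eventuallyEq {f g : ℂ → ℂ} (hf : HasPeriods f L)
    (h : f =ᶠ[codiscrete ℂ] g) : HasPeriods g L := fun l hl =>
  ((eventuallyEq_codiscrete_add h l).symm.trans (hf l hl)).trans h

theorem HasPeriods.sub_mem {f : ℂ → ℂ} (hf : HasPeriods f L) {l : ℂ} (hl : l ∈ L.lattice) :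
    (fun z => f (z - l)) =ᶠ[codiscrete ℂ] f := by
  simpa [sub_eq_add_neg] using hf (-l) (neg_mem hl)

theorem HasPeriods.deriv {f : ℂ → ℂ} (hf : HasPeriods f L) : HasPeriods (deriv f) L := by
  intro l hl
  have h := deriv_congr_codiscrete (hf l hl)
  filter_upwards [h] with z hz
  rwa [deriv_comp_add_const] at hz

theorem eq_const_of_hasPeriods {f : ℂ → ℂ} (hf : Differentiable ℂ f) (hL : HasPeriods f L) :
    ∃ a, ∀ z, f z = a := by
  refine ⟨f 0, fun z => ?_⟩
  refine hf.apply_eq_apply_of_bounded (IsZLattice.isCompact_range_of_periodic L.lattice _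
    hf.continuous fun z w hw => ?_).isBounded z 0
  have h := eq_of_eventuallyEq_codiscrete (hf.continuous.comp (continuous_add_const w))
    hf.continuous (hL w hw)
  exact congrFun h z

/-- Liouville's theorem: an elliptic function without poles is constant. -/
theorem eventuallyEq_const_of_hasPeriods {f : ℂ → ℂ} (hf : Meromorphic f) (hL : HasPeriods f L)
    (h : ∀ z, 0 ≤ meromorphicOrderAt f z) : ∃ a, f =ᶠ[codiscrete ℂ] fun _ => a := by
  obtain ⟨g, hg, hfg⟩ := exists_differentiable_of_order_nonneg hf h
  obtain ⟨a, ha⟩ := eq_const_of_hasPeriods hg (hL.of_eventuallyEq hfg)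
  exact ⟨a, hfg.trans (.of_forall ha)⟩

variable {L : PeriodPair}

theorem order_add_of_periodic {f : ℂ → ℂ} {l : ℂ}
    (h : (fun z => f (z + l)) =ᶠ[codiscrete ℂ] f) (z : ℂ) :
    meromorphicOrderAt f (z + l) = meromorphicOrderAt f z := by
  rw [← meromorphicOrderAt_congr (nhdsNE_of_codiscrete h z)]
  exact meromorphicOrderAt_fun_comp_add_const_eq_meromorphicOrderAt.symm

theorem analyticAt_comp_sub {f : ℂ → ℂ} {z c : ℂ} (h : AnalyticAt ℂ f (z - c)) :
    AnalyticAt ℂ (fun w => f (w - c)) z :=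
  h.fun_comp_of_eq (by fun_prop) rfl

theorem order_nonneg_add {f g : ℂ → ℂ} {z : ℂ} (hf : MeromorphicAt f z) (hg : MeromorphicAt g z)
    (h1 : 0 ≤ meromorphicOrderAt f z) (h2 : 0 ≤ meromorphicOrderAt g z) :
    0 ≤ meromorphicOrderAt (fun x => f x + g x) z :=
  (le_min h1 h2).trans (meromorphicOrderAt_add hf hg)

/-- A solution of `y' = a + b y` has no poles. -/
theorem order_nonneg_of_linear_ode {y : ℂ → ℂ} {z a b : ℂ} (hy : MeromorphicAt y z)
    (h : ∀ᶠ x in 𝓝[≠] z, deriv y x = a + b * y x) : 0 ≤ meromorphicOrderAt y z := by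
  classical
  by_contra hneg
  rw [not_le] at hneg
  obtain ⟨n, hn⟩ := WithTop.ne_top_iff_exists.1 hneg.ne_top
  have hn0 : n < 0 := by
    rw [← hn] at hneg
    exact_mod_cast hneg
  have h1 : meromorphicOrderAt (deriv y) z = ((n - 1 : ℤ) : WithTop ℤ) :=
    meromorphicOrderAt_deriv_eq_sub_one (by exact_mod_cast hn0.ne) hn.symm
  have h2 : meromorphicOrderAt (deriv y) z
      = meromorphicOrderAt ((fun _ => a) + (fun _ => b) * y) z :=
    meromorphicOrderAt_congr h
  have h3 := meromorphicOrderAt_add (MeromorphicAt.const a z)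
    ((MeromorphicAt.const b z).mul hy)
  rw [← h2, h1, meromorphicOrderAt_mul (MeromorphicAt.const b z) hy, ← hn,
    meromorphicOrderAt_const, meromorphicOrderAt_const] at h3
  have h4 : ((n : ℤ) : WithTop ℤ) ≤ ((n - 1 : ℤ) : WithTop ℤ) := by
    refine le_trans (le_min ?_ ?_) h3
    · split_ifs
      · exact le_top
      · exact_mod_cast hn0.le
    · split_ifs
      · simp
      · simp
  have : n ≤ n - 1 := by exact_mod_cast h4
  omega

/-- The quasi-periods are not proportional to the periods: otherwise subtracting a linear function
from `ζ` would give an elliptic function `h` with a single simple pole. Then `h' + h²` is a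
constant `k²` by Liouville's theorem, and `1 / (h - k)` is entire and elliptic, hence constant. -/
theorem quasiPeriod_not_proportional (lam : ℂ) :
    ¬ ∀ l ∈ L.lattice, quasiPeriod L l = lam * l := by
  intro hlam
  set h : ℂ → ℂ := fun z => weierstrassZeta L z - lam * z with hh
  have hlin : Meromorphic fun z : ℂ => lam * z :=
    meromorphic_of_differentiable (by fun_prop)
  have hm : Meromorphic h := (meromorphic_zeta L).sub hlin
  have hper : ∀ l ∈ L.lattice, ∀ z, h (z + l) = h z := by
    intro l hl z
    simp only [hh, zeta_add L hl, hlam l hl]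
    ring
  have hneg : ∀ z, h (-z) = -h z := by
    intro z
    simp only [hh, zeta_neg]
    ring
  obtain ⟨E, hE, hEz⟩ := exists_zeta_eq_inv_add L (zero_mem L.lattice)
  -- near the origin `h = 1/z + z D`, by oddness
  obtain ⟨D, hD, hDz⟩ : ∃ D : ℂ → ℂ, AnalyticAt ℂ D 0 ∧
      ∀ᶠ z in 𝓝[≠] (0 : ℂ), h z = 1 / z + z * D z := by
    have hF : AnalyticAt ℂ (fun z => E z - lam * z) 0 := by fun_prop
    have hF0 : (fun z => E z - lam * z) 0 = 0 := by
      have h1 : ∀ᶠ z in 𝓝[≠] (0 : ℂ), E (-z) = -E z := by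
        filter_upwards [self_mem_nhdsWithin] with z hz
        have := hEz (-z)
        rw [zeta_neg, hEz z, sub_zero, sub_zero, div_neg] at this
        linear_combination -this
      have hE' : ContinuousAt (fun z => E (-z)) 0 := by
        refine ContinuousAt.comp (g := E) (f := fun z : ℂ => -z) ?_ continuousAt_neg
        simpa using hE.continuousAt
      have h2 := eq_of_eventually_nhdsNE hE' hE.continuousAt.neg h1
      simp only [neg_zero, Pi.neg_apply] at h2
      have h3 : E 0 = 0 := by linear_combination (1 / 2 : ℂ) * h2
      simp [h3]
    refine ⟨dslope (fun z => E z - lam * z) 0, ?_, ?_⟩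
    · obtain ⟨p, hp⟩ := hF
      exact ⟨_, hp.has_fpower_series_dslope_fslope⟩
    · filter_upwards [self_mem_nhdsWithin] with z hz
      have hz0 : z ≠ 0 := hz
      have h1 := sub_smul_dslope (fun z => E z - lam * z) 0 z
      simp only [hF0, sub_zero, smul_eq_mul] at h1
      rw [h1]
      simp only [hh, hEz, sub_zero]
      ring
  -- `h' + h²` has no poles
  have hQ : Meromorphic (fun z => deriv h z + h z ^ 2) := hm.deriv.add (hm.pow (n := 2))
  have hQper : HasPeriods (fun z => deriv h z + h z ^ 2) L := by
    intro l hl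
    refine .of_forall fun z => ?_
    have : deriv h (z + l) = deriv h z := by
      rw [← deriv_comp_add_const, funext (hper l hl)]
    simp only [this, hper l hl]
  have hQ0 : 0 ≤ meromorphicOrderAt (fun z => deriv h z + h z ^ 2) 0 := by
    have hA : AnalyticAt ℂ (fun z => 3 * D z + z * deriv D z + z ^ 2 * D z ^ 2) 0 := by
      have := hD.deriv
      fun_prop
    refine order_nonneg_of_eventuallyEq hA ?_
    filter_upwards [eventually_nhdsNE_nhds hDz, hDz,
      hD.eventually_analyticAt.filter_mono nhdsWithin_le_nhds, self_mem_nhdsWithin]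
      with z h1 h2 h3 hz
    have hz0 : z ≠ 0 := hz
    have h4 : HasDerivAt (fun z => 1 / z + z * D z)
        (-1 / z ^ 2 + (1 * D z + z * deriv D z)) z := by
      refine HasDerivAt.add ?_ ((hasDerivAt_id z).mul h3.differentiableAt.hasDerivAt)
      have h5 : HasDerivAt (fun z : ℂ => 1 / z) (-(z ^ 2)⁻¹) z := by
        simpa only [one_div] using hasDerivAt_inv hz0
      exact h5.congr_deriv (by ring)
    rw [EventuallyEq.deriv_eq h1, h4.deriv, h2]
    field_simp
    ring
  have hQord : ∀ z, 0 ≤ meromorphicOrderAt (fun z => deriv h z + h z ^ 2) z := by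
    intro z
    by_cases hz : z ∈ L.lattice
    · have h1 := order_add_of_periodic (f := fun z => deriv h z + h z ^ 2) (hQper z hz) 0
      rw [zero_add] at h1
      rw [h1]
      exact hQ0
    · have h1 : AnalyticAt ℂ h z := (analyticAt_zeta L hz).sub (by fun_prop)
      exact (h1.deriv.add (h1.pow 2)).meromorphicOrderAt_nonneg
  obtain ⟨a, ha⟩ := eventuallyEq_const_of_hasPeriods hQ hQper hQord
  obtain ⟨k, hk⟩ := IsAlgClosed.exists_pow_nat_eq a (n := 2) two_pos
  have hcont : ∀ b c : ℂ, (∀ᶠ z in 𝓝[≠] (0 : ℂ), b * (h z - k) = c) → b = 0 ∧ c = 0 := by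
    intro b c hbc
    have h1 : ∀ᶠ z in 𝓝[≠] (0 : ℂ), b * (1 + z ^ 2 * D z - k * z) = c * z := by
      filter_upwards [hbc, hDz, self_mem_nhdsWithin] with z h2 h3 hz
      have hz0 : z ≠ 0 := hz
      rw [← h2, h3]
      field_simp
    have hDc := hD.continuousAt
    have h2 := eq_of_eventually_nhdsNE (by fun_prop) (by fun_prop) h1
    have hb : b = 0 := by simpa using h2
    refine ⟨hb, ?_⟩
    obtain ⟨z, hz⟩ := hbc.exists
    simpa [hb] using hz.symm
  have hk0 : Meromorphic fun _ : ℂ => k := Meromorphic.const k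
  have hne : ∀ᶠ z in codiscrete ℂ, h z ≠ k := by
    refine eventually_ne_codiscrete hm hk0 fun he => ?_
    have h1 := hcont 1 0 ((nhdsNE_of_codiscrete he 0).mono fun z hz => by simp [hz])
    exact one_ne_zero h1.1
  set y : ℂ → ℂ := fun z => (h z - k)⁻¹ with hy
  have hym : Meromorphic y := (hm.sub hk0).inv
  have hyd : ∀ᶠ z in codiscrete ℂ, deriv y z = 1 + 2 * k * y z := by
    filter_upwards [ha, hne, eventually_analyticAt_codiscrete hm] with z h1 h2 h3
    have h4 : h z - k ≠ 0 := sub_ne_zero.2 h2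
    have h5 : HasDerivAt (fun z => h z - k) (deriv h z) z :=
      h3.differentiableAt.hasDerivAt.sub_const k
    rw [hy, (h5.fun_inv h4).deriv]
    field_simp
    linear_combination -h1 + hk
  have hyper : HasPeriods y L := fun l hl => .of_forall fun z => by simp [hy, hper l hl]
  obtain ⟨b, hb⟩ := eventuallyEq_const_of_hasPeriods hym hyper fun z =>
    order_nonneg_of_linear_ode (hym z) (nhdsNE_of_codiscrete hyd z)
  have h1 := hcont b 1 <| nhdsNE_of_codiscrete (by
    filter_upwards [hb, hne] with z h1 h2
    rw [← h1, hy]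
    exact inv_mul_cancel₀ (sub_ne_zero.2 h2)) 0
  exact one_ne_zero h1.2

/-- The principal parts `1 / zⁿ`, `n ≥ 2`, are realised by elliptic functions with poles at the
lattice points only, the derivatives of the zeta function. -/
theorem exists_elliptic_principal_part (n : ℕ) :
    ∃ P : ℂ → ℂ, Meromorphic P ∧ HasPeriods P L ∧ (∀ z, z ∉ L.lattice → AnalyticAt ℂ P z) ∧
      ∃ E : ℂ → ℂ, AnalyticAt ℂ E 0 ∧ ∀ᶠ z in 𝓝[≠] (0 : ℂ), P z = 1 / z ^ (n + 2) + E z := by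
  have step : ∀ (n : ℕ) (Q : ℂ → ℂ), n ≠ 0 → (∃ E : ℂ → ℂ, AnalyticAt ℂ E 0 ∧
      ∀ᶠ z in 𝓝[≠] (0 : ℂ), Q z = 1 / z ^ n + E z) → ∃ E : ℂ → ℂ, AnalyticAt ℂ E 0 ∧
      ∀ᶠ z in 𝓝[≠] (0 : ℂ), -(1 / (n : ℂ)) * deriv Q z = 1 / z ^ (n + 1) + E z := by
    rintro n Q hn ⟨E, hE, h⟩
    refine ⟨fun z => -(1 / (n : ℂ)) * deriv E z, by have := hE.deriv; fun_prop, ?_⟩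
    filter_upwards [eventually_nhdsNE_nhds h, self_mem_nhdsWithin,
      hE.eventually_analyticAt.filter_mono nhdsWithin_le_nhds] with z h1 hz h2
    have hz0 : z ≠ 0 := hz
    have hn0 : (n : ℂ) ≠ 0 := by exact_mod_cast hn
    have h3 : HasDerivAt (fun z => 1 / z ^ n + E z)
        (-(n * z ^ (n - 1)) / (z ^ n) ^ 2 + deriv E z) z := by
      refine HasDerivAt.add ?_ h2.differentiableAt.hasDerivAt
      simpa [one_div] using (hasDerivAt_pow n z).fun_inv (pow_ne_zero n hz0)
    rw [EventuallyEq.deriv_eq h1, h3.deriv]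
    obtain ⟨m, rfl⟩ := Nat.exists_eq_succ_of_ne_zero hn
    simp only [Nat.succ_eq_add_one, Nat.add_sub_cancel] at hn0 ⊢
    field_simp
    ring
  induction n with
  | zero =>
    obtain ⟨E, hE, hEz⟩ := exists_zeta_eq_inv_add L (zero_mem L.lattice)
    obtain ⟨E', hE', h'⟩ := step 1 (weierstrassZeta L) one_ne_zero
      ⟨E, hE, .of_forall fun z => by simpa using hEz z⟩
    refine ⟨fun z => -(1 / ((1 : ℕ) : ℂ)) * deriv (weierstrassZeta L) z,
      (Meromorphic.const _).mul (meromorphic_zeta L).deriv, fun l hl => .of_forall fun z => ?_,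
      fun z hz => ?_, E', hE', h'⟩
    · have h1 : (fun z => weierstrassZeta L (z + l))
          = fun z => weierstrassZeta L z + quasiPeriod L l := funext (zeta_add L hl)
      have h2 : deriv (weierstrassZeta L) (z + l) = deriv (weierstrassZeta L) z := by
        rw [← deriv_comp_add_const, h1, deriv_add_const]
      simp only [h2]
    · have := (analyticAt_zeta L hz).deriv
      fun_prop
  | succ n ih =>
    obtain ⟨P, hP, hper, han, hE⟩ := ih
    obtain ⟨E', hE', h'⟩ := step (n + 2) P (by omega) hE
    refine ⟨fun z => -(1 / ((n + 2 : ℕ) : ℂ)) * deriv P z,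
      (Meromorphic.const _).mul hP.deriv, fun l hl => ?_, fun z hz => ?_, E', hE', h'⟩
    · filter_upwards [hper.deriv l hl] with z hz
      rw [hz]
    · have := (han z hz).deriv
      fun_prop

/-- If the poles of an elliptic function are simple, their residues sum to zero and the function is
a combination of zeta functions and a constant. -/
theorem sum_residues_of_simple_poles {ι : Type*} {f : ℂ → ℂ} (hf : Meromorphic f)
    (hL : HasPeriods f L) (S : Finset ι) (x ρ : ι → ℂ)
    (hx : ∀ i ∈ S, ∀ j ∈ S, i ≠ j → x i - x j ∉ L.lattice)
    (hloc : ∀ i ∈ S, ∃ R : ℂ → ℂ, AnalyticAt ℂ R (x i) ∧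
      ∀ᶠ z in 𝓝[≠] (x i), f z = ρ i / (z - x i) + R z)
    (hreg : ∀ z, (∀ i ∈ S, z - x i ∉ L.lattice) → 0 ≤ meromorphicOrderAt f z) :
    ∑ i ∈ S, ρ i = 0 ∧
      ∃ C, f =ᶠ[codiscrete ℂ] fun z => ∑ i ∈ S, ρ i * weierstrassZeta L (z - x i) + C := by
  classical
  set s : ℂ → ℂ := fun z => ∑ i ∈ S, ρ i * weierstrassZeta L (z - x i) with hs
  have hz : ∀ c, Meromorphic fun z => weierstrassZeta L (z - c) := fun c =>
    meromorphic_comp_sub (meromorphic_zeta L) c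
  have hza : ∀ c z, z - c ∉ L.lattice → AnalyticAt ℂ (fun z => weierstrassZeta L (z - c)) z := by
    intro c z hc
    exact analyticAt_comp_sub (analyticAt_zeta L hc)
  have hsm : Meromorphic s := by
    intro z
    exact MeromorphicAt.fun_sum fun i _ => (MeromorphicAt.const _ _).mul (hz (x i) z)
  have hsper : ∀ l ∈ L.lattice, ∀ z, s (z + l) = s z + (∑ i ∈ S, ρ i) * quasiPeriod L l := by
    intro l hl z
    simp only [hs]
    rw [Finset.sum_mul, ← Finset.sum_add_distrib]
    refine Finset.sum_congr rfl fun i _ => ?_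
    rw [show z + l - x i = z - x i + l by ring, zeta_add L hl]
    ring
  have hgm : Meromorphic (fun z => f z - s z) := hf.sub hsm
  have hgper : ∀ l ∈ L.lattice, ∀ᶠ z in codiscrete ℂ,
      f (z + l) - s (z + l) = f z - s z - (∑ i ∈ S, ρ i) * quasiPeriod L l := by
    intro l hl
    filter_upwards [hL l hl] with z h1
    rw [h1, hsper l hl]
    ring
  have hgord : ∀ z, 0 ≤ meromorphicOrderAt (fun z => f z - s z) z := by
    intro z
    by_cases hzS : ∀ i ∈ S, z - x i ∉ L.lattice
    · have h1 : AnalyticAt ℂ s z :=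
        Finset.analyticAt_fun_sum S fun i hi => analyticAt_const.mul (hza (x i) z (hzS i hi))
      simp only [sub_eq_add_neg]
      exact order_nonneg_add (hf z) h1.neg.meromorphicAt (hreg z hzS)
        h1.neg.meromorphicOrderAt_nonneg
    · push Not at hzS
      obtain ⟨i, hi, hl⟩ := hzS
      -- by periodicity it suffices to look at the pole `x i` itself
      have h0 : 0 ≤ meromorphicOrderAt (fun z => f z - s z) (x i) := by
        obtain ⟨R, hR, hRz⟩ := hloc i hi
        obtain ⟨E, hE, hEz⟩ := exists_zeta_eq_inv_add L (zero_mem L.lattice)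
        have hE' : AnalyticAt ℂ (fun z => E (z - x i)) (x i) := by
          exact analyticAt_comp_sub (by simpa using hE)
        have h2 : AnalyticAt ℂ (fun z => ∑ j ∈ S.erase i, ρ j * weierstrassZeta L (z - x j))
            (x i) := by
          refine Finset.analyticAt_fun_sum _ fun j hj => analyticAt_const.mul (hza (x j) _ ?_)
          exact hx i hi j (Finset.mem_of_mem_erase hj) (Finset.ne_of_mem_erase hj).symm
        refine order_nonneg_of_eventuallyEq ((hR.fun_sub (analyticAt_const.mul hE')).fun_sub h2)
          (g := fun z => R z - ρ i * E (z - x i) -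
            ∑ j ∈ S.erase i, ρ j * weierstrassZeta L (z - x j)) ?_
        filter_upwards [hRz] with z h3
        simp only [hs]
        rw [← Finset.add_sum_erase S _ hi, h3, hEz, sub_zero]
        ring
      obtain ⟨l, hl', rfl⟩ : ∃ l ∈ L.lattice, z = x i + l := ⟨z - x i, hl, by ring⟩
      have h1 : meromorphicOrderAt (fun z => f z - s z) (x i + l)
          = meromorphicOrderAt
            (fun z => f z - s z - (∑ i ∈ S, ρ i) * quasiPeriod L l) (x i) := by
        rw [← meromorphicOrderAt_congr (nhdsNE_of_codiscrete (hgper l hl') (x i))]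
        exact (meromorphicOrderAt_fun_comp_add_const_eq_meromorphicOrderAt
          (f := fun z => f z - s z)).symm
      rw [h1]
      simp only [sub_eq_add_neg (f _ - s _)]
      exact order_nonneg_add (hgm _) (MeromorphicAt.const _ _) h0
        analyticAt_const.meromorphicOrderAt_nonneg
  obtain ⟨g, hg, hfg⟩ := exists_differentiable_of_order_nonneg hgm hgord
  have hgp : ∀ l ∈ L.lattice, ∀ z, g (z + l) = g z - (∑ i ∈ S, ρ i) * quasiPeriod L l := by
    intro l hl z
    refine congrFun (eq_of_eventuallyEq_codiscrete (f := fun z => g (z + l))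
      (g := fun z => g z - (∑ i ∈ S, ρ i) * quasiPeriod L l) ?_ ?_ ?_) z
    · exact hg.continuous.comp (continuous_add_const l)
    · have := hg.continuous
      fun_prop
    · filter_upwards [hgper l hl, hfg, eventuallyEq_codiscrete_add hfg l] with z h1 h2 h3
      rw [← h3, ← h2, h1]
  have hg' : HasPeriods (deriv g) L := by
    intro l hl
    refine .of_forall fun z => ?_
    simp only
    rw [← deriv_comp_add_const, funext (hgp l hl), deriv_sub_const]
  obtain ⟨a, ha⟩ := eq_const_of_hasPeriods hg.deriv hg'
  obtain ⟨b, hb⟩ : ∃ b, ∀ z, g z = a * z + b := by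
    have h1 : Differentiable ℂ fun z => g z - a * z := by fun_prop
    refine ⟨g 0, fun z => ?_⟩
    have h2 := is_const_of_deriv_eq_zero h1 (fun z => ?_) z 0
    · simp only [mul_zero, sub_zero] at h2
      linear_combination h2
    · have h3 : HasDerivAt (fun z => g z - a * z) (deriv g z - a * 1) z :=
        (hg z).hasDerivAt.sub ((hasDerivAt_id z).const_mul a)
      rw [h3.deriv, ha]
      ring
  -- `f - s` is entire and additively quasi-periodic, hence affine; comparing increments
  -- `a l = -(∑ ρ) η(l)` for every period `l`.
  have hrel : ∀ l ∈ L.lattice, a * l = -((∑ i ∈ S, ρ i) * quasiPeriod L l) := by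
    intro l hl
    have h1 := hgp l hl 0
    rw [hb, hb] at h1
    linear_combination h1
  have hsum : ∑ i ∈ S, ρ i = 0 := by
    by_contra hne
    refine quasiPeriod_not_proportional (L := L) (-a / ∑ i ∈ S, ρ i) fun l hl => ?_
    field_simp
    linear_combination hrel l hl
  have ha0 : a = 0 := by
    have h1 := hrel L.ω₁ L.ω₁_mem_lattice
    rw [hsum, zero_mul, neg_zero] at h1
    refine (mul_eq_zero.1 h1).resolve_right fun h2 => L.ω₁_div_two_notMem_lattice ?_
    simp [h2]
  refine ⟨hsum, b, ?_⟩
  filter_upwards [hfg] with z h1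
  rw [hb, ha0] at h1
  linear_combination h1

/-- The residue theorem for elliptic functions. -/
theorem sum_residues_eq_zero {ι : Type*} {f : ℂ → ℂ} (hf : Meromorphic f)
    (hL : HasPeriods f L) (S : Finset ι) (x : ι → ℂ) (K : ℕ) (c : ι → ℕ → ℂ)
    (hx : ∀ i ∈ S, ∀ j ∈ S, i ≠ j → x i - x j ∉ L.lattice)
    (hloc : ∀ i ∈ S, ∃ R : ℂ → ℂ, AnalyticAt ℂ R (x i) ∧
      ∀ᶠ z in 𝓝[≠] (x i), f z = ∑ k ∈ Finset.range (K + 1), c i k / (z - x i) ^ (k + 1) + R z)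
    (hreg : ∀ z, (∀ i ∈ S, z - x i ∉ L.lattice) → 0 ≤ meromorphicOrderAt f z) :
    ∑ i ∈ S, c i 0 = 0 := by
  classical
  -- subtracting the elliptic functions `s` with the multiple poles of `f` leaves simple poles
  choose P hP hPper hPan E hE hPE using fun n => exists_elliptic_principal_part (L := L) n
  set s : ℂ → ℂ := fun z => ∑ i ∈ S, ∑ k ∈ Finset.range K, c i (k + 1) * P k (z - x i) with hs
  have hterm : ∀ i k, Meromorphic fun z => c i (k + 1) * P k (z - x i) := fun i k =>
    (Meromorphic.const _).mul (meromorphic_comp_sub (hP k) (x i))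
  have han : ∀ i k z, z - x i ∉ L.lattice →
      AnalyticAt ℂ (fun z => c i (k + 1) * P k (z - x i)) z := by
    intro i k z hz
    exact analyticAt_const.mul (analyticAt_comp_sub (hPan k _ hz))
  have hsm : Meromorphic s := fun z =>
    MeromorphicAt.fun_sum fun i _ => MeromorphicAt.fun_sum fun k _ => hterm i k z
  have hsper : HasPeriods s L := by
    intro l hl
    have h1 : ∀ i ∈ S, ∀ k ∈ Finset.range K,
        ∀ᶠ z in codiscrete ℂ, P k (z - x i + l) = P k (z - x i) := fun i _ k _ => by
      simpa [sub_eq_add_neg] using eventually_codiscrete_add (hPper k l hl) (-x i)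
    have h2 : ∀ᶠ z in codiscrete ℂ, ∀ i ∈ S, ∀ k ∈ Finset.range K,
        P k (z - x i + l) = P k (z - x i) :=
      (Filter.eventually_all_finset S).2 fun i hi =>
        (Filter.eventually_all_finset _).2 (h1 i hi)
    filter_upwards [h2] with z h3
    refine Finset.sum_congr rfl fun i hi => Finset.sum_congr rfl fun k hk => ?_
    rw [← h3 i hi k hk, add_sub_right_comm]
  refine (sum_residues_of_simple_poles (f := fun z => f z - s z) (hf.sub hsm) (fun l hl => ?_)
    S x (fun i => c i 0) hx (fun i hi => ?_) fun z hz => ?_).1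
  · filter_upwards [hL l hl, hsper l hl] with z h1 h2
    rw [h1, h2]
  · obtain ⟨R, hR, hRz⟩ := hloc i hi
    have hE' : ∀ k, AnalyticAt ℂ (fun z => E k (z - x i)) (x i) := by
      intro k
      exact analyticAt_comp_sub (by simpa using hE k)
    have hPE' : ∀ᶠ z in 𝓝[≠] (x i), ∀ k ∈ Finset.range K,
        P k (z - x i) = 1 / (z - x i) ^ (k + 2) + E k (z - x i) := by
      refine (Filter.eventually_all_finset _).2 fun k _ => ?_
      have h1 := tendsto_affine_nhdsNE 1 (-x i) (x i) one_ne_zero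
      simp only [one_mul, add_neg_cancel, ← sub_eq_add_neg] at h1
      exact h1.eventually (hPE k)
    refine ⟨fun z => R z - ∑ k ∈ Finset.range K, c i (k + 1) * E k (z - x i)
      - ∑ j ∈ S.erase i, ∑ k ∈ Finset.range K, c j (k + 1) * P k (z - x j), ?_, ?_⟩
    · refine (hR.fun_sub (Finset.analyticAt_fun_sum _ fun k _ =>
        analyticAt_const.mul (hE' k))).fun_sub (Finset.analyticAt_fun_sum _ fun j hj =>
        Finset.analyticAt_fun_sum _ fun k _ => han j k _ ?_)
      exact hx i hi j (Finset.mem_of_mem_erase hj) (Finset.ne_of_mem_erase hj).symm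
    · filter_upwards [hRz, hPE'] with z h1 h2
      simp only [hs]
      rw [← Finset.add_sum_erase S _ hi, h1, Finset.sum_range_succ']
      have h3 : ∑ k ∈ Finset.range K, c i (k + 1) * P k (z - x i)
          = ∑ k ∈ Finset.range K, c i (k + 1) / (z - x i) ^ (k + 1 + 1)
            + ∑ k ∈ Finset.range K, c i (k + 1) * E k (z - x i) := by
        rw [← Finset.sum_add_distrib]
        refine Finset.sum_congr rfl fun k hk => ?_
        rw [h2 k hk]
        ring
      rw [h3, zero_add, pow_one]
      ring
  · have h1 : AnalyticAt ℂ s z := Finset.analyticAt_fun_sum _ fun i hi =>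
      Finset.analyticAt_fun_sum _ fun k _ => han i k z (hz i hi)
    simp only [sub_eq_add_neg]
    exact order_nonneg_add (hf z) h1.neg.meromorphicAt (hreg z hz)
      h1.neg.meromorphicOrderAt_nonneg

/-! ### Uniqueness for linear differential systems with a regular singular point -/

/-- An analytic function vanishing at `z₀` is a multiple of `z - z₀`. -/
theorem exists_eq_sub_mul {f : ℂ → ℂ} {z₀ : ℂ} (hf : AnalyticAt ℂ f z₀) (h0 : f z₀ = 0) :
    ∃ g : ℂ → ℂ, AnalyticAt ℂ g z₀ ∧ ∀ z, f z = (z - z₀) * g z := by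
  refine ⟨dslope f z₀, ?_, fun z => ?_⟩
  · obtain ⟨p, hp⟩ := hf
    exact ⟨_, hp.has_fpower_series_dslope_fslope⟩
  · have h1 := sub_smul_dslope f z₀ z
    rw [h0, sub_zero, smul_eq_mul] at h1
    exact h1.symm

/-- An analytic function vanishing to every order is zero. -/
theorem eventually_zero_of_forall_pow {f : ℂ → ℂ} {z₀ : ℂ} (hf : AnalyticAt ℂ f z₀)
    (h : ∀ n : ℕ, ∃ g : ℂ → ℂ, AnalyticAt ℂ g z₀ ∧ ∀ᶠ z in 𝓝 z₀, f z = (z - z₀) ^ n * g z) :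
    ∀ᶠ z in 𝓝 z₀, f z = 0 := by
  refine analyticOrderAt_eq_top.1 (ENat.eq_top_iff_forall_ge.2 fun n => ?_)
  rw [natCast_le_analyticOrderAt hf]
  obtain ⟨g, hg, hfg⟩ := h n
  exact ⟨g, hg, hfg.mono fun z hz => by rw [hz, smul_eq_mul]⟩

/-- Uniqueness of the analytic solution of a linear system `(z - z₀) δ' = L δ` vanishing at `z₀`,
when no positive integer is an eigenvalue of `L z₀`. -/
theorem eventually_zero_of_fuchsian {ι : Type*} [Fintype ι] {z₀ : ℂ} (δ : ι → ℂ → ℂ)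
    (hδ : ∀ i, AnalyticAt ℂ (δ i) z₀) (h0 : ∀ i, δ i z₀ = 0) (L : ι → ι → ℂ → ℂ)
    (hL : ∀ i j, ContinuousAt (L i j) z₀)
    (hode : ∀ i, ∀ᶠ z in 𝓝 z₀, (z - z₀) * deriv (δ i) z = ∑ j, L i j z * δ j z)
    (hres : ∀ n : ℕ, 1 ≤ n → ∀ w : ι → ℂ, (∀ i, n * w i = ∑ j, L i j z₀ * w j) → ∀ i, w i = 0)
    (i : ι) : ∀ᶠ z in 𝓝 z₀, δ i z = 0 := by
  have key : ∀ n : ℕ, ∃ A : ι → ℂ → ℂ, (∀ i, AnalyticAt ℂ (A i) z₀) ∧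
      ∀ i, ∀ᶠ z in 𝓝 z₀, δ i z = (z - z₀) ^ (n + 1) * A i z := by
    intro n
    induction n with
    | zero =>
      choose A hA hA' using fun i => exists_eq_sub_mul (hδ i) (h0 i)
      exact ⟨A, hA, fun i => .of_forall fun z => by simpa using hA' i z⟩
    | succ n ih =>
      obtain ⟨A, hA, hAz⟩ := ih
      have h1 : ∀ i, A i z₀ = 0 := by
        refine hres (n + 1) (by omega) (fun i => A i z₀) fun i => ?_
        have h2 : ∀ᶠ z in 𝓝[≠] z₀, ((n + 1 : ℕ) : ℂ) * A i z + (z - z₀) * deriv (A i) z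
            = ∑ j, L i j z * A j z := by
          have h3 : ∀ᶠ z in 𝓝[≠] z₀, ∀ j, δ j z = (z - z₀) ^ (n + 1) * A j z :=
            (eventually_all.2 hAz).filter_mono nhdsWithin_le_nhds
          filter_upwards [h3, eventually_nhdsNE_nhds ((hAz i).filter_mono nhdsWithin_le_nhds),
            (hode i).filter_mono nhdsWithin_le_nhds, self_mem_nhdsWithin,
            (hA i).eventually_analyticAt.filter_mono nhdsWithin_le_nhds] with z h4 h5 h6 h7 h8
          have hz : z - z₀ ≠ 0 := sub_ne_zero.2 h7
          have h9 : HasDerivAt (fun z => (z - z₀) ^ (n + 1) * A i z)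
              (((n + 1 : ℕ) : ℂ) * (z - z₀) ^ n * A i z + (z - z₀) ^ (n + 1) * deriv (A i) z)
              z := by
            have h10 : HasDerivAt (fun z => (z - z₀) ^ (n + 1))
                (((n + 1 : ℕ) : ℂ) * (z - z₀) ^ n) z := by
              simpa using ((hasDerivAt_id z).sub_const z₀).fun_pow (n + 1)
            exact h10.mul h8.differentiableAt.hasDerivAt
          rw [EventuallyEq.deriv_eq h5, h9.deriv] at h6
          have h11 : ∑ j, L i j z * δ j z = (z - z₀) ^ (n + 1) * ∑ j, L i j z * A j z := by
            rw [Finset.mul_sum]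
            refine Finset.sum_congr rfl fun j _ => ?_
            rw [h4 j]
            ring
          rw [h11] at h6
          refine mul_left_cancel₀ (pow_ne_zero (n + 1) hz) ?_
          rw [← h6]
          ring
        have hc1 : ContinuousAt (fun z => ((n + 1 : ℕ) : ℂ) * A i z + (z - z₀) * deriv (A i) z)
            z₀ := by
          have := (hA i).continuousAt
          have := (hA i).deriv.continuousAt
          fun_prop
        have hc2 : ContinuousAt (fun z => ∑ j, L i j z * A j z) z₀ :=
          tendsto_finsetSum _ fun j _ => (hL i j).mul (hA j).continuousAt
        have h3 := eq_of_eventually_nhdsNE hc1 hc2 h2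
        simpa using h3
      choose B hB hB' using fun i => exists_eq_sub_mul (hA i) (h1 i)
      refine ⟨B, hB, fun i => (hAz i).mono fun z hz => ?_⟩
      rw [hz, hB' i z]
      ring
  refine eventually_zero_of_forall_pow (hδ i) fun n => ?_
  cases n with
  | zero => exact ⟨δ i, hδ i, .of_forall fun z => by simp⟩
  | succ n =>
    obtain ⟨A, hA, hAz⟩ := key n
    exact ⟨A i, hA i, hAz i⟩

/-! ### The reduced system and its local solutions -/

/-- The coefficients of the reduced system obeyed by `u = ψ - i c / (2 p)`, by its counterpart
`v` for the conjugate equation, and by `M`. -/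
structure ReducedParams where
  d : ℂ
  e : ℂ
  G : ℂ
  κ : ℝ
  he : e.im ≠ 0

namespace ReducedParams

variable (Q : ReducedParams)

/-- The complex conjugate of the coefficient `d`. -/
def d' : ℂ := starRingEnd ℂ Q.d

/-- The complex conjugate of the coefficient `e`. -/
def e' : ℂ := starRingEnd ℂ Q.e

/-- The complex conjugate of the coefficient `G`. -/
def G' : ℂ := starRingEnd ℂ Q.G

theorem e_ne_e' : Q.e ≠ Q.e' := by
  intro h
  exact Q.he (Complex.conj_eq_iff_im.1 h.symm)

theorem e_ne_zero : Q.e ≠ 0 := by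
  intro h
  exact Q.he (by simp [h])

/-- Meromorphic solutions of the reduced system. -/
structure IsWave (u v M : ℂ → ℂ) : Prop where
  meromorphic_u : Meromorphic u
  meromorphic_v : Meromorphic v
  meromorphic_M : Meromorphic M
  ne_zero : ¬ M =ᶠ[codiscrete ℂ] fun _ => 0
  eq_u : ∀ᶠ z in codiscrete ℂ, deriv u z = -(u z ^ 2 + Q.d * M z + Q.e * M z ^ 2 + Q.G)
  eq_v : ∀ᶠ z in codiscrete ℂ, deriv v z = -(v z ^ 2 + Q.d' * M z + Q.e' * M z ^ 2 + Q.G')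
  eq_M : ∀ᶠ z in codiscrete ℂ, deriv M z = (u z + v z + Q.κ) * M z

/-- The functions `U = (z - z₀) u`, `V = (z - z₀) v`, `N = (z - z₀) M` attached to a solution of
the reduced system having at most simple poles at `z₀`. -/
structure IsGerm (z₀ : ℂ) (U V N : ℂ → ℂ) : Prop where
  analyticAt_U : AnalyticAt ℂ U z₀
  analyticAt_V : AnalyticAt ℂ V z₀
  analyticAt_N : AnalyticAt ℂ N z₀
  eq_U : ∀ᶠ z in 𝓝 z₀, (z - z₀) * deriv U z
    = U z - U z ^ 2 - Q.d * (z - z₀) * N z - Q.e * N z ^ 2 - Q.G * (z - z₀) ^ 2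
  eq_V : ∀ᶠ z in 𝓝 z₀, (z - z₀) * deriv V z
    = V z - V z ^ 2 - Q.d' * (z - z₀) * N z - Q.e' * N z ^ 2 - Q.G' * (z - z₀) ^ 2
  eq_N : ∀ᶠ z in 𝓝 z₀, (z - z₀) * deriv N z = N z + (U z + V z + Q.κ * (z - z₀)) * N z

variable {Q}

theorem IsWave.comp_add {u v M : ℂ → ℂ} (h : Q.IsWave u v M) (b : ℂ) :
    Q.IsWave (fun z => u (z + b)) (fun z => v (z + b)) (fun z => M (z + b)) where
  meromorphic_u := meromorphic_comp_add h.meromorphic_u b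
  meromorphic_v := meromorphic_comp_add h.meromorphic_v b
  meromorphic_M := meromorphic_comp_add h.meromorphic_M b
  ne_zero h0 := h.ne_zero (by simpa using eventuallyEq_codiscrete_add h0 (-b))
  eq_u := by
    filter_upwards [eventually_codiscrete_add h.eq_u b] with z hz
    rw [deriv_comp_add_const, hz]
  eq_v := by
    filter_upwards [eventually_codiscrete_add h.eq_v b] with z hz
    rw [deriv_comp_add_const, hz]
  eq_M := by
    filter_upwards [eventually_codiscrete_add h.eq_M b] with z hz
    rw [deriv_comp_add_const, hz]

theorem deriv_div_pow {U : ℂ → ℂ} {u : ℂ → ℂ} {z₀ : ℂ} {k : ℕ} (hU : AnalyticAt ℂ U z₀)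
    (h : ∀ᶠ z in 𝓝[≠] z₀, u z = U z / (z - z₀) ^ (k + 1)) :
    ∀ᶠ z in 𝓝[≠] z₀, (z - z₀) ^ (k + 2) * deriv u z
      = (z - z₀) * deriv U z - (k + 1) * U z := by
  filter_upwards [eventually_nhdsNE_nhds h, self_mem_nhdsWithin,
    hU.eventually_analyticAt.filter_mono nhdsWithin_le_nhds] with z h1 h2 h3
  have hz : z - z₀ ≠ 0 := sub_ne_zero.2 h2
  have h4 : HasDerivAt (fun z => (z - z₀) ^ (k + 1)) (((k + 1 : ℕ) : ℂ) * (z - z₀) ^ k) z := by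
    simpa using ((hasDerivAt_id z).sub_const z₀).fun_pow (k + 1)
  have h5 := h3.differentiableAt.hasDerivAt.fun_div h4 (pow_ne_zero _ hz)
  rw [EventuallyEq.deriv_eq h1, h5.deriv]
  push_cast
  field_simp
  ring

/-- The solutions of the reduced system have at most simple poles: for poles of higher order the
leading coefficients `a`, `b`, `m` would satisfy `a² = -e m²`, `b² = -ē m²`, `(a + b) m = 0`. -/
theorem IsWave.exists_germ {u v M : ℂ → ℂ} (h : Q.IsWave u v M) (z₀ : ℂ) :
    ∃ U V N : ℂ → ℂ, Q.IsGerm z₀ U V N ∧ ∀ᶠ z in 𝓝[≠] z₀,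
      u z = U z / (z - z₀) ∧ v z = V z / (z - z₀) ∧ M z = N z / (z - z₀) := by
  let Pole (k : ℕ) : Prop := ∃ U V N : ℂ → ℂ, AnalyticAt ℂ U z₀ ∧ AnalyticAt ℂ V z₀ ∧
    AnalyticAt ℂ N z₀ ∧ (∀ᶠ z in 𝓝[≠] z₀, u z = U z / (z - z₀) ^ (k + 1)) ∧
    (∀ᶠ z in 𝓝[≠] z₀, v z = V z / (z - z₀) ^ (k + 1)) ∧
    ∀ᶠ z in 𝓝[≠] z₀, M z = N z / (z - z₀) ^ (k + 1)
  have start : ∃ k, Pole k := by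
    have aux : ∀ f : ℂ → ℂ, MeromorphicAt f z₀ → ∃ n : ℕ, ∀ k ≥ n, ∃ F : ℂ → ℂ,
        AnalyticAt ℂ F z₀ ∧ ∀ᶠ z in 𝓝[≠] z₀, f z = F z / (z - z₀) ^ (k + 1) := by
      rintro f ⟨n, hn⟩
      refine ⟨n, fun k hk => ⟨fun z => (z - z₀) ^ (k + 1 - n) * ((z - z₀) ^ n • f z), ?_, ?_⟩⟩
      · fun_prop
      · filter_upwards [self_mem_nhdsWithin] with z hz
        have hz : z - z₀ ≠ 0 := sub_ne_zero.2 hz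
        rw [smul_eq_mul, ← mul_assoc, ← pow_add, Nat.sub_add_cancel (by omega)]
        field_simp
    obtain ⟨n₁, h₁⟩ := aux u (h.meromorphic_u z₀)
    obtain ⟨n₂, h₂⟩ := aux v (h.meromorphic_v z₀)
    obtain ⟨n₃, h₃⟩ := aux M (h.meromorphic_M z₀)
    obtain ⟨U, hU, hU'⟩ := h₁ (n₁ + n₂ + n₃) (by omega)
    obtain ⟨V, hV, hV'⟩ := h₂ (n₁ + n₂ + n₃) (by omega)
    obtain ⟨N, hN, hN'⟩ := h₃ (n₁ + n₂ + n₃) (by omega)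
    exact ⟨_, U, V, N, hU, hV, hN, hU', hV', hN'⟩
  have step : ∀ k, Pole (k + 1) → Pole k := by
    rintro k ⟨U, V, N, hU, hV, hN, hU', hV', hN'⟩
    have cU := hU.continuousAt
    have cV := hV.continuousAt
    have cN := hN.continuousAt
    have dU := hU.deriv.continuousAt
    have dV := hV.deriv.continuousAt
    have dN := hN.deriv.continuousAt
    have lead : ∀ (F f : ℂ → ℂ) (d e G : ℂ), AnalyticAt ℂ F z₀ →
        (∀ᶠ z in 𝓝[≠] z₀, f z = F z / (z - z₀) ^ (k + 1 + 1)) →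
        (∀ᶠ z in codiscrete ℂ, deriv f z = -(f z ^ 2 + d * M z + e * M z ^ 2 + G)) →
        F z₀ ^ 2 + e * N z₀ ^ 2 = 0 := by
      intro F f d e G hF hF' hode
      have cF := hF.continuousAt
      have dF := hF.deriv.continuousAt
      have h1 : ∀ᶠ z in 𝓝[≠] z₀, (z - z₀) ^ (k + 1) * ((z - z₀) * deriv F z
          - ((k + 1 : ℕ) + 1) * F z) + F z ^ 2 + d * (z - z₀) ^ (k + 2) * N z + e * N z ^ 2
          + G * (z - z₀) ^ (2 * k + 4) = 0 := by
        filter_upwards [hF', hN', deriv_div_pow hF hF', nhdsNE_of_codiscrete hode z₀,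
          self_mem_nhdsWithin] with z h1 h2 h3 h4 h5
        have hz : z - z₀ ≠ 0 := sub_ne_zero.2 h5
        rw [← h3, h4, h1, h2]
        field_simp
        ring
      have h2 := eq_of_eventually_nhdsNE (by fun_prop) continuousAt_const h1
      simpa using h2
    have h1 := lead U u _ _ _ hU hU' h.eq_u
    have h2 := lead V v _ _ _ hV hV' h.eq_v
    have h3 : (U z₀ + V z₀) * N z₀ = 0 := by
      have h1 : ∀ᶠ z in 𝓝[≠] z₀, (z - z₀) ^ (k + 1) * ((z - z₀) * deriv N z
          - ((k + 1 : ℕ) + 1) * N z) - (U z + V z + Q.κ * (z - z₀) ^ (k + 2)) * N z = 0 := by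
        filter_upwards [hU', hV', hN', deriv_div_pow hN hN', nhdsNE_of_codiscrete h.eq_M z₀,
          self_mem_nhdsWithin] with z h1 h2 h3 h4 h5 h6
        have hz : z - z₀ ≠ 0 := sub_ne_zero.2 h6
        rw [← h4, h5, h1, h2, h3]
        field_simp
        ring
      have h2 := eq_of_eventually_nhdsNE (by fun_prop) continuousAt_const h1
      simpa using h2
    have hN0 : N z₀ = 0 := by
      by_contra hne
      have h4 : V z₀ = -U z₀ := by
        have := (mul_eq_zero.1 h3).resolve_right hne
        linear_combination this
      have h5 : (Q.e - Q.e') * N z₀ ^ 2 = 0 := by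
        rw [h4] at h2
        linear_combination h1 - h2
      rcases mul_eq_zero.1 h5 with h6 | h6
      · exact Q.e_ne_e' (sub_eq_zero.1 h6)
      · exact hne (pow_eq_zero_iff two_ne_zero |>.1 h6)
    have hU0 : U z₀ = 0 := by simpa [hN0] using h1
    have hV0 : V z₀ = 0 := by simpa [hN0] using h2
    obtain ⟨U₁, hU₁, eU⟩ := exists_eq_sub_mul hU hU0
    obtain ⟨V₁, hV₁, eV⟩ := exists_eq_sub_mul hV hV0
    obtain ⟨N₁, hN₁, eN⟩ := exists_eq_sub_mul hN hN0
    refine ⟨U₁, V₁, N₁, hU₁, hV₁, hN₁, ?_, ?_, ?_⟩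
    · filter_upwards [hU', self_mem_nhdsWithin] with z h1 h2
      have hz : z - z₀ ≠ 0 := sub_ne_zero.2 h2
      rw [h1, eU]
      field_simp
      ring
    · filter_upwards [hV', self_mem_nhdsWithin] with z h1 h2
      have hz : z - z₀ ≠ 0 := sub_ne_zero.2 h2
      rw [h1, eV]
      field_simp
      ring
    · filter_upwards [hN', self_mem_nhdsWithin] with z h1 h2
      have hz : z - z₀ ≠ 0 := sub_ne_zero.2 h2
      rw [h1, eN]
      field_simp
      ring
  have base : Pole 0 := by
    obtain ⟨k, hk⟩ := start
    induction k with
    | zero => exact hk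
    | succ k ih => exact ih (step k hk)
  obtain ⟨U, V, N, hU, hV, hN, hU', hV', hN'⟩ := base
  have cU := hU.continuousAt
  have cV := hV.continuousAt
  have cN := hN.continuousAt
  have dU := hU.deriv.continuousAt
  have dV := hV.deriv.continuousAt
  have dN := hN.deriv.continuousAt
  -- near `z₀`, and not merely in a punctured neighbourhood
  have full : ∀ f g : ℂ → ℂ, AnalyticAt ℂ f z₀ → AnalyticAt ℂ g z₀ →
      (∀ᶠ z in 𝓝[≠] z₀, f z = g z) → ∀ᶠ z in 𝓝 z₀, f z = g z := fun f g hf hg hfg =>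
    eventuallyEq_nhds_of_nhdsNE hf.continuousAt hg.continuousAt hfg
  have aU := hU.deriv
  have aV := hV.deriv
  have aN := hN.deriv
  refine ⟨U, V, N, ⟨hU, hV, hN, full _ _ (by fun_prop) (by fun_prop) ?_,
    full _ _ (by fun_prop) (by fun_prop) ?_, full _ _ (by fun_prop) (by fun_prop) ?_⟩, ?_⟩
  · filter_upwards [hU', hN', deriv_div_pow hU hU', nhdsNE_of_codiscrete h.eq_u z₀,
      self_mem_nhdsWithin] with z h1 h2 h3 h4 h5
    have hz : z - z₀ ≠ 0 := sub_ne_zero.2 h5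
    simp only [zero_add, pow_one, Nat.cast_zero, one_mul] at h1 h2 h3
    rw [h4, h1, h2] at h3
    have h6 : U z / (z - z₀) * (z - z₀) = U z := div_mul_cancel₀ _ hz
    have h7 : N z / (z - z₀) * (z - z₀) = N z := div_mul_cancel₀ _ hz
    generalize U z / (z - z₀) = a at *
    generalize N z / (z - z₀) = m at *
    rw [← h6] at h3 ⊢
    rw [← h7]
    linear_combination -h3
  · filter_upwards [hV', hN', deriv_div_pow hV hV', nhdsNE_of_codiscrete h.eq_v z₀,
      self_mem_nhdsWithin] with z h1 h2 h3 h4 h5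
    have hz : z - z₀ ≠ 0 := sub_ne_zero.2 h5
    simp only [zero_add, pow_one, Nat.cast_zero, one_mul] at h1 h2 h3
    rw [h4, h1, h2] at h3
    have h6 : V z / (z - z₀) * (z - z₀) = V z := div_mul_cancel₀ _ hz
    have h7 : N z / (z - z₀) * (z - z₀) = N z := div_mul_cancel₀ _ hz
    generalize V z / (z - z₀) = a at *
    generalize N z / (z - z₀) = m at *
    rw [← h6] at h3 ⊢
    rw [← h7]
    linear_combination -h3
  · filter_upwards [hU', hV', hN', deriv_div_pow hN hN', nhdsNE_of_codiscrete h.eq_M z₀,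
      self_mem_nhdsWithin] with z h1 h2 h3 h4 h5 h6
    have hz : z - z₀ ≠ 0 := sub_ne_zero.2 h6
    simp only [zero_add, pow_one, Nat.cast_zero, one_mul] at h1 h2 h3 h4
    rw [h5, h1, h2, h3] at h4
    have h7 : U z / (z - z₀) * (z - z₀) = U z := div_mul_cancel₀ _ hz
    have h8 : V z / (z - z₀) * (z - z₀) = V z := div_mul_cancel₀ _ hz
    have h9 : N z / (z - z₀) * (z - z₀) = N z := div_mul_cancel₀ _ hz
    generalize U z / (z - z₀) = a at *
    generalize V z / (z - z₀) = b at *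
    generalize N z / (z - z₀) = m at *
    rw [← h7, ← h8, ← h9]
    rw [← h9] at h4
    linear_combination -h4
  · filter_upwards [hU', hV', hN'] with z h1 h2 h3
    exact ⟨by simpa using h1, by simpa using h2, by simpa using h3⟩

end ReducedParams

namespace ReducedParams

variable {Q : ReducedParams}

/-! ### The leading coefficients -/

namespace IsGerm

variable {z₀ : ℂ} {U V N : ℂ → ℂ}

theorem lead_U (h : Q.IsGerm z₀ U V N) : U z₀ - U z₀ ^ 2 = Q.e * N z₀ ^ 2 := by
  have := h.eq_U.self_of_nhds
  simp only [sub_self, zero_mul, mul_zero] at this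
  linear_combination -this

theorem lead_V (h : Q.IsGerm z₀ U V N) : V z₀ - V z₀ ^ 2 = Q.e' * N z₀ ^ 2 := by
  have := h.eq_V.self_of_nhds
  simp only [sub_self, zero_mul, mul_zero] at this
  linear_combination -this

theorem lead_N (h : Q.IsGerm z₀ U V N) : (1 + U z₀ + V z₀) * N z₀ = 0 := by
  have := h.eq_N.self_of_nhds
  simp only [sub_self, zero_mul, mul_zero] at this
  linear_combination -this

theorem U_eq_zero_or_one (h : Q.IsGerm z₀ U V N) (hN : N z₀ = 0) : U z₀ = 0 ∨ U z₀ = 1 := by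
  have h1 := h.lead_U
  rw [hN] at h1
  have h2 : U z₀ * (U z₀ - 1) = 0 := by linear_combination -h1
  rcases mul_eq_zero.1 h2 with h3 | h3
  · exact .inl h3
  · exact .inr (sub_eq_zero.1 h3)

theorem V_eq_zero_or_one (h : Q.IsGerm z₀ U V N) (hN : N z₀ = 0) : V z₀ = 0 ∨ V z₀ = 1 := by
  have h1 := h.lead_V
  rw [hN] at h1
  have h2 : V z₀ * (V z₀ - 1) = 0 := by linear_combination -h1
  rcases mul_eq_zero.1 h2 with h3 | h3
  · exact .inl h3
  · exact .inr (sub_eq_zero.1 h3)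

/-- Where `M` has no pole, it vanishes to first order at least at each pole of `u` or `v`. -/
theorem exists_analytic_M (h : Q.IsGerm z₀ U V N) (hN : N z₀ = 0) :
    ∃ K : ℂ → ℂ, AnalyticAt ℂ K z₀ ∧ (∀ z, N z = (z - z₀) * K z) ∧
      (U z₀ + V z₀) * K z₀ = 0 ∧
      ∀ᶠ z in 𝓝 z₀, (z - z₀) * deriv K z = (U z + V z + Q.κ * (z - z₀)) * K z := by
  obtain ⟨K, hK, hNK⟩ := exists_eq_sub_mul h.analyticAt_N hN
  have aK := hK.deriv
  have aU := h.analyticAt_U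
  have aV := h.analyticAt_V
  have h1 : ∀ᶠ z in 𝓝[≠] z₀, (z - z₀) * deriv K z = (U z + V z + Q.κ * (z - z₀)) * K z := by
    filter_upwards [h.eq_N.filter_mono nhdsWithin_le_nhds, self_mem_nhdsWithin,
      hK.eventually_analyticAt.filter_mono nhdsWithin_le_nhds] with z h2 h3 h4
    have hz : z - z₀ ≠ 0 := sub_ne_zero.2 h3
    have h5 : HasDerivAt N (1 * K z + (z - z₀) * deriv K z) z := by
      have : N = fun z => (z - z₀) * K z := funext hNK
      rw [this]
      exact ((hasDerivAt_id z).sub_const z₀).mul h4.differentiableAt.hasDerivAt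
    rw [h5.deriv, hNK] at h2
    refine mul_left_cancel₀ hz ?_
    linear_combination h2
  have h2 : ∀ᶠ z in 𝓝 z₀, (z - z₀) * deriv K z = (U z + V z + Q.κ * (z - z₀)) * K z :=
    eventuallyEq_nhds_of_nhdsNE (f := fun z => (z - z₀) * deriv K z)
      (g := fun z => (U z + V z + Q.κ * (z - z₀)) * K z)
      (AnalyticAt.continuousAt (𝕜 := ℂ) (by fun_prop)) (AnalyticAt.continuousAt (𝕜 := ℂ) (by fun_prop)) h1
  refine ⟨K, hK, hNK, ?_, h2⟩
  have := h2.self_of_nhds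
  simp only [sub_self, zero_mul, mul_zero, add_zero] at this
  exact this.symm

end IsGerm

/-- The relations between the residues `a`, `b`, `m` of `u`, `v`, `M` at a pole of `M`: `a` and `b`
are `-1/2 ± i α`, where `α` is one of the two real roots of `e_i (α² - 3/4) = 2 e_r α`, with
`e = e_r + i e_i`. -/
structure IsPoleData (Q : ReducedParams) (a b m : ℂ) (α : ℝ) : Prop where
  a_eq : a = -1 / 2 + I * α
  b_eq : b = -1 / 2 - I * α
  e_mul : Q.e * m ^ 2 = a - a ^ 2
  e'_mul : Q.e' * m ^ 2 = b - b ^ 2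
  root : Q.e.im * (α ^ 2 - 3 / 4) = 2 * Q.e.re * α

theorem IsPoleData.ne_zero {a b m : ℂ} {α : ℝ} (h : Q.IsPoleData a b m α) : α ≠ 0 := by
  intro h0
  have := h.root
  rw [h0] at this
  exact Q.he (by linarith)

theorem IsGerm.exists_poleData {z₀ : ℂ} {U V N : ℂ → ℂ} (h : Q.IsGerm z₀ U V N)
    (hN : N z₀ ≠ 0) : ∃ α : ℝ, Q.IsPoleData (U z₀) (V z₀) (N z₀) α := by
  have h1 := h.lead_U
  have h2 := h.lead_V
  have h3 : 1 + U z₀ + V z₀ = 0 := (mul_eq_zero.1 h.lead_N).resolve_right hN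
  set a := U z₀
  set b := V z₀
  set m := N z₀
  have hb : b = -1 - a := by linear_combination h3
  obtain ⟨t, ht⟩ : ∃ t : ℂ, a = -1 / 2 + I * t := ⟨-I * (a + 1 / 2), by
    linear_combination (a + 1 / 2) * I_sq⟩
  have hei : (Q.e.im : ℂ) ≠ 0 := by exact_mod_cast Q.he
  have e1 : Q.e = Q.e.re + Q.e.im * I := (re_add_im Q.e).symm
  have e2 : Q.e' = Q.e.re - Q.e.im * I := by
    rw [e', Complex.ext_iff]; simp
  -- eliminating `m` between the two leading equations
  have h4 : Q.e' * (a - a ^ 2) = Q.e * (b - b ^ 2) := by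
    rw [h1, h2]; ring
  have h5 : (Q.e.im : ℂ) * (t ^ 2 - 3 / 4) = 2 * Q.e.re * t := by
    rw [e1, e2, hb, ht] at h4
    have : (2 * I) * ((Q.e.im : ℂ) * (t ^ 2 - 3 / 4) - 2 * Q.e.re * t) = 0 := by
      ring_nf at h4 ⊢
      simp only [I_sq, show I ^ 3 = -I by rw [pow_succ, I_sq]; ring] at h4 ⊢
      linear_combination -h4
    have := (mul_eq_zero.1 this).resolve_left (by simp)
    linear_combination this
  -- the discriminant of this real quadratic equation is positive
  have h6 : ((t - Q.e.re / Q.e.im) - (√((Q.e.re / Q.e.im) ^ 2 + 3 / 4) : ℝ))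
      * ((t - Q.e.re / Q.e.im) + (√((Q.e.re / Q.e.im) ^ 2 + 3 / 4) : ℝ)) = 0 := by
    have h7 : ((√((Q.e.re / Q.e.im) ^ 2 + 3 / 4) : ℝ) : ℂ) ^ 2
        = (Q.e.re / Q.e.im : ℂ) ^ 2 + 3 / 4 := by
      rw [← ofReal_pow, Real.sq_sqrt (by positivity)]
      push_cast
      ring
    have h8 : (t - Q.e.re / Q.e.im : ℂ) ^ 2 = (Q.e.re / Q.e.im : ℂ) ^ 2 + 3 / 4 := by
      field_simp
      linear_combination 4 * Q.e.im * h5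
    linear_combination h8 - h7
  obtain ⟨α, rfl⟩ : ∃ α : ℝ, t = α := by
    rcases mul_eq_zero.1 h6 with h7 | h7
    · exact ⟨Q.e.re / Q.e.im + √((Q.e.re / Q.e.im) ^ 2 + 3 / 4), by
        push_cast; linear_combination h7⟩
    · exact ⟨Q.e.re / Q.e.im - √((Q.e.re / Q.e.im) ^ 2 + 3 / 4), by
        push_cast; linear_combination h7⟩
  exact ⟨α, ht, by rw [hb, ht]; ring, h1.symm, h2.symm, ofReal_injective (by push_cast; exact h5)⟩

/-! ### Uniqueness of the local solutions -/

/-- The polar germs of solutions are determined by their leading coefficients: the resonance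
polynomial `(n + 1) ((n - 2) (n - 3) + 8 α²)` has no root `n ≥ 1`. -/
theorem IsGerm.eventually_eq {z₀ : ℂ} {U₁ V₁ N₁ U₂ V₂ N₂ : ℂ → ℂ} (h₁ : Q.IsGerm z₀ U₁ V₁ N₁)
    (h₂ : Q.IsGerm z₀ U₂ V₂ N₂) (hN : N₁ z₀ ≠ 0) (hU12 : U₁ z₀ = U₂ z₀) (hN12 : N₁ z₀ = N₂ z₀) :
    ∀ᶠ z in 𝓝 z₀, U₁ z = U₂ z ∧ V₁ z = V₂ z ∧ N₁ z = N₂ z := by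
  obtain ⟨α, hp⟩ := h₁.exists_poleData hN
  have hα := hp.ne_zero
  obtain ⟨α₂, hp₂⟩ := h₂.exists_poleData (hN12 ▸ hN)
  have hV12 : V₁ z₀ = V₂ z₀ := by
    linear_combination hp.b_eq + hp.a_eq - hp₂.a_eq - hp₂.b_eq - hU12
  have cU₁ := h₁.analyticAt_U.continuousAt
  have cV₁ := h₁.analyticAt_V.continuousAt
  have cN₁ := h₁.analyticAt_N.continuousAt
  have cU₂ := h₂.analyticAt_U.continuousAt
  have cV₂ := h₂.analyticAt_V.continuousAt
  have cN₂ := h₂.analyticAt_N.continuousAt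
  have dif : ∀ {F G : ℂ → ℂ}, AnalyticAt ℂ F z₀ → AnalyticAt ℂ G z₀ →
      ∀ᶠ z in 𝓝 z₀, deriv (fun z => F z - G z) z = deriv F z - deriv G z := by
    intro F G hF hG
    filter_upwards [hF.eventually_analyticAt, hG.eventually_analyticAt] with z h1 h2
    exact deriv_fun_sub h1.differentiableAt h2.differentiableAt
  -- the differences of the two solutions satisfy a linear system with a simple pole
  let δ : Fin 3 → ℂ → ℂ := ![fun z => U₁ z - U₂ z, fun z => V₁ z - V₂ z, fun z => N₁ z - N₂ z]
  let L : Fin 3 → Fin 3 → ℂ → ℂ := ![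
    ![fun z => 1 - (U₁ z + U₂ z), fun _ => 0, fun z => -Q.d * (z - z₀) - Q.e * (N₁ z + N₂ z)],
    ![fun _ => 0, fun z => 1 - (V₁ z + V₂ z),
      fun z => -Q.d' * (z - z₀) - Q.e' * (N₁ z + N₂ z)],
    ![fun z => N₂ z, fun z => N₂ z, fun z => 1 + U₁ z + V₁ z + Q.κ * (z - z₀)]]
  have key := eventually_zero_of_fuchsian δ (z₀ := z₀) ?_ ?_ L ?_ ?_ ?_
  · filter_upwards [key 0, key 1, key 2] with z h1 h2 h3
    exact ⟨sub_eq_zero.1 h1, sub_eq_zero.1 h2, sub_eq_zero.1 h3⟩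
  · intro i
    fin_cases i
    · exact h₁.analyticAt_U.sub h₂.analyticAt_U
    · exact h₁.analyticAt_V.sub h₂.analyticAt_V
    · exact h₁.analyticAt_N.sub h₂.analyticAt_N
  · intro i
    fin_cases i
    · exact sub_eq_zero.2 hU12
    · exact sub_eq_zero.2 hV12
    · exact sub_eq_zero.2 hN12
  · intro i j
    fin_cases i <;> fin_cases j <;>
      simp only [L, Fin.zero_eta, Fin.mk_one, Fin.reduceFinMk, Matrix.cons_val] <;> fun_prop
  · intro i
    fin_cases i
    · filter_upwards [h₁.eq_U, h₂.eq_U, dif h₁.analyticAt_U h₂.analyticAt_U] with z h1 h2 h3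
      simp only [δ, L, Fin.sum_univ_three, Fin.zero_eta, Matrix.cons_val]
      rw [h3]
      linear_combination h1 - h2
    · filter_upwards [h₁.eq_V, h₂.eq_V, dif h₁.analyticAt_V h₂.analyticAt_V] with z h1 h2 h3
      simp only [δ, L, Fin.sum_univ_three, Fin.mk_one, Matrix.cons_val]
      rw [h3]
      linear_combination h1 - h2
    · filter_upwards [h₁.eq_N, h₂.eq_N, dif h₁.analyticAt_N h₂.analyticAt_N] with z h1 h2 h3
      simp only [δ, L, Fin.sum_univ_three, Fin.reduceFinMk, Matrix.cons_val]
      rw [h3]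
      linear_combination h1 - h2
  · intro n hn w hw
    have w0 := hw 0
    have w1 := hw 1
    have w2 := hw 2
    simp only [L, Fin.sum_univ_three, Matrix.cons_val, ← hU12, ← hV12, ← hN12, sub_self, mul_zero,
      zero_mul, add_zero, zero_add, zero_sub] at w0 w1 w2
    have ha := hp.a_eq
    have hb := hp.b_eq
    have h1 := hp.e_mul
    have h2 := hp.e'_mul
    rw [ha, hb] at w2
    rw [ha] at w0 h1
    rw [hb] at w1 h2
    set m := N₁ z₀
    have hnn : ∀ x : ℝ, ((n : ℂ) - 2 + 2 * I * x) = 0 → x = 0 := by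
      intro x hx
      have := congrArg Complex.im hx
      simpa using this
    -- elimination of `w 0` and `w 1` from the eigenvalue equations
    have h3 : ((n : ℂ) + 1) * (((n : ℂ) - 2) * (n - 3) + 8 * α ^ 2) * w 2 = 0 := by
      have e0 : (n - 2 + 2 * I * α) * w 0 = -2 * Q.e * m * w 2 := by linear_combination w0
      have e1 : (n - 2 - 2 * I * α) * w 1 = -2 * Q.e' * m * w 2 := by linear_combination w1
      have e2 : n * w 2 = m * (w 0 + w 1) := by linear_combination w2
      have : n * ((n - 2 + 2 * I * α) * (n - 2 - 2 * I * α)) * w 2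
          = -2 * w 2 * ((Q.e * m ^ 2) * (n - 2 - 2 * I * α)
            + (Q.e' * m ^ 2) * (n - 2 + 2 * I * α)) := by
        linear_combination ((n - 2 + 2 * I * α) * (n - 2 - 2 * I * α)) * e2
          + m * (n - 2 - 2 * I * α) * e0 + m * (n - 2 + 2 * I * α) * e1
      rw [h1, h2] at this
      have i2 := I_sq
      ring_nf at this ⊢
      simp only [i2] at this
      linear_combination this
    have h4 : w 2 = 0 := by
      refine (mul_eq_zero.1 h3).resolve_left (mul_ne_zero ?_ ?_)
      · exact_mod_cast Nat.succ_ne_zero n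
      · have : (0 : ℝ) < ((n : ℝ) - 2) * (n - 3) + 8 * α ^ 2 := by
          have h5 : 0 < α ^ 2 := by positivity
          have h6 : (0 : ℝ) ≤ ((n : ℝ) - 2) * (n - 3) := by
            rcases le_or_gt n 2 with h7 | h7
            · have : (n : ℝ) ≤ 2 := by exact_mod_cast h7
              nlinarith
            · have : (3 : ℝ) ≤ n := by exact_mod_cast h7
              nlinarith
          linarith
        exact_mod_cast this.ne'
    rw [h4] at w0 w1
    have h5 : w 0 = 0 := by
      have e0 : (n - 2 + 2 * I * α) * w 0 = 0 := by linear_combination w0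
      exact (mul_eq_zero.1 e0).resolve_left fun h => hα (hnn α h)
    have h6 : w 1 = 0 := by
      have e1 : (n - 2 + 2 * I * (-α : ℝ)) * w 1 = 0 := by push_cast; linear_combination w1
      exact (mul_eq_zero.1 e1).resolve_left fun h => hα (neg_eq_zero.1 (hnn (-α) h))
    intro i
    fin_cases i
    exacts [h5, h6, h4]

/-- Two waves having a pole of `M` with the same residues at the same point are equal. -/
theorem IsWave.eq_of_germs {u₁ v₁ M₁ u₂ v₂ M₂ : ℂ → ℂ} (h₁ : Q.IsWave u₁ v₁ M₁)
    (h₂ : Q.IsWave u₂ v₂ M₂) {z₀ : ℂ} {U₁ V₁ N₁ U₂ V₂ N₂ : ℂ → ℂ} (g₁ : Q.IsGerm z₀ U₁ V₁ N₁)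
    (g₂ : Q.IsGerm z₀ U₂ V₂ N₂)
    (e₁ : ∀ᶠ z in 𝓝[≠] z₀, u₁ z = U₁ z / (z - z₀) ∧ v₁ z = V₁ z / (z - z₀) ∧
      M₁ z = N₁ z / (z - z₀))
    (e₂ : ∀ᶠ z in 𝓝[≠] z₀, u₂ z = U₂ z / (z - z₀) ∧ v₂ z = V₂ z / (z - z₀) ∧
      M₂ z = N₂ z / (z - z₀))
    (hN : N₁ z₀ ≠ 0) (hU12 : U₁ z₀ = U₂ z₀) (hN12 : N₁ z₀ = N₂ z₀) :
    u₁ =ᶠ[codiscrete ℂ] u₂ ∧ v₁ =ᶠ[codiscrete ℂ] v₂ ∧ M₁ =ᶠ[codiscrete ℂ] M₂ := by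
  have h := (g₁.eventually_eq g₂ hN hU12 hN12).filter_mono
    (nhdsWithin_le_nhds : 𝓝[≠] z₀ ≤ 𝓝 z₀)
  refine ⟨eventuallyEq_codiscrete_of_nhdsNE h₁.meromorphic_u h₂.meromorphic_u (z := z₀) ?_,
    eventuallyEq_codiscrete_of_nhdsNE h₁.meromorphic_v h₂.meromorphic_v (z := z₀) ?_,
    eventuallyEq_codiscrete_of_nhdsNE h₁.meromorphic_M h₂.meromorphic_M (z := z₀) ?_⟩ <;>
  · filter_upwards [h, e₁, e₂] with z h1 h2 h3
    simp [h1, h2, h3]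

/-- Two waves taking the same finite values at a point are equal. -/
theorem IsWave.eq_of_regular {u₁ v₁ M₁ u₂ v₂ M₂ : ℂ → ℂ} (h₁ : Q.IsWave u₁ v₁ M₁)
    (h₂ : Q.IsWave u₂ v₂ M₂) {z₀ : ℂ} {A₁ B₁ K₁ A₂ B₂ K₂ : ℂ → ℂ}
    (hA₁ : AnalyticAt ℂ A₁ z₀) (hB₁ : AnalyticAt ℂ B₁ z₀) (hK₁ : AnalyticAt ℂ K₁ z₀)
    (hA₂ : AnalyticAt ℂ A₂ z₀) (hB₂ : AnalyticAt ℂ B₂ z₀) (hK₂ : AnalyticAt ℂ K₂ z₀)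
    (e₁ : ∀ᶠ z in 𝓝[≠] z₀, u₁ z = A₁ z ∧ v₁ z = B₁ z ∧ M₁ z = K₁ z)
    (e₂ : ∀ᶠ z in 𝓝[≠] z₀, u₂ z = A₂ z ∧ v₂ z = B₂ z ∧ M₂ z = K₂ z)
    (hA : A₁ z₀ = A₂ z₀) (hB : B₁ z₀ = B₂ z₀) (hK : K₁ z₀ = K₂ z₀) :
    M₁ =ᶠ[codiscrete ℂ] M₂ ∧ u₁ =ᶠ[codiscrete ℂ] u₂ := by
  let δ : Fin 3 → ℂ → ℂ := ![fun z => A₁ z - A₂ z, fun z => B₁ z - B₂ z, fun z => K₁ z - K₂ z]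
  let L : Fin 3 → Fin 3 → ℂ → ℂ := ![
    ![fun z => (z - z₀) * -(A₁ z + A₂ z), fun _ => 0,
      fun z => (z - z₀) * -(Q.d + Q.e * (K₁ z + K₂ z))],
    ![fun _ => 0, fun z => (z - z₀) * -(B₁ z + B₂ z),
      fun z => (z - z₀) * -(Q.d' + Q.e' * (K₁ z + K₂ z))],
    ![fun z => (z - z₀) * K₂ z, fun z => (z - z₀) * K₂ z,
      fun z => (z - z₀) * (A₁ z + B₁ z + Q.κ)]]
  have key := eventually_zero_of_fuchsian δ (z₀ := z₀) ?_ ?_ L ?_ ?_ ?_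
  · have h1 : ∀ᶠ z in 𝓝[≠] z₀, ∀ i, δ i z = 0 :=
      (eventually_all.2 key).filter_mono nhdsWithin_le_nhds
    refine ⟨eventuallyEq_codiscrete_of_nhdsNE h₁.meromorphic_M h₂.meromorphic_M (z := z₀) ?_,
      eventuallyEq_codiscrete_of_nhdsNE h₁.meromorphic_u h₂.meromorphic_u (z := z₀) ?_⟩
    · filter_upwards [h1, e₁, e₂] with z h2 h3 h4
      rw [h3.2.2, h4.2.2]
      exact sub_eq_zero.1 (h2 2)
    · filter_upwards [h1, e₁, e₂] with z h2 h3 h4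
      rw [h3.1, h4.1]
      exact sub_eq_zero.1 (h2 0)
  · intro i
    fin_cases i
    exacts [hA₁.sub hA₂, hB₁.sub hB₂, hK₁.sub hK₂]
  · intro i
    fin_cases i
    exacts [sub_eq_zero.2 hA, sub_eq_zero.2 hB, sub_eq_zero.2 hK]
  · have := hA₁.continuousAt
    have := hB₁.continuousAt
    have := hK₁.continuousAt
    have := hA₂.continuousAt
    have := hB₂.continuousAt
    have := hK₂.continuousAt
    intro i j
    fin_cases i <;> fin_cases j <;>
      simp only [L, Fin.zero_eta, Fin.mk_one, Fin.reduceFinMk, Matrix.cons_val] <;> fun_prop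
  · -- the equations hold off `z₀`, hence by continuity at `z₀`
    have der : ∀ {f F g G : ℂ → ℂ}, AnalyticAt ℂ F z₀ → AnalyticAt ℂ G z₀ →
        (∀ᶠ z in 𝓝[≠] z₀, f z = F z) → (∀ᶠ z in 𝓝[≠] z₀, g z = G z) →
        ∀ᶠ z in 𝓝[≠] z₀, deriv (fun z => F z - G z) z = deriv f z - deriv g z := by
      intro f F g G hF hG hf hg
      filter_upwards [eventually_nhdsNE_nhds hf, eventually_nhdsNE_nhds hg,
        hF.eventually_analyticAt.filter_mono nhdsWithin_le_nhds,
        hG.eventually_analyticAt.filter_mono nhdsWithin_le_nhds] with z h1 h2 h3 h4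
      rw [EventuallyEq.deriv_eq h1, EventuallyEq.deriv_eq h2]
      exact deriv_fun_sub h3.differentiableAt h4.differentiableAt
    have off : ∀ i, ∀ᶠ z in 𝓝[≠] z₀, (z - z₀) * deriv (δ i) z = ∑ j, L i j z * δ j z := by
      intro i
      fin_cases i
      · filter_upwards [nhdsNE_of_codiscrete h₁.eq_u z₀, nhdsNE_of_codiscrete h₂.eq_u z₀, e₁, e₂,
          der hA₁ hA₂ (e₁.mono fun _ h => h.1) (e₂.mono fun _ h => h.1)] with z h1 h2 h3 h4 h5
        simp only [δ, L, Fin.sum_univ_three, Fin.zero_eta, Matrix.cons_val]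
        rw [h5, h1, h2, h3.1, h4.1, h3.2.2, h4.2.2]
        ring
      · filter_upwards [nhdsNE_of_codiscrete h₁.eq_v z₀, nhdsNE_of_codiscrete h₂.eq_v z₀, e₁, e₂,
          der hB₁ hB₂ (e₁.mono fun _ h => h.2.1) (e₂.mono fun _ h => h.2.1)]
          with z h1 h2 h3 h4 h5
        simp only [δ, L, Fin.sum_univ_three, Fin.mk_one, Matrix.cons_val]
        rw [h5, h1, h2, h3.2.1, h4.2.1, h3.2.2, h4.2.2]
        ring
      · filter_upwards [nhdsNE_of_codiscrete h₁.eq_M z₀, nhdsNE_of_codiscrete h₂.eq_M z₀, e₁, e₂,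
          der hK₁ hK₂ (e₁.mono fun _ h => h.2.2) (e₂.mono fun _ h => h.2.2)]
          with z h1 h2 h3 h4 h5
        simp only [δ, L, Fin.sum_univ_three, Fin.reduceFinMk, Matrix.cons_val]
        rw [h5, h1, h2, h3.1, h4.1, h3.2.1, h4.2.1, h3.2.2, h4.2.2]
        ring
    have hδ : ∀ i, AnalyticAt ℂ (δ i) z₀ := by
      intro i
      fin_cases i
      exacts [hA₁.sub hA₂, hB₁.sub hB₂, hK₁.sub hK₂]
    have hL : ∀ i j, AnalyticAt ℂ (L i j) z₀ := by
      intro i j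
      fin_cases i <;> fin_cases j <;>
        simp only [L, Fin.zero_eta, Fin.mk_one, Fin.reduceFinMk, Matrix.cons_val] <;> fun_prop
    intro i
    have aδ := (hδ i).deriv
    refine eventuallyEq_nhds_of_nhdsNE (f := fun z => (z - z₀) * deriv (δ i) z)
      (g := fun z => ∑ j, L i j z * δ j z) (AnalyticAt.continuousAt (𝕜 := ℂ) (by fun_prop)) ?_ (off i)
    exact tendsto_finsetSum _ fun j _ => (hL i j).continuousAt.mul (hδ j).continuousAt
  · intro n hn w hw i
    have h1 : (n : ℂ) * w i = 0 := by
      rw [hw i]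
      refine Finset.sum_eq_zero fun j _ => ?_
      have : L i j z₀ = 0 := by
        fin_cases i <;> fin_cases j <;> simp [L]
      rw [this, zero_mul]
    exact (mul_eq_zero.1 h1).resolve_left (by exact_mod_cast (by omega : n ≠ 0))

end ReducedParams

/-! ### Simple poles and their residues -/

/-- The residue of `f` at `z₀`, for a function `f` with at most a simple pole there. -/
noncomputable def residue (f : ℂ → ℂ) (z₀ : ℂ) : ℂ :=
  limUnder (𝓝[≠] z₀) fun z => (z - z₀) * f z

section

variable {f F : ℂ → ℂ} {z₀ : ℂ}

theorem tendsto_of_eq_div (hF : AnalyticAt ℂ F z₀)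
    (h : ∀ᶠ z in 𝓝[≠] z₀, f z = F z / (z - z₀)) :
    Tendsto (fun z => (z - z₀) * f z) (𝓝[≠] z₀) (𝓝 (F z₀)) := by
  refine (hF.continuousAt.tendsto.mono_left nhdsWithin_le_nhds).congr' ?_
  filter_upwards [h, self_mem_nhdsWithin] with z h1 h2
  rw [h1, mul_div_cancel₀ _ (sub_ne_zero.2 h2)]

theorem residue_eq_of_tendsto {ρ : ℂ} (h : Tendsto (fun z => (z - z₀) * f z) (𝓝[≠] z₀) (𝓝 ρ)) :
    residue f z₀ = ρ :=
  h.limUnder_eq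

theorem residue_of_eq_div (hF : AnalyticAt ℂ F z₀)
    (h : ∀ᶠ z in 𝓝[≠] z₀, f z = F z / (z - z₀)) : residue f z₀ = F z₀ :=
  residue_eq_of_tendsto (tendsto_of_eq_div hF h)

theorem exists_eq_div_add_of_eq_div (hF : AnalyticAt ℂ F z₀)
    (h : ∀ᶠ z in 𝓝[≠] z₀, f z = F z / (z - z₀)) :
    ∃ R : ℂ → ℂ, AnalyticAt ℂ R z₀ ∧ ∀ᶠ z in 𝓝[≠] z₀, f z = F z₀ / (z - z₀) + R z := by
  obtain ⟨R, hR, hFR⟩ := exists_eq_sub_mul (f := fun z => F z - F z₀) (hF.sub analyticAt_const)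
    (sub_self _)
  refine ⟨R, hR, ?_⟩
  filter_upwards [h, self_mem_nhdsWithin] with z h1 h2
  have hz : z - z₀ ≠ 0 := sub_ne_zero.2 h2
  rw [h1, show F z = F z₀ + (z - z₀) * R z by linear_combination hFR z]
  field_simp

theorem order_neg_iff_of_eq_div (hF : AnalyticAt ℂ F z₀)
    (h : ∀ᶠ z in 𝓝[≠] z₀, f z = F z / (z - z₀)) :
    meromorphicOrderAt f z₀ < 0 ↔ F z₀ ≠ 0 := by
  constructor
  · intro h1 h2
    obtain ⟨R, hR, hfR⟩ := exists_eq_div_add_of_eq_div hF h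
    rw [h2] at hfR
    exact absurd (order_nonneg_of_eventuallyEq hR (by simpa using hfR)) (not_le.2 h1)
  · intro h1
    have h2 : meromorphicOrderAt f z₀ = ((-1 : ℤ) : WithTop ℤ) := by
      have hf : MeromorphicAt f z₀ :=
        (hF.meromorphicAt.fun_div (by fun_prop : AnalyticAt ℂ (fun z => z - z₀) z₀).meromorphicAt).congr
          (h.mono fun z hz => hz.symm)
      rw [meromorphicOrderAt_eq_int_iff hf]
      refine ⟨F, hF, h1, h.mono fun z hz => ?_⟩
      rw [hz, smul_eq_mul, zpow_neg_one, div_eq_inv_mul]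
    rw [h2]
    exact_mod_cast (by norm_num : (-1 : ℤ) < 0)

theorem residue_comp_add (f : ℂ → ℂ) (b z₀ : ℂ) :
    residue (fun z => f (z + b)) z₀ = residue f (z₀ + b) := by
  have h : map (fun z => z + b) (𝓝[≠] z₀) = 𝓝[≠] (z₀ + b) := by
    exact (Homeomorph.addRight b).map_punctured_nhds_eq z₀
  rw [residue, residue, limUnder, limUnder, ← h, Filter.map_map]
  congr 2
  ext z
  simp

theorem residue_congr {g : ℂ → ℂ} (h : f =ᶠ[codiscrete ℂ] g) (z₀ : ℂ) :
    residue f z₀ = residue g z₀ := by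
  rw [residue, residue, limUnder, limUnder]
  congr 1
  refine Filter.map_congr ?_
  filter_upwards [nhdsNE_of_codiscrete h z₀] with z hz
  rw [hz]

end

/-! ### Period lattices -/

/-- The group of periods of a function considered up to equality on a codiscrete set. -/
def periods (f : ℂ → ℂ) : Submodule ℤ ℂ :=
  AddSubgroup.toIntSubmodule
    { carrier := {l | (fun z => f (z + l)) =ᶠ[codiscrete ℂ] f}
      zero_mem' := by simp
      add_mem' := by
        intro a b ha hb
        have h := (eventuallyEq_codiscrete_add ha b).trans hb
        simpa [add_assoc, add_comm a b] using h
      neg_mem' := by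
        intro a ha
        have h := (eventuallyEq_codiscrete_add ha (-a)).symm
        simpa using h }

theorem mem_periods {f : ℂ → ℂ} {l : ℂ} :
    l ∈ periods f ↔ (fun z => f (z + l)) =ᶠ[codiscrete ℂ] f := Iff.rfl

theorem hasPeriods_iff {f : ℂ → ℂ} {L : PeriodPair} : HasPeriods f L ↔ L.lattice ≤ periods f :=
  Iff.rfl

/-- The period groups of functions having a pole are discrete. -/
theorem exists_ball_disjoint_periods {f : ℂ → ℂ} (hf : Meromorphic f) {z₀ : ℂ}
    (hz₀ : meromorphicOrderAt f z₀ < 0) : ∃ r > 0, ∀ l ∈ periods f, ‖l‖ < r → l = 0 := by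
  have h1 := nhdsNE_of_codiscrete (eventually_analyticAt_codiscrete hf) z₀
  rw [eventually_nhdsWithin_iff, Metric.eventually_nhds_iff] at h1
  obtain ⟨r, hr, h⟩ := h1
  refine ⟨r, hr, fun l hl hlr => ?_⟩
  by_contra hl0
  have h2 := h (y := z₀ + l) (by simpa using hlr) (by simpa using hl0)
  have h3 := h2.meromorphicOrderAt_nonneg
  rw [order_add_of_periodic hl] at h3
  exact absurd hz₀ (not_lt.2 h3)

/-- The multiples of the periods of a lattice by a nonzero number form a lattice. -/
theorem exists_lattice_eq_mul (L : PeriodPair) {c : ℂ} (hc : c ≠ 0) :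
    ∃ L' : PeriodPair, ∀ l, l ∈ L'.lattice ↔ ∃ l' ∈ L.lattice, l = c * l' := by
  refine ⟨⟨c * L.ω₁, c * L.ω₂, ?_⟩, fun l => ?_⟩
  · rw [LinearIndependent.pair_iff]
    intro s t hst
    refine LinearIndependent.pair_iff.1 L.indep s t ?_
    refine mul_left_cancel₀ hc ?_
    simp only [real_smul] at hst ⊢
    linear_combination hst
  · rw [PeriodPair.mem_lattice]
    constructor
    · rintro ⟨m, n, rfl⟩
      exact ⟨_, PeriodPair.mem_lattice.2 ⟨m, n, rfl⟩, by ring⟩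
    · rintro ⟨l', hl', rfl⟩
      obtain ⟨m, n, rfl⟩ := PeriodPair.mem_lattice.1 hl'
      exact ⟨m, n, by ring⟩

/-- A discrete group of complex numbers containing a lattice is a lattice. -/
theorem exists_periodPair_lattice_eq (F : Submodule ℤ ℂ) {r : ℝ} (hr : 0 < r)
    (hF : ∀ l ∈ F, ‖l‖ < r → l = 0) (L : PeriodPair) (hL : L.lattice ≤ F) :
    ∃ L' : PeriodPair, L'.lattice = F := by
  have : DiscreteTopology F := by
    refine discreteTopology_of_isOpen_singleton_zero ?_
    rw [Metric.isOpen_iff]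
    rintro x rfl
    refine ⟨r, hr, fun y hy => ?_⟩
    have : (y : ℂ) = 0 := hF y y.2 (by simpa using hy)
    exact Subtype.ext this
  have : IsZLattice ℝ F := by
    refine ⟨?_⟩
    rw [eq_top_iff, ← (inferInstance : IsZLattice ℝ L.lattice).span_top]
    exact Submodule.span_mono hL
  have hrank : Module.finrank ℤ F = 2 := by
    rw [ZLattice.rank ℝ F]; simp
  let b : Module.Basis (Fin 2) ℤ F := Module.finBasisOfFinrankEq ℤ F hrank
  have hli := (b.ofZLatticeBasis ℝ F).linearIndependent
  have hspan := b.ofZLatticeBasis_span ℝ F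
  have hb : ![(b 0 : ℂ), b 1] = b.ofZLatticeBasis ℝ F := by
    ext i
    fin_cases i <;> simp
  refine ⟨⟨b 0, b 1, ?_⟩, ?_⟩
  · rw [hb]
    exact hli
  · refine Eq.trans ?_ hspan
    rw [PeriodPair.lattice]
    congr 1
    ext x
    simp [Fin.exists_fin_two, eq_comm]

/-- A closed discrete set invariant under a lattice is finite modulo this lattice. -/
theorem exists_finset_representatives (L : PeriodPair) (P : Set ℂ)
    (hP : ∀ᶠ z in codiscrete ℂ, z ∉ P) (hPL : ∀ z ∈ P, ∀ l ∈ L.lattice, z + l ∈ P) :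
    ∃ S : Finset ℂ, (∀ z ∈ S, z ∈ P) ∧ (∀ x ∈ S, ∀ y ∈ S, x ≠ y → x - y ∉ L.lattice) ∧
      ∀ z ∈ P, ∃ x ∈ S, z - x ∈ L.lattice := by
  classical
  let D := closure (ZSpan.fundamentalDomain L.basis)
  have hD : IsCompact D := (ZSpan.fundamentalDomain_isBounded L.basis).isCompact_closure
  have hfin : (D \ {z | z ∉ P}).Finite := by
    refine hD.finite_sdiff_of_mem_codiscreteWithin ?_
    exact codiscreteWithin_mono (Set.subset_univ D) hP
  let q : ℂ → ℂ := fun z => Quotient.out (QuotientAddGroup.mk z : ℂ ⧸ L.lattice.toAddSubgroup)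
  have hq : ∀ z, z - q z ∈ L.lattice := by
    intro z
    have h1 : (QuotientAddGroup.mk (q z) : ℂ ⧸ L.lattice.toAddSubgroup) = QuotientAddGroup.mk z :=
      Quotient.out_eq _
    have h2 := QuotientAddGroup.eq.1 h1
    rw [neg_add_eq_sub] at h2
    exact h2
  have hq2 : ∀ z w, z - w ∈ L.lattice → q z = q w := by
    intro z w h
    have h1 : (QuotientAddGroup.mk w : ℂ ⧸ L.lattice.toAddSubgroup) = QuotientAddGroup.mk z :=
      QuotientAddGroup.eq.2 (by rw [neg_add_eq_sub]; exact h)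
    simp only [q, h1]
  refine ⟨hfin.toFinset.image q, ?_, ?_, ?_⟩
  · intro x hx
    obtain ⟨z, hz, rfl⟩ := Finset.mem_image.1 hx
    have hz' : z ∈ P := by simpa using (hfin.mem_toFinset.1 hz).2
    have := hPL z hz' _ (neg_mem (hq z))
    simpa using this
  · intro x hx y hy hxy h
    obtain ⟨z, hz, rfl⟩ := Finset.mem_image.1 hx
    obtain ⟨w, hw, rfl⟩ := Finset.mem_image.1 hy
    refine hxy (hq2 z w ?_)
    have := add_mem (add_mem (hq z) h) (neg_mem (hq w))
    convert this using 1
    ring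
  · intro z hz
    have h1 : ((ZSpan.floor L.basis z : ℂ)) ∈ L.lattice := by
      rw [L.lattice_eq_span_range_basis]
      exact (ZSpan.floor L.basis z).2
    have h2 : ZSpan.fract L.basis z ∈ P := by
      have := hPL z hz _ (neg_mem h1)
      rwa [← sub_eq_add_neg] at this
    have h3 : ZSpan.fract L.basis z ∈ hfin.toFinset := by
      rw [hfin.mem_toFinset]
      exact ⟨subset_closure (ZSpan.fract_mem_fundamentalDomain L.basis z), by simpa using h2⟩
    refine ⟨q (ZSpan.fract L.basis z), Finset.mem_image_of_mem q h3, ?_⟩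
    have := add_mem h1 (hq (ZSpan.fract L.basis z))
    convert this using 1
    rw [ZSpan.fract_apply]
    ring

/-! ### The common period lattice of an elliptic wave -/

namespace ReducedParams

variable {Q : ReducedParams} {u v M : ℂ → ℂ}

theorem IsWave.v_eq (h : Q.IsWave u v M) :
    ∀ᶠ z in codiscrete ℂ, v z = deriv M z / M z - Q.κ - u z := by
  filter_upwards [h.eq_M, eventually_ne_codiscrete h.meromorphic_M (Meromorphic.const 0) h.ne_zero]
    with z h1 h2
  rw [h1, mul_div_assoc, div_self h2]
  ring

theorem mem_periods_deriv {f : ℂ → ℂ} {l : ℂ} (h : l ∈ periods f) : l ∈ periods (deriv f) := by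
  have h1 := deriv_congr_codiscrete h
  filter_upwards [h1] with z hz
  rwa [deriv_comp_add_const] at hz

theorem IsWave.mem_periods_v (h : Q.IsWave u v M) {l : ℂ} (hu : l ∈ periods u)
    (hM : l ∈ periods M) : l ∈ periods v := by
  rw [mem_periods] at *
  have hM' := mem_periods_deriv hM
  rw [mem_periods] at hM'
  filter_upwards [h.v_eq, eventually_codiscrete_add h.v_eq l, hu, hM, hM']
    with z h1 h2 h3 h4 h5
  rw [h1, h2, h3, h4, h5]

/-- `d M + e M²` has the periods of `u`, so that `M` takes at most two values under translation. -/
theorem IsWave.two_mul_mem_periods_M (h : Q.IsWave u v M) {l : ℂ} (hu : l ∈ periods u) :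
    2 * l ∈ periods M := by
  have hMl := meromorphic_comp_add h.meromorphic_M l
  have h1 : ∀ᶠ z in codiscrete ℂ,
      (M (z + l) - M z) * (Q.d + Q.e * (M (z + l) + M z)) = 0 := by
    filter_upwards [h.eq_u, eventually_codiscrete_add h.eq_u l, hu, mem_periods_deriv hu]
      with z h1 h2 h3 h4
    rw [h3, h4] at h2
    linear_combination h2 - h1
  rcases eventuallyEq_zero_or_of_mul (g := fun z => Q.d + Q.e * (M (z + l) + M z))
    (hMl.sub h.meromorphic_M) h1 with h2 | h2
  · have h3 : l ∈ periods M := h2.mono fun z hz => sub_eq_zero.1 hz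
    rw [two_mul]
    exact add_mem h3 h3
  · filter_upwards [h2, eventually_codiscrete_add h2 l] with z h3 h4
    simp only [Pi.zero_apply] at h3 h4
    refine mul_left_cancel₀ Q.e_ne_zero ?_
    rw [two_mul, ← add_assoc]
    linear_combination h4 - h3

/-- `u + v` and `(u - v)²` have the periods of `M`. -/
theorem IsWave.two_mul_mem_periods_u (h : Q.IsWave u v M) {l : ℂ} (hM : l ∈ periods M) :
    2 * l ∈ periods u := by
  have hul := meromorphic_comp_add h.meromorphic_u l
  have hvl := meromorphic_comp_add h.meromorphic_v l
  have hs : ∀ᶠ z in codiscrete ℂ, u (z + l) + v (z + l) = u z + v z := by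
    filter_upwards [h.v_eq, eventually_codiscrete_add h.v_eq l, hM, mem_periods_deriv hM]
      with z h1 h2 h4 h5
    rw [h1, h2, h4, h5]
    ring
  have hs' : ∀ᶠ z in codiscrete ℂ,
      deriv u (z + l) + deriv v (z + l) = deriv u z + deriv v z := by
    have han := (eventually_analyticAt_codiscrete h.meromorphic_u).and
      (eventually_analyticAt_codiscrete h.meromorphic_v)
    filter_upwards [eventually_codiscrete_nhds hs, han, eventually_codiscrete_add han l]
      with z h1 h2 h3
    have h4 := EventuallyEq.deriv_eq h1
    have h5 : HasDerivAt (fun z => u (z + l) + v (z + l)) (deriv u (z + l) + deriv v (z + l)) z :=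
      (h3.1.differentiableAt.hasDerivAt.comp_add_const z l).add
        (h3.2.differentiableAt.hasDerivAt.comp_add_const z l)
    have h6 := h2.1.differentiableAt.hasDerivAt.add h2.2.differentiableAt.hasDerivAt
    rw [h5.deriv] at h4
    rw [h4]
    exact h6.deriv
  have h1 : ∀ᶠ z in codiscrete ℂ,
      ((u (z + l) - v (z + l)) - (u z - v z)) * ((u (z + l) - v (z + l)) + (u z - v z)) = 0 := by
    filter_upwards [h.eq_u, eventually_codiscrete_add h.eq_u l, h.eq_v,
      eventually_codiscrete_add h.eq_v l, hs, hs', hM] with z h1 h2 h3 h4 h5 h6 h7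
    rw [h2, h4, h1, h3, h7] at h6
    linear_combination -2 * h6 - (u (z + l) + v (z + l) + u z + v z) * h5
  have half : ∀ {a b c d : ℂ}, a + b = c + d → a - b = c - d → a = c := by
    intro a b c d h1 h2
    linear_combination (h1 + h2) / 2
  rcases eventuallyEq_zero_or_of_mul (g := fun z => (u (z + l) - v (z + l)) + (u z - v z))
    ((hul.sub hvl).sub (h.meromorphic_u.sub h.meromorphic_v)) h1 with h2 | h2
  · have h3 : l ∈ periods u := by
      filter_upwards [h2, hs] with z h3 h4
      exact half h4 (sub_eq_zero.1 h3)
    rw [two_mul]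
    exact add_mem h3 h3
  · filter_upwards [h2, eventually_codiscrete_add h2 l, hs, eventually_codiscrete_add hs l]
      with z h3 h4 h5 h6
    simp only [Pi.zero_apply] at h3 h4
    rw [two_mul, ← add_assoc]
    exact half (h6.trans h5) (by linear_combination h4 - h3)

/-- A wave with constant square modulus is constant. -/
theorem IsWave.u_const_of_M_const (h : Q.IsWave u v M) {m : ℂ}
    (hM : M =ᶠ[codiscrete ℂ] fun _ => m) : ∃ a, u =ᶠ[codiscrete ℂ] fun _ => a := by
  have hv : ∀ᶠ z in codiscrete ℂ, v z = -Q.κ - u z := by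
    filter_upwards [h.v_eq, deriv_congr_codiscrete hM] with z h1 h2
    rw [h1, h2, deriv_const]
    ring
  have hv' : ∀ᶠ z in codiscrete ℂ, deriv v z = -deriv u z := by
    filter_upwards [deriv_congr_codiscrete hv] with z h1
    rw [h1, deriv_const_sub]
  -- `v = -κ - u`, so that the sum of the two Riccati equations is a quadratic equation for `u`
  obtain ⟨t, ht⟩ : ∃ t : ℂ, t ^ 2 = -((Q.d + Q.d') * m + (Q.e + Q.e') * m ^ 2 + Q.G + Q.G') / 2
      - Q.κ ^ 2 / 4 := IsAlgClosed.exists_pow_nat_eq _ two_pos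
  have h1 : ∀ᶠ z in codiscrete ℂ, (u z + (Q.κ / 2 - t)) * (u z + (Q.κ / 2 + t)) = 0 := by
    filter_upwards [hv, hv', h.eq_u, h.eq_v, hM] with z h1 h2 h3 h4 h5
    rw [h2, h1, h5, h3, h5] at h4
    linear_combination h4 / 2 - ht
  rcases eventuallyEq_zero_or_of_mul (g := fun z => u z + (Q.κ / 2 + t))
    (h.meromorphic_u.add (Meromorphic.const _)) h1 with h2 | h2
  · exact ⟨_, h2.mono fun z hz => eq_neg_of_add_eq_zero_left hz⟩
  · exact ⟨_, h2.mono fun z hz => eq_neg_of_add_eq_zero_left hz⟩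

/-- The periods of an elliptic wave form a lattice, and `M` has poles. -/
theorem IsWave.exists_lattice (h : Q.IsWave u v M)
    (hell : IsNondegenerateElliptic u ∨ IsNondegenerateElliptic M) :
    ∃ L : PeriodPair, L.lattice = periods u ⊓ periods M ∧ ∃ z, meromorphicOrderAt M z < 0 := by
  -- twice a period of one of the functions is a period of both
  have hL₀ : ∃ L : PeriodPair, L.lattice ≤ periods u ⊓ periods M := by
    rcases hell with ⟨_, ⟨L, hL⟩, _⟩ | ⟨_, ⟨L, hL⟩, _⟩
    all_goals
      obtain ⟨L', hL'⟩ := exists_lattice_eq_mul L (two_ne_zero (α := ℂ))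
      refine ⟨L', fun l hl => ?_⟩
      obtain ⟨l', hl', rfl⟩ := (hL' l).1 hl
    · refine ⟨?_, h.two_mul_mem_periods_M (hL l' hl')⟩
      rw [two_mul]
      exact add_mem (hL l' hl') (hL l' hl')
    · refine ⟨h.two_mul_mem_periods_u (hL l' hl'), ?_⟩
      rw [two_mul]
      exact add_mem (hL l' hl') (hL l' hl')
  obtain ⟨L, hL⟩ := hL₀
  have hpole : ∃ z, meromorphicOrderAt M z < 0 := by
    by_contra! hno
    obtain ⟨m, hm⟩ := eventuallyEq_const_of_hasPeriods h.meromorphic_M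
      (fun l hl => (hL hl).2) hno
    rcases hell with ⟨_, _, h1⟩ | ⟨_, _, h1⟩
    · exact h1 (h.u_const_of_M_const hm)
    · exact h1 ⟨m, hm⟩
  obtain ⟨z₀, hz₀⟩ := hpole
  obtain ⟨r, hr, hr'⟩ := exists_ball_disjoint_periods h.meromorphic_M hz₀
  obtain ⟨L', hL'⟩ := exists_periodPair_lattice_eq (periods u ⊓ periods M) hr
    (fun l hl => hr' l hl.2) L hL
  exact ⟨L', hL', z₀, hz₀⟩

end ReducedParams

namespace ReducedParams

variable {Q : ReducedParams} {u v M : ℂ → ℂ}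

/-! ### Residues of a wave -/

theorem IsWave.exists_germ_residue (h : Q.IsWave u v M) (z₀ : ℂ) :
    ∃ U V N : ℂ → ℂ, Q.IsGerm z₀ U V N ∧
      (∀ᶠ z in 𝓝[≠] z₀, u z = U z / (z - z₀) ∧ v z = V z / (z - z₀) ∧ M z = N z / (z - z₀)) ∧
      U z₀ = residue u z₀ ∧ V z₀ = residue v z₀ ∧ N z₀ = residue M z₀ := by
  obtain ⟨U, V, N, g, e⟩ := h.exists_germ z₀
  exact ⟨U, V, N, g, e, (residue_of_eq_div g.analyticAt_U (e.mono fun _ h => h.1)).symm,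
    (residue_of_eq_div g.analyticAt_V (e.mono fun _ h => h.2.1)).symm,
    (residue_of_eq_div g.analyticAt_N (e.mono fun _ h => h.2.2)).symm⟩

theorem IsWave.order_u_neg_iff (h : Q.IsWave u v M) (z₀ : ℂ) :
    meromorphicOrderAt u z₀ < 0 ↔ residue u z₀ ≠ 0 := by
  obtain ⟨U, V, N, g, e, h1, h2, h3⟩ := h.exists_germ_residue z₀
  rw [← h1, order_neg_iff_of_eq_div g.analyticAt_U (e.mono fun _ h => h.1)]

theorem IsWave.order_v_neg_iff (h : Q.IsWave u v M) (z₀ : ℂ) :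
    meromorphicOrderAt v z₀ < 0 ↔ residue v z₀ ≠ 0 := by
  obtain ⟨U, V, N, g, e, h1, h2, h3⟩ := h.exists_germ_residue z₀
  rw [← h2, order_neg_iff_of_eq_div g.analyticAt_V (e.mono fun _ h => h.2.1)]

theorem IsWave.order_M_neg_iff (h : Q.IsWave u v M) (z₀ : ℂ) :
    meromorphicOrderAt M z₀ < 0 ↔ residue M z₀ ≠ 0 := by
  obtain ⟨U, V, N, g, e, h1, h2, h3⟩ := h.exists_germ_residue z₀
  rw [← h3, order_neg_iff_of_eq_div g.analyticAt_N (e.mono fun _ h => h.2.2)]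

theorem IsWave.exists_eq_residue_div_add (h : Q.IsWave u v M) (z₀ : ℂ) :
    (∃ R : ℂ → ℂ, AnalyticAt ℂ R z₀ ∧ ∀ᶠ z in 𝓝[≠] z₀, u z = residue u z₀ / (z - z₀) + R z) ∧
    (∃ R : ℂ → ℂ, AnalyticAt ℂ R z₀ ∧ ∀ᶠ z in 𝓝[≠] z₀, v z = residue v z₀ / (z - z₀) + R z) ∧
    ∃ R : ℂ → ℂ, AnalyticAt ℂ R z₀ ∧ ∀ᶠ z in 𝓝[≠] z₀, M z = residue M z₀ / (z - z₀) + R z := by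
  obtain ⟨U, V, N, g, e, h1, h2, h3⟩ := h.exists_germ_residue z₀
  rw [← h1, ← h2, ← h3]
  exact ⟨exists_eq_div_add_of_eq_div g.analyticAt_U (e.mono fun _ h => h.1),
    exists_eq_div_add_of_eq_div g.analyticAt_V (e.mono fun _ h => h.2.1),
    exists_eq_div_add_of_eq_div g.analyticAt_N (e.mono fun _ h => h.2.2)⟩

theorem IsWave.tendsto_residue (h : Q.IsWave u v M) (z₀ : ℂ) :
    Tendsto (fun z => (z - z₀) * u z) (𝓝[≠] z₀) (𝓝 (residue u z₀)) ∧
      Tendsto (fun z => (z - z₀) * M z) (𝓝[≠] z₀) (𝓝 (residue M z₀)) := by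
  obtain ⟨U, V, N, g, e, h1, h2, h3⟩ := h.exists_germ_residue z₀
  rw [← h1, ← h3]
  exact ⟨tendsto_of_eq_div g.analyticAt_U (e.mono fun _ h => h.1),
    tendsto_of_eq_div g.analyticAt_N (e.mono fun _ h => h.2.2)⟩

theorem IsWave.residue_of_M (h : Q.IsWave u v M) {z₀ : ℂ} (hM : residue M z₀ = 0) :
    (residue u z₀ = 0 ∨ residue u z₀ = 1) ∧ (residue v z₀ = 0 ∨ residue v z₀ = 1) := by
  obtain ⟨U, V, N, g, e, h1, h2, h3⟩ := h.exists_germ_residue z₀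
  rw [← h1, ← h2]
  rw [← h3] at hM
  exact ⟨g.U_eq_zero_or_one hM, g.V_eq_zero_or_one hM⟩

theorem IsWave.exists_poleData (h : Q.IsWave u v M) {z₀ : ℂ} (hM : residue M z₀ ≠ 0) :
    ∃ α : ℝ, Q.IsPoleData (residue u z₀) (residue v z₀) (residue M z₀) α := by
  obtain ⟨U, V, N, g, e, h1, h2, h3⟩ := h.exists_germ_residue z₀
  rw [← h1, ← h2, ← h3]
  exact g.exists_poleData (h3 ▸ hM)

theorem IsPoleData.m_sq {a b m : ℂ} {α : ℝ} (h : Q.IsPoleData a b m α) :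
    m ^ 2 = ((2 * α / Q.e.im : ℝ) : ℂ) := by
  have hei : (Q.e.im : ℂ) ≠ 0 := by exact_mod_cast Q.he
  have h1 := h.e_mul
  have h2 : (Q.e.im : ℂ) * (α ^ 2 - 3 / 4) = 2 * Q.e.re * α := by
    have := congrArg (fun x : ℝ => (x : ℂ)) h.root
    push_cast at this
    exact this
  rw [h.a_eq] at h1
  refine mul_left_cancel₀ (mul_ne_zero hei Q.e_ne_zero) ?_
  push_cast
  field_simp
  have e1 : Q.e = Q.e.re + Q.e.im * I := (re_add_im Q.e).symm
  have e2 : Q.e * (2 * α) = 2 * Q.e.re * α + 2 * Q.e.im * α * I := by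
    linear_combination 2 * α * e1
  linear_combination Q.e.im * h1 - e2 + h2 - Q.e.im * α ^ 2 * I_sq

/-- The residue of `u` at a pole of `M` is determined by that of `M`. -/
theorem IsPoleData.a_eq' {a b m : ℂ} {α : ℝ} (h : Q.IsPoleData a b m α) :
    a = -1 / 2 + I * (Q.e.im * m ^ 2 / 2) := by
  have hei : (Q.e.im : ℂ) ≠ 0 := by exact_mod_cast Q.he
  rw [h.m_sq, h.a_eq]
  push_cast
  field_simp

theorem IsWave.residue_u_eq (h : Q.IsWave u v M) {z₀ : ℂ} (hM : residue M z₀ ≠ 0) :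
    residue u z₀ = -1 / 2 + I * (Q.e.im * residue M z₀ ^ 2 / 2) := by
  obtain ⟨α, hα⟩ := h.exists_poleData hM
  exact hα.a_eq'

/-- Waves of the same parameters having a pole of `M` of the same residue are translates of each
other. -/
theorem IsWave.eq_comp_add {u₁ v₁ M₁ u₂ v₂ M₂ : ℂ → ℂ} (h₁ : Q.IsWave u₁ v₁ M₁)
    (h₂ : Q.IsWave u₂ v₂ M₂) {z₁ z₂ : ℂ} (hM : residue M₁ z₁ ≠ 0)
    (hM12 : residue M₁ z₁ = residue M₂ z₂) :
    (u₁ =ᶠ[codiscrete ℂ] fun z => u₂ (z + (z₂ - z₁))) ∧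
    (v₁ =ᶠ[codiscrete ℂ] fun z => v₂ (z + (z₂ - z₁))) ∧
    M₁ =ᶠ[codiscrete ℂ] fun z => M₂ (z + (z₂ - z₁)) := by
  have h₃ := h₂.comp_add (z₂ - z₁)
  obtain ⟨U, V, N, g, e, a1, a2, a3⟩ := h₁.exists_germ_residue z₁
  obtain ⟨U', V', N', g', e', b1, b2, b3⟩ := h₃.exists_germ_residue z₁
  rw [residue_comp_add, add_sub_cancel] at b1 b2 b3
  refine h₁.eq_of_germs h₃ g g' e e' (by rwa [a3]) ?_ (by rw [a3, b3, hM12])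
  rw [a1, b1, h₁.residue_u_eq hM, h₂.residue_u_eq (by rwa [← hM12]), hM12]

theorem IsWave.sub_mem_periods (h : Q.IsWave u v M) {z₁ z₂ : ℂ} (hM : residue M z₁ ≠ 0)
    (hM12 : residue M z₁ = residue M z₂) : z₂ - z₁ ∈ periods u ⊓ periods M := by
  obtain ⟨h1, h2, h3⟩ := h.eq_comp_add h hM hM12
  exact ⟨h1.symm, h3.symm⟩

theorem residue_add_of_mem_periods {f : ℂ → ℂ} {l : ℂ} (hl : l ∈ periods f) (z : ℂ) :
    residue f (z + l) = residue f z := by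
  rw [← residue_comp_add, residue_congr hl]

/-! ### Counting the poles of an elliptic wave -/

/-- The possible residues of `M`: the four fourth roots of `3 / e_i²`. -/
noncomputable def poleResidue (Q : ReducedParams) (k : Fin 4) : ℂ :=
  (((3 : ℝ) ^ (1 / 4 : ℝ) : ℝ) : ℂ) / (-(Q.e.im : ℂ)) ^ (1 / 2 : ℂ)
    * exp ((k : ℕ) * (2 * I * Real.pi / 4))

theorem exp_quarter : exp (2 * I * Real.pi / 4) = I := by
  rw [show 2 * I * (Real.pi : ℂ) / 4 = Real.pi / 2 * I by ring, exp_pi_div_two_mul_I]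

theorem poleResidue_eq (k : Fin 4) : Q.poleResidue k = Q.poleResidue 0 * I ^ (k : ℕ) := by
  rw [poleResidue, poleResidue, exp_nat_mul, exp_nat_mul, exp_quarter]
  simp

theorem poleResidue_zero_sq : Q.poleResidue 0 ^ 2 = (√3 : ℝ) / -(Q.e.im : ℂ) := by
  have h1 : ((3 : ℝ) ^ (1 / 4 : ℝ)) ^ 2 = √3 := by
    rw [← Real.rpow_natCast, ← Real.rpow_mul (by norm_num), Real.sqrt_eq_rpow]
    norm_num
  have h2 : ((-(Q.e.im : ℂ)) ^ (1 / 2 : ℂ)) ^ 2 = -(Q.e.im : ℂ) := by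
    rw [← cpow_nat_mul]
    norm_num
  rw [poleResidue, mul_pow, div_pow, h2, ← ofReal_pow, h1]
  simp

theorem poleResidue_sq (k : Fin 4) :
    Q.poleResidue k ^ 2 = (√3 : ℝ) / -(Q.e.im : ℂ) * (-1) ^ (k : ℕ) := by
  rw [poleResidue_eq, mul_pow, poleResidue_zero_sq, ← pow_mul, mul_comm (k : ℕ) 2, pow_mul, I_sq]

theorem poleResidue_ne_zero (k : Fin 4) : Q.poleResidue k ≠ 0 := by
  intro h
  have h1 := Q.poleResidue_sq k
  have hei : (Q.e.im : ℂ) ≠ 0 := by exact_mod_cast Q.he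
  rw [h] at h1
  have h2 : ((√3 : ℝ) : ℂ) ≠ 0 := by simp
  simp [hei] at h1

theorem poleResidue_injective : Function.Injective Q.poleResidue := by
  intro j k hjk
  rw [poleResidue_eq, poleResidue_eq (k := k)] at hjk
  have h := mul_left_cancel₀ (Q.poleResidue_ne_zero 0) hjk
  fin_cases j <;> fin_cases k <;> simp [pow_succ, Complex.ext_iff] at h ⊢ <;> norm_num at h

theorem poleResidue_pow_four (k : Fin 4) : Q.poleResidue k ^ 4 = 3 / (Q.e.im : ℂ) ^ 2 := by
  have h3 : ((√3 : ℝ) : ℂ) ^ 2 = 3 := by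
    rw [← ofReal_pow, Real.sq_sqrt (by norm_num)]; norm_num
  have h4 : ((-1 : ℂ) ^ (k : ℕ)) ^ 2 = 1 := by
    rw [← pow_mul, mul_comm, pow_mul]; norm_num
  rw [show 4 = 2 * 2 from rfl, pow_mul, poleResidue_sq, mul_pow, h4, div_pow, h3]
  ring

theorem exists_poleResidue_eq {m : ℂ} (h : m ^ 4 = 3 / (Q.e.im : ℂ) ^ 2) :
    ∃ k, m = Q.poleResidue k := by
  have h0 := Q.poleResidue_pow_four 0
  have hI := I_sq
  set p := Q.poleResidue 0 with hp
  have h1 : (m - p) * ((m + p) * ((m - p * I) * (m + p * I))) = 0 := by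
    linear_combination h - h0 - (m ^ 2 - p ^ 2) * p ^ 2 * hI
  rcases mul_eq_zero.1 h1 with h2 | h1
  · exact ⟨0, sub_eq_zero.1 h2⟩
  rcases mul_eq_zero.1 h1 with h2 | h1
  · exact ⟨2, by rw [poleResidue_eq]; simp only [Fin.val_two, I_sq]; linear_combination h2⟩
  rcases mul_eq_zero.1 h1 with h2 | h2
  · exact ⟨1, by rw [poleResidue_eq]; simp only [Fin.val_one, pow_one]; linear_combination h2⟩
  · refine ⟨3, ?_⟩
    rw [poleResidue_eq, show ((3 : Fin 4) : ℕ) = 3 from rfl, pow_succ, I_sq]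
    linear_combination h2

/-- Representatives of the poles of an elliptic wave, with the residue theorem for `u` and `M`. -/
theorem IsWave.exists_representatives (h : Q.IsWave u v M) {L : PeriodPair}
    (hL : L.lattice ≤ periods u ⊓ periods M) :
    ∃ S : Finset ℂ, (∀ x ∈ S, ∀ y ∈ S, x ≠ y → x - y ∉ L.lattice) ∧
      (∀ z, (residue u z ≠ 0 ∨ residue v z ≠ 0 ∨ residue M z ≠ 0) →
        ∃ x ∈ S, z - x ∈ L.lattice) ∧
      ∑ x ∈ S, residue u x = 0 ∧ ∑ x ∈ S, residue v x = 0 ∧ ∑ x ∈ S, residue M x = 0 := by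
  have hLv : HasPeriods v L := fun l hl => h.mem_periods_v (hL hl).1 (hL hl).2
  have hP : ∀ᶠ z in codiscrete ℂ,
      z ∉ {z | residue u z ≠ 0 ∨ residue v z ≠ 0 ∨ residue M z ≠ 0} := by
    filter_upwards [eventually_analyticAt_codiscrete h.meromorphic_u,
      eventually_analyticAt_codiscrete h.meromorphic_v,
      eventually_analyticAt_codiscrete h.meromorphic_M] with z h1 h2 h3
    simp only [← h.order_u_neg_iff, ← h.order_v_neg_iff, ← h.order_M_neg_iff,
      not_or, not_lt]
    exact ⟨h1.meromorphicOrderAt_nonneg, h2.meromorphicOrderAt_nonneg,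
      h3.meromorphicOrderAt_nonneg⟩
  have hPL : ∀ z ∈ {z | residue u z ≠ 0 ∨ residue v z ≠ 0 ∨ residue M z ≠ 0}, ∀ l ∈ L.lattice,
      z + l ∈ {z | residue u z ≠ 0 ∨ residue v z ≠ 0 ∨ residue M z ≠ 0} := by
    intro z hz l hl
    simp only [Set.mem_ofPred_eq] at hz ⊢
    rwa [residue_add_of_mem_periods (hL hl).1, residue_add_of_mem_periods (hL hl).2,
      residue_add_of_mem_periods (hLv l hl)]
  obtain ⟨S, hS1, hS2, hS3⟩ := exists_finset_representatives L _ hP hPL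
  have hreg : ∀ z, (∀ i ∈ S, z - i ∉ L.lattice) →
      residue u z = 0 ∧ residue v z = 0 ∧ residue M z = 0 := by
    intro z hz
    by_contra hcon
    obtain ⟨x, hx, hzx⟩ := hS3 z (by simp only [Set.mem_ofPred_eq]; tauto)
    exact hz x hx hzx
  refine ⟨S, hS2, hS3, ?_, ?_, ?_⟩
  · refine (sum_residues_of_simple_poles h.meromorphic_u (fun l hl => (hL hl).1) S id (residue u)
      hS2 (fun i _ => (h.exists_eq_residue_div_add i).1) fun z hz => ?_).1
    exact not_lt.1 fun h1 => (h.order_u_neg_iff z).1 h1 (hreg z hz).1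
  · refine (sum_residues_of_simple_poles h.meromorphic_v hLv S id (residue v)
      hS2 (fun i _ => (h.exists_eq_residue_div_add i).2.1) fun z hz => ?_).1
    exact not_lt.1 fun h1 => (h.order_v_neg_iff z).1 h1 (hreg z hz).2.1
  · refine (sum_residues_of_simple_poles h.meromorphic_M (fun l hl => (hL hl).2) S id (residue M)
      hS2 (fun i _ => (h.exists_eq_residue_div_add i).2.2) fun z hz => ?_).1
    exact not_lt.1 fun h1 => (h.order_M_neg_iff z).1 h1 (hreg z hz).2.2

theorem IsPoleData.eq_or_mul_eq {a b m a' b' m' : ℂ} {α α' : ℝ} (h : Q.IsPoleData a b m α)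
    (h' : Q.IsPoleData a' b' m' α') :
    α = α' ∨ α * α' = -3 / 4 ∧ Q.e.im * (α + α') = 2 * Q.e.re := by
  have h1 : (α - α') * (Q.e.im * (α + α') - 2 * Q.e.re) = 0 := by
    linear_combination h.root - h'.root
  rcases mul_eq_zero.1 h1 with h2 | h2
  · exact .inl (sub_eq_zero.1 h2)
  · refine .inr ⟨mul_left_cancel₀ Q.he ?_, sub_eq_zero.1 h2⟩
    linear_combination α * h2 - h.root

/-- The residues at the poles of `M` are `3^{1/4} (-e_i)^{-1/2} i^k`, each occurring once: since
`m² = 2 α / e_i`, the residues `m` of `M` are real or purely imaginary according to the sign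
of `α`, and both `∑ α` and `∑ m` vanish. -/
theorem IsWave.exists_poles (h : Q.IsWave u v M) {L : PeriodPair}
    (hL : L.lattice = periods u ⊓ periods M) (hM : ∃ z, meromorphicOrderAt M z < 0) :
    Q.e.re = 0 ∧ (∀ k, ∃ z, residue M z = Q.poleResidue k) ∧
      ∀ z, residue M z ≠ 0 → ∃ k, residue M z = Q.poleResidue k := by
  classical
  obtain ⟨S, hS, hSrep, hsu, -, hsM⟩ := h.exists_representatives hL.le
  set T := S.filter fun z => residue M z ≠ 0 with hT
  have hTM : ∀ z ∈ T, residue M z ≠ 0 := fun z hz => (Finset.mem_filter.1 hz).2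
  have hα : ∀ z : ℂ, ∃ α : ℝ, residue M z ≠ 0 →
      Q.IsPoleData (residue u z) (residue v z) (residue M z) α := by
    intro z
    by_cases hz : residue M z = 0
    · exact ⟨0, fun h => absurd hz h⟩
    · obtain ⟨α, hα⟩ := h.exists_poleData hz
      exact ⟨α, fun _ => hα⟩
  choose α hα using hα
  have hTrep : ∀ z, residue M z ≠ 0 → ∃ x ∈ T, residue M z = residue M x := by
    intro z hz
    obtain ⟨x, hx, hzx⟩ := hSrep z (.inr (.inr hz))
    have h1 : residue M z = residue M x := by
      rw [hL] at hzx
      rw [← residue_add_of_mem_periods hzx.2 x, add_sub_cancel]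
    exact ⟨x, Finset.mem_filter.2 ⟨hx, by rwa [← h1]⟩, h1⟩
  have inj : ∀ x ∈ T, ∀ y ∈ T, residue M x = residue M y → x = y := by
    intro x hx y hy hxy
    by_contra hne
    refine hS y (Finset.mem_filter.1 hy).1 x (Finset.mem_filter.1 hx).1 (Ne.symm hne) ?_
    rw [hL]
    exact h.sub_mem_periods (hTM x hx) hxy
  have sumM : ∑ x ∈ T, residue M x = 0 := by
    rw [hT, Finset.sum_filter_ne_zero, hsM]
  have sumα : ∑ x ∈ T, α x = 0 := by
    have h1 := congrArg Complex.im hsu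
    rw [im_sum, zero_im] at h1
    rw [hT, Finset.sum_filter]
    refine Eq.trans ?_ h1
    refine Finset.sum_congr rfl fun x _ => ?_
    split_ifs with hx
    · rw [(hα x hx).a_eq]
      simp
    · rcases (h.residue_of_M (not_not.1 hx)).1 with h2 | h2 <;> simp [h2]
  have msq : ∀ x ∈ T, residue M x ^ 2 = ((2 * α x / Q.e.im : ℝ) : ℂ) := fun x hx =>
    (hα x (hTM x hx)).m_sq
  have same : ∀ x ∈ T, ∀ y ∈ T, α x = α y → residue M y = residue M x ∨
      residue M y = -residue M x := by
    intro x hx y hy hxy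
    refine sq_eq_sq_iff_eq_or_eq_neg.1 ?_
    rw [msq x hx, msq y hy, hxy]
  have hneg : ∀ x ∈ T, ∃ y ∈ T, residue M y = -residue M x := by
    intro x hx
    by_contra! hno
    have hmx := hTM x hx
    have h1 : ∑ y ∈ T, (residue M y / residue M x).re = 0 := by
      rw [← re_sum, ← Finset.sum_div, sumM]
      simp
    rw [Finset.sum_eq_single x] at h1
    · rw [div_self hmx] at h1
      simp at h1
    · intro y hy hyx
      have hαne : α x ≠ α y := by
        intro hxy
        rcases same x hx y hy hxy with h2 | h2
        · exact hyx (inj y hy x hx h2)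
        · exact hno y hy h2
      obtain ⟨h2, -⟩ := ((hα x hmx).eq_or_mul_eq (hα y (hTM y hy))).resolve_left hαne
      -- the square of the quotient is a negative real number
      have h3 : (residue M y / residue M x) ^ 2 = ((α y / α x : ℝ) : ℂ) := by
        have h5 : (Q.e.im : ℂ) ≠ 0 := by exact_mod_cast Q.he
        have h6 : (α x : ℂ) ≠ 0 := by exact_mod_cast (hα x hmx).ne_zero
        rw [div_pow, msq x hx, msq y hy]
        push_cast
        field_simp
      have h4 : α y / α x < 0 := by
        have h7 := (hα x hmx).ne_zero
        have : α y / α x = α x * α y / α x ^ 2 := by field_simp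
        rw [this, h2]
        have : 0 < α x ^ 2 := by positivity
        exact div_neg_of_neg_of_pos (by norm_num) this
      generalize residue M y / residue M x = q at h3
      have h5 := congrArg Complex.im h3
      have h6 := congrArg Complex.re h3
      rw [sq, mul_im, ofReal_im] at h5
      rw [sq, mul_re, ofReal_re] at h6
      by_contra hq
      have h7 : q.im = 0 := by
        have : 2 * q.re * q.im = 0 := by linear_combination h5
        simpa [hq] using this
      rw [h7] at h6
      nlinarith [sq_nonneg q.re]
    · exact fun h2 => absurd hx h2
  obtain ⟨z₀, hz₀⟩ := hM
  obtain ⟨x, hx, -⟩ := hTrep z₀ ((h.order_M_neg_iff z₀).1 hz₀)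
  have hx0 := (hα x (hTM x hx)).ne_zero
  obtain ⟨y, hy, hxy⟩ : ∃ y ∈ T, α x ≠ α y := by
    by_contra! hno
    rw [Finset.sum_congr rfl fun y hy => (hno y hy).symm, Finset.sum_const, nsmul_eq_mul] at sumα
    rcases mul_eq_zero.1 sumα with h1 | h1
    · have : T.card = 0 := by exact_mod_cast h1
      rw [Finset.card_eq_zero] at this
      rw [this] at hx
      exact absurd hx (Finset.notMem_empty x)
    · exact hx0 h1
  obtain ⟨h1, h2⟩ := ((hα x (hTM x hx)).eq_or_mul_eq (hα y (hTM y hy))).resolve_left hxy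
  obtain ⟨x', hx', hmx'⟩ := hneg x hx
  obtain ⟨y', hy', hmy'⟩ := hneg y hy
  have αsame : ∀ x ∈ T, ∀ x' ∈ T, residue M x' = -residue M x → α x' = α x := by
    intro x hx x' hx' hm
    have h3 := msq x hx
    have h4 := msq x' hx'
    rw [hm, neg_sq, h3] at h4
    have h5 : 2 * α x / Q.e.im = 2 * α x' / Q.e.im := by exact_mod_cast h4
    have hei := Q.he
    field_simp at h5
    exact h5.symm
  have hαx' := αsame x hx x' hx' hmx'
  have hαy' := αsame y hy y' hy' hmy'
  have nself : ∀ x ∈ T, ∀ x' ∈ T, residue M x' = -residue M x → x ≠ x' := by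
    rintro x hx x' hx' hm rfl
    exact hTM x hx (self_eq_neg.1 hm)
  have hTeq : T = {x, x', y, y'} := by
    ext z
    simp only [Finset.mem_insert, Finset.mem_singleton]
    constructor
    · intro hz
      by_cases hzx : α x = α z
      · rcases same x hx z hz hzx with h3 | h3
        · exact .inl (inj z hz x hx h3)
        · exact .inr (.inl (inj z hz x' hx' (h3.trans hmx'.symm)))
      · obtain ⟨h3, -⟩ := ((hα x (hTM x hx)).eq_or_mul_eq (hα z (hTM z hz))).resolve_left hzx
        have h4 : α y = α z := mul_left_cancel₀ hx0 (h1.trans h3.symm)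
        rcases same y hy z hz h4 with h3 | h3
        · exact .inr (.inr (.inl (inj z hz y hy h3)))
        · exact .inr (.inr (.inr (inj z hz y' hy' (h3.trans hmy'.symm))))
    · rintro (rfl | rfl | rfl | rfl) <;> assumption
  have hsum : 2 * α x + 2 * α y = 0 := by
    have n1 : x ≠ x' := nself x hx x' hx' hmx'
    have n2 : y ≠ y' := nself y hy y' hy' hmy'
    have n3 : x ≠ y := fun h => hxy (by rw [h])
    have n4 : x ≠ y' := fun h => hxy (by rw [← hαy', h])
    have n5 : x' ≠ y := fun h => hxy (by rw [← hαx', h])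
    have n6 : x' ≠ y' := fun h => hxy (by rw [← hαx', ← hαy', h])
    rw [hTeq, Finset.sum_insert (by simp [n1, n3, n4]), Finset.sum_insert (by simp [n5, n6]),
      Finset.sum_insert (by simp [n2]), Finset.sum_singleton, hαx', hαy'] at sumα
    linarith
  have hαy : α y = -α x := by linarith
  have hre : Q.e.re = 0 := by
    rw [hαy] at h2
    linarith
  have hsq : α x ^ 2 = 3 / 4 := by
    rw [hαy] at h1
    linarith
  have hpow : ∀ z ∈ T, residue M z ^ 4 = 3 / (Q.e.im : ℂ) ^ 2 := by
    intro z hz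
    have h3 : α z ^ 2 = 3 / 4 := by
      rw [hTeq] at hz
      simp only [Finset.mem_insert, Finset.mem_singleton] at hz
      rcases hz with rfl | rfl | rfl | rfl
      · exact hsq
      · rw [hαx', hsq]
      · rw [hαy, neg_sq, hsq]
      · rw [hαy', hαy, neg_sq, hsq]
    have h4 : (α z : ℂ) ^ 2 = 3 / 4 := by
      rw [← ofReal_pow, h3]; norm_num
    rw [show 4 = 2 * 2 from rfl, pow_mul, msq z hz]
    push_cast
    rw [div_pow, mul_pow, h4]
    norm_num
  refine ⟨hre, fun k => ?_, fun z hz => ?_⟩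
  · have hpx := hpow x hx
    have hpk := Q.poleResidue_pow_four k
    set p := Q.poleResidue k
    have h3 : (p ^ 2 - residue M x ^ 2) * (p ^ 2 + residue M x ^ 2) = 0 := by
      linear_combination hpk - hpx
    have h4 : residue M y ^ 2 = -residue M x ^ 2 := by
      rw [msq x hx, msq y hy, hαy]
      push_cast
      ring
    rcases mul_eq_zero.1 h3 with h5 | h5
    · rcases sq_eq_sq_iff_eq_or_eq_neg.1 (sub_eq_zero.1 h5) with h6 | h6
      · exact ⟨x, h6.symm⟩
      · exact ⟨x', by rw [h6, hmx']⟩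
    · have h7 : p ^ 2 = residue M y ^ 2 := by linear_combination h5 - h4
      rcases sq_eq_sq_iff_eq_or_eq_neg.1 h7 with h6 | h6
      · exact ⟨y, h6.symm⟩
      · exact ⟨y', by rw [h6, hmy']⟩
  · obtain ⟨x, hx, hzx⟩ := hTrep z hz
    rw [hzx]
    exact exists_poleResidue_eq (hpow x hx)

end ReducedParams

/-! ### Taylor expansions to third order -/

/-- The Taylor expansion of `f` at `z₀` is `c₀ + c₁ (z - z₀) + c₂ (z - z₀)² + c₃ (z - z₀)³ + ⋯`. -/
def HasJet (f : ℂ → ℂ) (z₀ c₀ c₁ c₂ c₃ : ℂ) : Prop :=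
  ∃ R : ℂ → ℂ, AnalyticAt ℂ R z₀ ∧ ∀ᶠ z in 𝓝 z₀,
    f z = c₀ + c₁ * (z - z₀) + c₂ * (z - z₀) ^ 2 + c₃ * (z - z₀) ^ 3 + (z - z₀) ^ 4 * R z

section

variable {f g : ℂ → ℂ} {z₀ c₀ c₁ c₂ c₃ d₀ d₁ d₂ d₃ : ℂ}

theorem exists_hasJet (hf : AnalyticAt ℂ f z₀) : ∃ c₁ c₂ c₃, HasJet f z₀ (f z₀) c₁ c₂ c₃ := by
  have step : ∀ {f : ℂ → ℂ}, AnalyticAt ℂ f z₀ →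
      ∃ g : ℂ → ℂ, AnalyticAt ℂ g z₀ ∧ ∀ z, f z = f z₀ + (z - z₀) * g z := by
    intro f hf
    obtain ⟨g, hg, h⟩ := exists_eq_sub_mul (f := fun z => f z - f z₀) (hf.sub analyticAt_const)
      (sub_self _)
    exact ⟨g, hg, fun z => by rw [← h z]; ring⟩
  obtain ⟨f₁, h₁, e₁⟩ := step hf
  obtain ⟨f₂, h₂, e₂⟩ := step h₁
  obtain ⟨f₃, h₃, e₃⟩ := step h₂
  obtain ⟨f₄, h₄, e₄⟩ := step h₃
  refine ⟨f₁ z₀, f₂ z₀, f₃ z₀, f₄, h₄, .of_forall fun z => ?_⟩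
  rw [e₁ z, e₂ z, e₃ z, e₄ z]
  ring

theorem HasJet.congr (hf : HasJet f z₀ c₀ c₁ c₂ c₃) (h : ∀ᶠ z in 𝓝 z₀, g z = f z) :
    HasJet g z₀ c₀ c₁ c₂ c₃ := by
  obtain ⟨R, hR, h'⟩ := hf
  exact ⟨R, hR, by filter_upwards [h, h'] with z h1 h2; rw [h1, h2]⟩

theorem HasJet.add (hf : HasJet f z₀ c₀ c₁ c₂ c₃) (hg : HasJet g z₀ d₀ d₁ d₂ d₃) :
    HasJet (fun z => f z + g z) z₀ (c₀ + d₀) (c₁ + d₁) (c₂ + d₂) (c₃ + d₃) := by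
  obtain ⟨R, hR, h⟩ := hf
  obtain ⟨S, hS, h'⟩ := hg
  refine ⟨fun z => R z + S z, hR.add hS, ?_⟩
  filter_upwards [h, h'] with z h1 h2
  rw [h1, h2]
  ring

theorem HasJet.const_mul (hf : HasJet f z₀ c₀ c₁ c₂ c₃) (a : ℂ) :
    HasJet (fun z => a * f z) z₀ (a * c₀) (a * c₁) (a * c₂) (a * c₃) := by
  obtain ⟨R, hR, h⟩ := hf
  refine ⟨fun z => a * R z, analyticAt_const.mul hR, ?_⟩
  filter_upwards [h] with z h1
  rw [h1]
  ring

theorem HasJet.mul (hf : HasJet f z₀ c₀ c₁ c₂ c₃) (hg : HasJet g z₀ d₀ d₁ d₂ d₃) :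
    HasJet (fun z => f z * g z) z₀ (c₀ * d₀) (c₀ * d₁ + c₁ * d₀) (c₀ * d₂ + c₁ * d₁ + c₂ * d₀)
      (c₀ * d₃ + c₁ * d₂ + c₂ * d₁ + c₃ * d₀) := by
  obtain ⟨R, hR, h⟩ := hf
  obtain ⟨S, hS, h'⟩ := hg
  refine ⟨fun z => (c₁ * d₃ + c₂ * d₂ + c₃ * d₁) + (c₂ * d₃ + c₃ * d₂) * (z - z₀)
    + c₃ * d₃ * (z - z₀) ^ 2
    + R z * (d₀ + d₁ * (z - z₀) + d₂ * (z - z₀) ^ 2 + d₃ * (z - z₀) ^ 3)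
    + S z * (c₀ + c₁ * (z - z₀) + c₂ * (z - z₀) ^ 2 + c₃ * (z - z₀) ^ 3)
    + (z - z₀) ^ 4 * R z * S z, by fun_prop, ?_⟩
  filter_upwards [h, h'] with z h1 h2
  rw [h1, h2]
  ring

theorem HasJet.id_mul (hf : HasJet f z₀ c₀ c₁ c₂ c₃) :
    HasJet (fun z => (z - z₀) * f z) z₀ 0 c₀ c₁ c₂ := by
  obtain ⟨R, hR, h⟩ := hf
  refine ⟨fun z => c₃ + (z - z₀) * R z, by fun_prop, ?_⟩
  filter_upwards [h] with z h1
  rw [h1]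
  ring

theorem HasJet.id_mul_deriv (hf : HasJet f z₀ c₀ c₁ c₂ c₃) :
    HasJet (fun z => (z - z₀) * deriv f z) z₀ 0 c₁ (2 * c₂) (3 * c₃) := by
  obtain ⟨R, hR, h⟩ := hf
  have hR' := hR.deriv
  refine ⟨fun z => 4 * R z + (z - z₀) * deriv R z, by fun_prop, ?_⟩
  filter_upwards [h.eventually_nhds, hR.eventually_analyticAt] with z h1 h2
  have h3 : HasDerivAt (fun z => z - z₀) 1 z := (hasDerivAt_id z).sub_const z₀
  have h4 := ((((h3.const_mul c₁).const_add c₀).add ((h3.fun_pow 2).const_mul c₂)).add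
    ((h3.fun_pow 3).const_mul c₃)).add ((h3.fun_pow 4).mul h2.differentiableAt.hasDerivAt)
  rw [EventuallyEq.deriv_eq h1]
  refine Eq.trans (congrArg _ h4.deriv) ?_
  push_cast
  ring

theorem HasJet.unique (hf : HasJet f z₀ c₀ c₁ c₂ c₃) (hg : HasJet f z₀ d₀ d₁ d₂ d₃) :
    c₀ = d₀ ∧ c₁ = d₁ ∧ c₂ = d₂ ∧ c₃ = d₃ := by
  obtain ⟨R, hR, h⟩ := hf
  obtain ⟨S, hS, h'⟩ := hg
  have cR := hR.continuousAt
  have cS := hS.continuousAt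
  have lead : ∀ {f g : ℂ → ℂ} {c d : ℂ}, ContinuousAt f z₀ → ContinuousAt g z₀ →
      (∀ᶠ z in 𝓝[≠] z₀, c + (z - z₀) * f z = d + (z - z₀) * g z) →
      c = d ∧ ∀ᶠ z in 𝓝[≠] z₀, f z = g z := by
    intro f g c d hf hg h1
    have h2 : c = d := by
      have := eq_of_eventually_nhdsNE (by fun_prop) (by fun_prop) h1
      simpa using this
    refine ⟨h2, ?_⟩
    filter_upwards [h1, self_mem_nhdsWithin] with z h3 h4
    rw [h2] at h3
    exact mul_left_cancel₀ (sub_ne_zero.2 h4) (add_left_cancel h3)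
  obtain ⟨e₀, h1⟩ := lead (c := c₀) (d := d₀)
    (f := fun z => c₁ + (z - z₀) * (c₂ + (z - z₀) * (c₃ + (z - z₀) * R z)))
    (g := fun z => d₁ + (z - z₀) * (d₂ + (z - z₀) * (d₃ + (z - z₀) * S z)))
    (by fun_prop) (by fun_prop) (by
      filter_upwards [(h.and h').filter_mono nhdsWithin_le_nhds] with z h1
      linear_combination h1.2 - h1.1)
  obtain ⟨e₁, h2⟩ := lead (by fun_prop) (by fun_prop) h1
  obtain ⟨e₂, h3⟩ := lead (by fun_prop) (by fun_prop) h2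
  obtain ⟨e₃, -⟩ := lead cR cS h3
  exact ⟨e₀, e₁, e₂, e₃⟩

end

/-! ### Laurent coefficients at the poles -/

/-- The first coefficients of the Laurent expansions of `u`, `v`, `M` at a pole of `M` of residue
`m`, in terms of `δ = d m`, `δ' = d' m`, `s = e m² = -e' m²`, where `s² = -3`. -/
theorem laurent_coefficients_one {s δ δ' κ a1 b1 n1 : ℂ} (hs : s ^ 2 = -3)
    (eu₁ : a1 = a1 - 2 * ((s - 1) / 2) * a1 - δ - 2 * s * n1)
    (ev₁ : b1 = b1 - 2 * ((-s - 1) / 2) * b1 - δ' + 2 * s * n1)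
    (en₁ : n1 = n1 + (((s - 1) / 2) + ((-s - 1) / 2)) * n1 + (a1 + b1) + κ) :
    n1 = 1 / 16 * s * δ - 1 / 16 * s * δ' + 1 / 16 * δ + 1 / 16 * δ' + 1 / 4 * κ ∧
    a1 = 3 / 16 * s * δ + 1 / 8 * s * δ' + 1 / 8 * s * κ + 1 / 16 * δ - 3 / 8 * κ ∧
    b1 = -1 / 8 * s * δ - 3 / 16 * s * δ' - 1 / 8 * s * κ + 1 / 16 * δ' - 3 / 8 * κ := by
  have hn1 : n1 = 1 / 16 * s * δ - 1 / 16 * s * δ' + 1 / 16 * δ + 1 / 16 * δ' + 1 / 4 * κ := by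
    linear_combination (1 / 4) * en₁ + (-1 / 16 * s - 1 / 16) * eu₁ + (1 / 16 * s - 1 / 16) * ev₁
      + (1 / 16 * a1 + 1 / 16 * b1 + 1 / 4 * n1) * hs
  rw [hn1] at eu₁ ev₁
  have ha1 : a1 = 3 / 16 * s * δ + 1 / 8 * s * δ' + 1 / 8 * s * κ + 1 / 16 * δ - 3 / 8 * κ := by
    linear_combination (-1 / 4 * s - 1 / 4) * eu₁ + (1 / 32 * s * δ - 1 / 32 * s * δ' + 1 / 4 * a1
      + 1 / 16 * δ + 1 / 8 * κ) * hs
  have hb1 : b1 = -1 / 8 * s * δ - 3 / 16 * s * δ' - 1 / 8 * s * κ + 1 / 16 * δ' - 3 / 8 * κ := by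
    linear_combination (1 / 4 * s - 1 / 4) * ev₁ + (1 / 32 * s * δ - 1 / 32 * s * δ' + 1 / 4 * b1
      + 1 / 16 * δ' + 1 / 8 * κ) * hs
  exact ⟨hn1, ha1, hb1⟩

/-- The next coefficients, for `d' = -d`. -/
theorem laurent_coefficients {s δ κ G G' a1 b1 n1 a2 b2 n2 a3 b3 n3 : ℂ} (hs : s ^ 2 = -3)
    (eu₁ : a1 = a1 - 2 * ((s - 1) / 2) * a1 - δ - 2 * s * n1)
    (ev₁ : b1 = b1 - 2 * ((-s - 1) / 2) * b1 - -δ + 2 * s * n1)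
    (en₁ : n1 = n1 + (((s - 1) / 2) + ((-s - 1) / 2)) * n1 + (a1 + b1) + κ)
    (eu₂ : 2 * a2 = a2 - (2 * ((s - 1) / 2) * a2 + a1 ^ 2) - δ * n1 - s * (2 * n2 + n1 ^ 2) - G)
    (ev₂ : 2 * b2 = b2 - (2 * ((-s - 1) / 2) * b2 + b1 ^ 2) + δ * n1 + s * (2 * n2 + n1 ^ 2) - G')
    (en₂ : 2 * n2 = n2 + (((s - 1) / 2) + ((-s - 1) / 2)) * n2 + (a1 + b1 + κ) * n1 + (a2 + b2))
    (eu₃ : 3 * a3 = a3 - (2 * ((s - 1) / 2) * a3 + 2 * a1 * a2) - δ * n2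
      - s * (2 * n3 + 2 * n1 * n2))
    (ev₃ : 3 * b3 = b3 - (2 * ((-s - 1) / 2) * b3 + 2 * b1 * b2) + δ * n2
      + s * (2 * n3 + 2 * n1 * n2))
    (en₃ : 3 * n3 = n3 + (((s - 1) / 2) + ((-s - 1) / 2)) * n3 + (a1 + b1 + κ) * n2
      + (a2 + b2) * n1 + (a3 + b3)) :
    n1 = 1 / 8 * s * δ + 1 / 4 * κ ∧
    a1 = 1 / 16 * s * δ + 1 / 8 * s * κ + 1 / 16 * δ - 3 / 8 * κ ∧
    b1 = 1 / 16 * s * δ - 1 / 8 * s * κ - 1 / 16 * δ - 3 / 8 * κ ∧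
    n2 = 1 / 144 * s * δ * κ + 1 / 18 * G * s - 1 / 18 * G' * s - 7 / 192 * δ ^ 2 + 1 / 48 * κ ^ 2 ∧
    a2 = -7 / 288 * s * δ * κ - 1 / 384 * s * δ ^ 2 + 1 / 32 * s * κ ^ 2 + 2 / 9 * G * s + 1 / 9 *
      G' * s + 1 / 32 * δ * κ - 5 / 384 * δ ^ 2 - 1 / 96 * κ ^ 2 ∧
    b2 = -7 / 288 * s * δ * κ + 1 / 384 * s * δ ^ 2 - 1 / 32 * s * κ ^ 2 - 1 / 9 * G * s - 2 / 9 *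
      G' * s - 1 / 32 * δ * κ - 5 / 384 * δ ^ 2 - 1 / 96 * κ ^ 2 ∧
    n3 = -7 / 1152 * s * δ * κ ^ 2 - 1 / 512 * s * δ ^ 3 - 1 / 144 * G * s * δ - 1 / 144 * G' * s
      * δ + 5 / 2304 * δ ^ 2 * κ + 1 / 192 * κ ^ 3 - 1 / 72 * G * δ + 1 / 24 * G * κ + 1 / 72 * G'
      * δ + 1 / 24 * G' * κ ∧
    a3 = -1 / 256 * s * δ * κ ^ 2 + 43 / 4608 * s * δ ^ 2 * κ + 1 / 1024 * s * δ ^ 3 - 1 / 384 * s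
      * κ ^ 3 - 1 / 72 * G * s * δ - 1 / 24 * G * s * κ - 1 / 144 * G' * s * δ - 19 / 768 * δ * κ
      ^ 2 + 5 / 1536 * δ ^ 2 * κ + 1 / 1024 * δ ^ 3 + 1 / 128 * κ ^ 3 + 1 / 8 * G * κ - 1 / 48 *
      G' * δ ∧
    b3 = -1 / 256 * s * δ * κ ^ 2 - 43 / 4608 * s * δ ^ 2 * κ + 1 / 1024 * s * δ ^ 3 + 1 / 384 * s
      * κ ^ 3 - 1 / 144 * G * s * δ - 1 / 72 * G' * s * δ + 1 / 24 * G' * s * κ + 19 / 768 * δ * κ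
      ^ 2 + 5 / 1536 * δ ^ 2 * κ - 1 / 1024 * δ ^ 3 + 1 / 128 * κ ^ 3 + 1 / 48 * G * δ + 1 / 8 *
      G' * κ := by
  have hn1 : n1 = 1 / 8 * s * δ + 1 / 4 * κ := by
    linear_combination (1 / 4) * en₁ + (-1 / 16 * s - 1 / 16) * eu₁ + (1 / 16 * s - 1 / 16) * ev₁
      + (1 / 16 * a1 + 1 / 16 * b1 + 1 / 4 * n1) * hs
  rw [hn1] at eu₁ ev₁
  have ha1 : a1 = 1 / 16 * s * δ + 1 / 8 * s * κ + 1 / 16 * δ - 3 / 8 * κ := by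
    linear_combination (-1 / 4 * s - 1 / 4) * eu₁ + (1 / 16 * s * δ + 1 / 4 * a1 + 1 / 16 * δ + 1
      / 8 * κ) * hs
  have hb1 : b1 = 1 / 16 * s * δ - 1 / 8 * s * κ - 1 / 16 * δ - 3 / 8 * κ := by
    linear_combination (1 / 4 * s - 1 / 4) * ev₁ + (1 / 16 * s * δ + 1 / 4 * b1 - 1 / 16 * δ + 1 /
      8 * κ) * hs
  rw [ha1, hb1, hn1] at en₂
  rw [ha1, hn1] at eu₂
  rw [hb1, hn1] at ev₂
  have hn2 : n2 = 1 / 144 * s * δ * κ + 1 / 18 * G * s - 1 / 18 * G' * s - 7 / 192 * δ ^ 2 + 1 /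
    48 * κ ^ 2 := by
    linear_combination (1 / 6) * en₂ + (-1 / 18 * s) * eu₂ + (1 / 18 * s) * ev₂ + (1 / 576 * s ^ 2
      * δ ^ 2 + 5 / 576 * s * δ * κ + 7 / 576 * δ ^ 2 - 1 / 288 * κ ^ 2 + 1 / 18 * a2 + 1 / 18 *
      b2 + 2 / 9 * n2) * hs
  rw [hn2] at eu₂ ev₂
  have ha2 : a2 = -7 / 288 * s * δ * κ - 1 / 384 * s * δ ^ 2 + 1 / 32 * s * κ ^ 2 + 2 / 9 * G * s
    + 1 / 9 * G' * s + 1 / 32 * δ * κ - 5 / 384 * δ ^ 2 - 1 / 96 * κ ^ 2 := by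
    linear_combination (-1 / 3 * s) * eu₂ + (1 / 192 * s ^ 2 * δ ^ 2 + 53 / 1728 * s * δ * κ + 1 /
      768 * s * δ ^ 2 + 1 / 192 * s * κ ^ 2 + 1 / 27 * G * s - 1 / 27 * G' * s - 1 / 96 * δ * κ +
      5 / 1152 * δ ^ 2 + 1 / 288 * κ ^ 2 + 1 / 3 * a2) * hs
  have hb2 : b2 = -7 / 288 * s * δ * κ + 1 / 384 * s * δ ^ 2 - 1 / 32 * s * κ ^ 2 - 1 / 9 * G * s
    - 2 / 9 * G' * s - 1 / 32 * δ * κ - 5 / 384 * δ ^ 2 - 1 / 96 * κ ^ 2 := by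
    linear_combination (1 / 3 * s) * ev₂ + (1 / 192 * s ^ 2 * δ ^ 2 + 53 / 1728 * s * δ * κ - 1 /
      768 * s * δ ^ 2 - 1 / 192 * s * κ ^ 2 + 1 / 27 * G * s - 1 / 27 * G' * s + 1 / 96 * δ * κ +
      5 / 1152 * δ ^ 2 + 1 / 288 * κ ^ 2 + 1 / 3 * b2) * hs
  rw [ha1, hb1, ha2, hb2, hn1, hn2] at en₃
  rw [ha1, ha2, hn1, hn2] at eu₃
  rw [hb1, hb2, hn1, hn2] at ev₃
  have hn3 : n3 = -7 / 1152 * s * δ * κ ^ 2 - 1 / 512 * s * δ ^ 3 - 1 / 144 * G * s * δ - 1 / 144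
    * G' * s * δ + 5 / 2304 * δ ^ 2 * κ + 1 / 192 * κ ^ 3 - 1 / 72 * G * δ + 1 / 24 * G * κ + 1 /
    72 * G' * δ + 1 / 24 * G' * κ := by
    linear_combination (1 / 6) * en₃ + (-1 / 24 * s + 1 / 24) * eu₃ + (1 / 24 * s + 1 / 24) * ev₃
      + (1 / 6912 * s ^ 2 * δ ^ 2 * κ + 1 / 864 * G * s ^ 2 * δ - 1 / 864 * G' * s ^ 2 * δ + 5 /
      9216 * s * δ * κ ^ 2 - 29 / 36864 * s * δ ^ 3 + 1 / 576 * G * s * δ + 1 / 288 * G * s * κ +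
      1 / 576 * G' * s * δ - 1 / 288 * G' * s * κ - 109 / 55296 * δ ^ 2 * κ - 1 / 512 * κ ^ 3 + 1
      / 216 * G * δ - 1 / 72 * G * κ - 1 / 216 * G' * δ - 1 / 72 * G' * κ + 1 / 24 * a3 + 1 / 24 *
      b3 + 1 / 6 * n3) * hs
  rw [hn3] at eu₃ ev₃
  have ha3 : a3 = -1 / 256 * s * δ * κ ^ 2 + 43 / 4608 * s * δ ^ 2 * κ + 1 / 1024 * s * δ ^ 3 - 1
    / 384 * s * κ ^ 3 - 1 / 72 * G * s * δ - 1 / 24 * G * s * κ - 1 / 144 * G' * s * δ - 19 / 768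
    * δ * κ ^ 2 + 5 / 1536 * δ ^ 2 * κ + 1 / 1024 * δ ^ 3 + 1 / 128 * κ ^ 3 + 1 / 8 * G * κ - 1 /
    48 * G' * δ := by
    linear_combination (-1 / 4 * s + 1 / 4) * eu₃ + (1 / 2304 * s ^ 2 * δ ^ 2 * κ + 1 / 288 * G *
      s ^ 2 * δ - 1 / 288 * G' * s ^ 2 * δ - 13 / 9216 * s * δ * κ ^ 2 - 25 / 18432 * s * δ ^ 2 *
      κ - 41 / 12288 * s * δ ^ 3 + 1 / 512 * s * κ ^ 3 + 1 / 48 * G * s * κ + 1 / 288 * G' * s * δ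
      + 79 / 9216 * δ * κ ^ 2 - 41 / 18432 * δ ^ 2 * κ + 35 / 12288 * δ ^ 3 - 5 / 1536 * κ ^ 3 - 1
      / 24 * G * κ + 1 / 144 * G' * δ + 1 / 4 * a3) * hs
  have hb3 : b3 = -1 / 256 * s * δ * κ ^ 2 - 43 / 4608 * s * δ ^ 2 * κ + 1 / 1024 * s * δ ^ 3 + 1
    / 384 * s * κ ^ 3 - 1 / 144 * G * s * δ - 1 / 72 * G' * s * δ + 1 / 24 * G' * s * κ + 19 / 768
    * δ * κ ^ 2 + 5 / 1536 * δ ^ 2 * κ - 1 / 1024 * δ ^ 3 + 1 / 128 * κ ^ 3 + 1 / 48 * G * δ + 1 /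
    8 * G' * κ := by
    linear_combination (1 / 4 * s + 1 / 4) * ev₃ + (1 / 2304 * s ^ 2 * δ ^ 2 * κ + 1 / 288 * G * s
      ^ 2 * δ - 1 / 288 * G' * s ^ 2 * δ - 13 / 9216 * s * δ * κ ^ 2 + 25 / 18432 * s * δ ^ 2 * κ
      - 41 / 12288 * s * δ ^ 3 - 1 / 512 * s * κ ^ 3 + 1 / 288 * G * s * δ - 1 / 48 * G' * s * κ -
      79 / 9216 * δ * κ ^ 2 - 41 / 18432 * δ ^ 2 * κ - 35 / 12288 * δ ^ 3 - 5 / 1536 * κ ^ 3 - 1 /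
      144 * G * δ - 1 / 24 * G' * κ + 1 / 4 * b3) * hs
  exact ⟨hn1, ha1, hb1, hn2, ha2, hb2, hn3, ha3, hb3⟩

namespace ReducedParams

variable {Q : ReducedParams} {u v M : ℂ → ℂ}

/-- The Laurent expansions at a pole of `M`, as long as `e' = -e`. -/
theorem IsGerm.exists_jets {z₀ : ℂ} {U V N : ℂ → ℂ} (g : Q.IsGerm z₀ U V N) (hN : N z₀ ≠ 0)
    (he : Q.e.re = 0) : ∃ s a1 b1 n1 a2 b2 n2 a3 b3 n3 : ℂ, s = Q.e * N z₀ ^ 2 ∧ s ^ 2 = -3 ∧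
      HasJet U z₀ ((s - 1) / 2) a1 a2 a3 ∧ HasJet V z₀ ((-s - 1) / 2) b1 b2 b3 ∧
      HasJet N z₀ (N z₀) (N z₀ * n1) (N z₀ * n2) (N z₀ * n3) ∧
      a1 = a1 - 2 * ((s - 1) / 2) * a1 - Q.d * N z₀ - 2 * s * n1 ∧
      b1 = b1 - 2 * ((-s - 1) / 2) * b1 - Q.d' * N z₀ + 2 * s * n1 ∧
      n1 = n1 + (((s - 1) / 2) + ((-s - 1) / 2)) * n1 + (a1 + b1) + Q.κ ∧
      2 * a2 = a2 - (2 * ((s - 1) / 2) * a2 + a1 ^ 2) - Q.d * N z₀ * n1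
        - s * (2 * n2 + n1 ^ 2) - Q.G ∧
      2 * b2 = b2 - (2 * ((-s - 1) / 2) * b2 + b1 ^ 2) - Q.d' * N z₀ * n1
        + s * (2 * n2 + n1 ^ 2) - Q.G' ∧
      2 * n2 = n2 + (((s - 1) / 2) + ((-s - 1) / 2)) * n2 + (a1 + b1 + Q.κ) * n1 + (a2 + b2) ∧
      3 * a3 = a3 - (2 * ((s - 1) / 2) * a3 + 2 * a1 * a2) - Q.d * N z₀ * n2
        - s * (2 * n3 + 2 * n1 * n2) ∧
      3 * b3 = b3 - (2 * ((-s - 1) / 2) * b3 + 2 * b1 * b2) - Q.d' * N z₀ * n2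
        + s * (2 * n3 + 2 * n1 * n2) ∧
      3 * n3 = n3 + (((s - 1) / 2) + ((-s - 1) / 2)) * n3 + (a1 + b1 + Q.κ) * n2
        + (a2 + b2) * n1 + (a3 + b3) := by
  obtain ⟨α, hp⟩ := g.exists_poleData hN
  have he' : Q.e' = -Q.e := by
    rw [e', Complex.ext_iff]
    simp [he]
  have hα : (α : ℂ) ^ 2 = 3 / 4 := by
    have h1 := hp.root
    rw [he] at h1
    have h2 : α ^ 2 - 3 / 4 = 0 := by
      refine mul_left_cancel₀ Q.he ?_
      linear_combination h1
    have h3 : α ^ 2 = 3 / 4 := by linarith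
    rw [← ofReal_pow, h3]
    norm_num
  have hs : Q.e * N z₀ ^ 2 = 2 * I * α := by
    rw [hp.e_mul, hp.a_eq]
    linear_combination hα - (α : ℂ) ^ 2 * I_sq
  obtain ⟨a1, a2, a3, jU⟩ := exists_hasJet g.analyticAt_U
  obtain ⟨b1, b2, b3, jV⟩ := exists_hasJet g.analyticAt_V
  obtain ⟨m1, m2, m3, jN⟩ := exists_hasJet g.analyticAt_N
  obtain ⟨n1, rfl⟩ : ∃ n, m1 = N z₀ * n := ⟨m1 / N z₀, by field_simp⟩
  obtain ⟨n2, rfl⟩ : ∃ n, m2 = N z₀ * n := ⟨m2 / N z₀, by field_simp⟩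
  obtain ⟨n3, rfl⟩ : ∃ n, m3 = N z₀ * n := ⟨m3 / N z₀, by field_simp⟩
  rw [show U z₀ = (Q.e * N z₀ ^ 2 - 1) / 2 by rw [hs, hp.a_eq]; ring] at jU
  rw [show V z₀ = (-(Q.e * N z₀ ^ 2) - 1) / 2 by rw [hs, hp.b_eq]; ring] at jV
  have j1 : HasJet (fun z => (z - z₀) ^ 2) z₀ 0 0 1 0 :=
    ⟨fun _ => 0, analyticAt_const, .of_forall fun z => by ring⟩
  have j2 : HasJet (fun z => z - z₀) z₀ 0 1 0 0 :=
    ⟨fun _ => 0, analyticAt_const, .of_forall fun z => by ring⟩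
  have jN2 := jN.mul jN
  have kU := (((jU.add ((jU.mul jU).const_mul (-1))).add ((jN.id_mul).const_mul (-Q.d))).add
    (jN2.const_mul (-Q.e))).add (j1.const_mul (-Q.G))
  have kV := (((jV.add ((jV.mul jV).const_mul (-1))).add ((jN.id_mul).const_mul (-Q.d'))).add
    (jN2.const_mul (-Q.e'))).add (j1.const_mul (-Q.G'))
  have kN := jN.add (((jU.add jV).add (j2.const_mul Q.κ)).mul jN)
  obtain ⟨-, u1, u2, u3⟩ := jU.id_mul_deriv.unique (kU.congr (g.eq_U.mono fun z hz => by
    rw [hz]; ring))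
  obtain ⟨-, v1, v2, v3⟩ := jV.id_mul_deriv.unique (kV.congr (g.eq_V.mono fun z hz => by
    rw [hz]; ring))
  obtain ⟨-, w1, w2, w3⟩ := jN.id_mul_deriv.unique (kN.congr (g.eq_N.mono fun z hz => by
    rw [hz]))
  rw [he'] at v1 v2 v3
  refine ⟨_, a1, b1, n1, a2, b2, n2, a3, b3, n3, rfl, ?_, jU, jV, jN, ?_, ?_, ?_, ?_, ?_, ?_,
    ?_, ?_, ?_⟩
  · rw [hs]
    linear_combination 4 * (α : ℂ) ^ 2 * I_sq - 4 * hα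
  · linear_combination u1
  · linear_combination v1
  · refine mul_left_cancel₀ hN ?_
    linear_combination w1
  · linear_combination u2
  · linear_combination v2
  · refine mul_left_cancel₀ hN ?_
    linear_combination w2
  · linear_combination u3
  · linear_combination v3
  · refine mul_left_cancel₀ hN ?_
    linear_combination w3

/-! ### Necessary conditions from the residue theorem -/

/-- `u M`, `v M` and `M` are regular where `M` has no pole. -/
theorem IsWave.exists_analytic (h : Q.IsWave u v M) {z₀ : ℂ} (hM : residue M z₀ = 0) :
    (∃ A : ℂ → ℂ, AnalyticAt ℂ A z₀ ∧ ∀ᶠ z in 𝓝[≠] z₀, u z * M z = A z) ∧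
    (∃ B : ℂ → ℂ, AnalyticAt ℂ B z₀ ∧ ∀ᶠ z in 𝓝[≠] z₀, v z * M z = B z) ∧
    ∃ K : ℂ → ℂ, AnalyticAt ℂ K z₀ ∧ ∀ᶠ z in 𝓝[≠] z₀, M z = K z := by
  obtain ⟨U, V, N, g, e, h1, h2, h3⟩ := h.exists_germ_residue z₀
  rw [← h3] at hM
  obtain ⟨K, hK, hNK, hUVK, -⟩ := g.exists_analytic_M hM
  have eK : ∀ᶠ z in 𝓝[≠] z₀, M z = K z := by
    filter_upwards [e, self_mem_nhdsWithin] with z h4 h5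
    rw [h4.2.2, hNK, mul_div_cancel_left₀ _ (sub_ne_zero.2 h5)]
  have aux : ∀ {w W : ℂ → ℂ}, AnalyticAt ℂ W z₀ → (∀ᶠ z in 𝓝[≠] z₀, w z = W z / (z - z₀)) →
      W z₀ * K z₀ = 0 →
      ∃ A : ℂ → ℂ, AnalyticAt ℂ A z₀ ∧ ∀ᶠ z in 𝓝[≠] z₀, w z * M z = A z := by
    intro w W hW hw h0
    obtain ⟨A, hA, hWA⟩ := exists_eq_sub_mul (hW.mul hK) h0
    refine ⟨A, hA, ?_⟩
    filter_upwards [hw, eK, self_mem_nhdsWithin] with z h4 h5 h6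
    have h7 := hWA z
    simp only [Pi.mul_apply] at h7
    rw [h4, h5, div_mul_eq_mul_div, h7, mul_div_cancel_left₀ _ (sub_ne_zero.2 h6)]
  have hU := g.U_eq_zero_or_one hM
  have hV := g.V_eq_zero_or_one hM
  refine ⟨aux g.analyticAt_U (e.mono fun _ h => h.1) ?_,
    aux g.analyticAt_V (e.mono fun _ h => h.2.1) ?_, K, hK, eK⟩
  all_goals
    rcases hU with hU | hU <;> rcases hV with hV | hV <;> rw [hU, hV] at hUVK <;>
      simp [hU, hV] at hUVK ⊢ <;> exact hUVK

theorem exists_hasJet_of {f F : ℂ → ℂ} {z₀ c₀ c₁ c₂ c₃ ρ : ℂ} (hF : HasJet F z₀ c₀ c₁ c₂ c₃)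
    (hρ : c₃ = ρ) (hf : ∀ᶠ z in 𝓝[≠] z₀, f z = F z / (z - z₀) ^ 4) :
    ∃ (F : ℂ → ℂ) (c₀ c₁ c₂ : ℂ), HasJet F z₀ c₀ c₁ c₂ ρ ∧
      ∀ᶠ z in 𝓝[≠] z₀, f z = F z / (z - z₀) ^ 4 :=
  ⟨F, c₀, c₁, c₂, hρ ▸ hF, hf⟩

/-- The residue theorem for a function with poles only at the poles of `M`, of order at most
four. -/
theorem IsWave.sum_residues (h : Q.IsWave u v M) {L : PeriodPair}
    (hL : L.lattice = periods u ⊓ periods M) {y : Fin 4 → ℂ}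
    (hy : ∀ k, residue M (y k) = Q.poleResidue k)
    (hall : ∀ z, residue M z ≠ 0 → ∃ k, residue M z = Q.poleResidue k)
    {f : ℂ → ℂ} (hf : Meromorphic f) (hfL : HasPeriods f L)
    (hreg : ∀ z, residue M z = 0 → 0 ≤ meromorphicOrderAt f z) (ρ : Fin 4 → ℂ)
    (hjet : ∀ k, ∃ (F : ℂ → ℂ) (c₀ c₁ c₂ : ℂ), HasJet F (y k) c₀ c₁ c₂ (ρ k) ∧
      ∀ᶠ z in 𝓝[≠] (y k), f z = F z / (z - y k) ^ 4) : ∑ k, ρ k = 0 := by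
  choose F c₀ c₁ c₂ hF hfF using hjet
  refine sum_residues_eq_zero hf hfL Finset.univ y 3
    (fun k j => ![ρ k, c₂ k, c₁ k, c₀ k] (Fin.ofNat 4 j)) ?_ ?_ ?_
  · intro i _ j _ hij hmem
    rw [hL] at hmem
    refine hij (Q.poleResidue_injective ?_)
    rw [← hy i, ← hy j, ← residue_add_of_mem_periods hmem.2 (y j), add_sub_cancel]
  · intro k _
    obtain ⟨R, hR, hFR⟩ := hF k
    refine ⟨R, hR, ?_⟩
    filter_upwards [hfF k, hFR.filter_mono nhdsWithin_le_nhds, self_mem_nhdsWithin]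
      with z h1 h2 h3
    have hz : z - y k ≠ 0 := sub_ne_zero.2 h3
    rw [h1, h2]
    simp only [Finset.sum_range_succ, Finset.sum_range_zero]
    simp [Fin.ofNat]
    field_simp
    ring
  · intro z hz
    refine hreg z ?_
    by_contra hne
    obtain ⟨k, hk⟩ := hall z hne
    refine hz k (Finset.mem_univ k) ?_
    rw [hL]
    exact h.sub_mem_periods (by rw [hy k]; exact Q.poleResidue_ne_zero k) (by rw [hy k, hk])

/-- Only the monomials of degree divisible by four survive the summation over the poles. -/
theorem sum_poleResidue (c1 c2 c3 c4 c5 c6 c7 : ℂ)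
    (h : ∑ k, (c1 * Q.poleResidue k + c2 * Q.poleResidue k ^ 2 + c3 * Q.poleResidue k ^ 3
      + c4 * Q.poleResidue k ^ 4 + c5 * Q.poleResidue k ^ 5 + c6 * Q.poleResidue k ^ 6
      + c7 * Q.poleResidue k ^ 7) = 0) : c4 = 0 := by
  have h0 := Q.poleResidue_ne_zero 0
  simp only [Fin.sum_univ_four, poleResidue_eq (k := 1), poleResidue_eq (k := 2),
    poleResidue_eq (k := 3)] at h
  simp only [Fin.val_one, Fin.val_two, show ((3 : Fin 4) : ℕ) = 3 from rfl, pow_succ, pow_zero,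
    one_mul] at h
  have hI := I_mul_I
  have h1 : 4 * (c4 * Q.poleResidue 0 ^ 4) = 0 := by
    rw [← h]
    generalize Q.poleResidue 0 = p
    simp only [hI]
    ring_nf
    simp only [show I ^ 2 = -1 from I_sq, show I ^ 4 = 1 from I_pow_four,
      show I ^ 6 = -1 by rw [show 6 = 4 + 2 from rfl, pow_add, I_pow_four, I_sq]; ring]
    ring
  have h2 := (mul_eq_zero.1 h1).resolve_left (by norm_num)
  exact (mul_eq_zero.1 h2).resolve_right (pow_ne_zero 4 h0)

end ReducedParams

namespace ReducedParams

variable {Q : ReducedParams} {u v M : ℂ → ℂ} {L : PeriodPair} {y : Fin 4 → ℂ}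

/-- A wave whose common period group is the lattice of `L`, the poles of `M` being represented
by `y 0, …, y 3`. -/
structure IsLatticeWave (Q : ReducedParams) (u v M : ℂ → ℂ) (L : PeriodPair) (y : Fin 4 → ℂ) :
    Prop where
  wave : Q.IsWave u v M
  lattice : L.lattice = periods u ⊓ periods M
  re_e : Q.e.re = 0
  residue_y : ∀ k, residue M (y k) = Q.poleResidue k
  exists_residue_eq : ∀ z, residue M z ≠ 0 → ∃ k, residue M z = Q.poleResidue k

theorem IsWave.exists_isLatticeWave (h : Q.IsWave u v M)
    (hell : IsNondegenerateElliptic u ∨ IsNondegenerateElliptic M) :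
    ∃ L y, Q.IsLatticeWave u v M L y := by
  obtain ⟨L, hL, hz⟩ := h.exists_lattice hell
  obtain ⟨he, hy, hall⟩ := h.exists_poles hL hz
  choose y hy using hy
  exact ⟨L, y, h, hL, he, hy, hall⟩

namespace IsLatticeWave

theorem e'_eq (h : Q.IsLatticeWave u v M L y) : Q.e' = -Q.e := by
  rw [e', Complex.ext_iff]
  simp [h.re_e]

theorem hasPeriods_u (h : Q.IsLatticeWave u v M L y) : HasPeriods u L :=
  fun _ hl => (h.lattice ▸ hl : _ ∈ periods u ⊓ periods M).1

theorem hasPeriods_M (h : Q.IsLatticeWave u v M L y) : HasPeriods M L :=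
  fun _ hl => (h.lattice ▸ hl : _ ∈ periods u ⊓ periods M).2

theorem hasPeriods_v (h : Q.IsLatticeWave u v M L y) : HasPeriods v L :=
  fun l hl => h.wave.mem_periods_v (h.hasPeriods_u l hl) (h.hasPeriods_M l hl)

theorem sum_residues (h : Q.IsLatticeWave u v M L y) {f : ℂ → ℂ} (hf : Meromorphic f)
    (hfL : HasPeriods f L) (hreg : ∀ z, residue M z = 0 → 0 ≤ meromorphicOrderAt f z)
    (ρ : Fin 4 → ℂ)
    (hjet : ∀ k, ∃ (F : ℂ → ℂ) (c₀ c₁ c₂ : ℂ), HasJet F (y k) c₀ c₁ c₂ (ρ k) ∧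
      ∀ᶠ z in 𝓝[≠] (y k), f z = F z / (z - y k) ^ 4) : ∑ k, ρ k = 0 :=
  h.wave.sum_residues h.lattice h.residue_y h.exists_residue_eq hf hfL hreg ρ hjet

/-- The residue theorem for `u M`. -/
theorem d_add_d' (h : Q.IsLatticeWave u v M L y) : Q.d + Q.d' = 0 := by
  have key := h.sum_residues (f := fun z => u z * M z)
    (h.wave.meromorphic_u.mul h.wave.meromorphic_M) (fun l hl => by
      filter_upwards [h.hasPeriods_u l hl, h.hasPeriods_M l hl] with z h1 h2
      rw [h1, h2]) (fun z hz => ?_)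
    (fun k => -Q.κ / 2 * Q.poleResidue k + (Q.d' - Q.d) / 16 * Q.poleResidue k ^ 2
      + Q.e * Q.κ / 4 * Q.poleResidue k ^ 3
      + 3 / 16 * Q.e * (Q.d + Q.d') * Q.poleResidue k ^ 4 + 0 * Q.poleResidue k ^ 5
      + 0 * Q.poleResidue k ^ 6 + 0 * Q.poleResidue k ^ 7) fun k => ?_
  · have h1 := sum_poleResidue _ _ _ _ _ _ _ key
    have h2 := Q.e_ne_zero
    refine mul_left_cancel₀ h2 ?_
    linear_combination 16 / 3 * h1
  · obtain ⟨⟨A, hA, eA⟩, -⟩ := h.wave.exists_analytic hz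
    exact order_nonneg_of_eventuallyEq hA eA
  · obtain ⟨U, V, N, g, e, h1, h2, h3⟩ := h.wave.exists_germ_residue (y k)
    rw [h.residue_y] at h3
    obtain ⟨s, a1, b1, n1, a2, b2, n2, a3, b3, n3, hs, hs3, jU, jV, jN, eu, ev, en, -⟩ :=
      g.exists_jets (by rw [h3]; exact Q.poleResidue_ne_zero k) h.re_e
    rw [h3] at hs jN eu ev
    obtain ⟨hn1, ha1, -⟩ := laurent_coefficients_one hs3 eu ev en
    refine exists_hasJet_of ((jU.mul jN).id_mul.id_mul) ?_ ?_
    · rw [hn1, ha1]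
      set m := Q.poleResidue k
      linear_combination m * (1 / 32 * (Q.d * m) - 1 / 32 * (Q.d' * m)) * hs3
        + m * (3 / 16 * (Q.d * m) + 3 / 16 * (Q.d' * m) + 1 / 4 * Q.κ) * hs
    · filter_upwards [e, self_mem_nhdsWithin] with z h4 h5
      have hz : z - y k ≠ 0 := sub_ne_zero.2 h5
      rw [h4.1, h4.2.2]
      field_simp

theorem order_uvMM_nonneg (h : Q.IsWave u v M) {z₀ : ℂ} (hz : residue M z₀ = 0) :
    0 ≤ meromorphicOrderAt (fun z => u z * M z * M z) z₀ ∧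
      0 ≤ meromorphicOrderAt (fun z => u z * M z * (v z * M z)) z₀ := by
  obtain ⟨⟨A, hA, eA⟩, ⟨B, hB, eB⟩, ⟨K, hK, eK⟩⟩ := h.exists_analytic hz
  refine ⟨order_nonneg_of_eventuallyEq (hA.mul hK) ?_,
    order_nonneg_of_eventuallyEq (hA.mul hB) ?_⟩
  · filter_upwards [eA, eK] with z h1 h2
    rw [h1, h2]; rfl
  · filter_upwards [eA, eB] with z h1 h2
    rw [h1, h2]; rfl

/-- The residue theorem for `u M²`. -/
theorem G_add_G' (h : Q.IsLatticeWave u v M L y) : Q.G + Q.G' = -7 / 8 * Q.κ ^ 2 := by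
  have hd : Q.d' = -Q.d := by linear_combination h.d_add_d'
  have key := h.sum_residues (f := fun z => u z * M z * M z)
    ((h.wave.meromorphic_u.mul h.wave.meromorphic_M).mul h.wave.meromorphic_M) (fun l hl => by
      filter_upwards [h.hasPeriods_u l hl, h.hasPeriods_M l hl] with z h1 h2
      rw [h1, h2]) (fun z hz => (order_uvMM_nonneg h.wave hz).1)
    (fun k => 0 * Q.poleResidue k + (-Q.κ ^ 2 / 4 - (Q.G - Q.G') / 6) * Q.poleResidue k ^ 2
      + -7 / 48 * Q.d * Q.κ * Q.poleResidue k ^ 3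
      + Q.e * (7 / 48 * Q.κ ^ 2 + (Q.G + Q.G') / 6) * Q.poleResidue k ^ 4
      + -1 / 8 * Q.e * Q.d * Q.κ * Q.poleResidue k ^ 5
      + -3 / 64 * Q.e * Q.d ^ 2 * Q.poleResidue k ^ 6 + 0 * Q.poleResidue k ^ 7) fun k => ?_
  · have h1 := sum_poleResidue _ _ _ _ _ _ _ key
    have h2 := Q.e_ne_zero
    refine mul_left_cancel₀ h2 ?_
    linear_combination 6 * h1
  · obtain ⟨U, V, N, g, e, h1, h2, h3⟩ := h.wave.exists_germ_residue (y k)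
    rw [h.residue_y] at h3
    obtain ⟨s, a1, b1, n1, a2, b2, n2, a3, b3, n3, hs, hs3, jU, jV, jN, eu₁, ev₁, en₁, eu₂, ev₂,
      en₂, eu₃, ev₃, en₃⟩ := g.exists_jets (by rw [h3]; exact Q.poleResidue_ne_zero k) h.re_e
    rw [h3] at hs jN eu₁ ev₁ eu₂ ev₂ eu₃ ev₃
    rw [hd] at ev₁ ev₂ ev₃
    obtain ⟨hn1, ha1, hb1, hn2, ha2, hb2, hn3, ha3, hb3⟩ :=
      laurent_coefficients (δ := Q.d * Q.poleResidue k) (G' := Q.G') hs3 eu₁ (by linear_combination ev₁) en₁ eu₂ (by linear_combination ev₂) en₂ eu₃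
      (by linear_combination ev₃) en₃
    refine exists_hasJet_of (((jU.mul jN).mul jN).id_mul) ?_ ?_
    · rw [hn1, ha1, hn2, ha2]
      set m := Q.poleResidue k
      linear_combination m ^ 2 * (1 / 128 * s * (Q.d * m) ^ 2 + 5 / 72 * (Q.d * m) * Q.κ
          + 1 / 128 * (Q.d * m) ^ 2 + 1 / 18 * Q.G - 1 / 18 * Q.G') * hs3
        + m ^ 2 * (-1 / 8 * (Q.d * m) * Q.κ - 3 / 64 * (Q.d * m) ^ 2 + 7 / 48 * Q.κ ^ 2
          + 1 / 6 * Q.G + 1 / 6 * Q.G') * hs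
    · filter_upwards [e, self_mem_nhdsWithin] with z h4 h5
      have hz : z - y k ≠ 0 := sub_ne_zero.2 h5
      rw [h4.1, h4.2.2]
      field_simp

/-- The residue theorem for `u v M²`. -/
theorem κ_mul_d (h : Q.IsLatticeWave u v M L y) : Q.κ = 0 ∨ Q.d = 0 := by
  have hd : Q.d' = -Q.d := by linear_combination h.d_add_d'
  have key := h.sum_residues (f := fun z => u z * M z * (v z * M z))
    ((h.wave.meromorphic_u.mul h.wave.meromorphic_M).mul
      (h.wave.meromorphic_v.mul h.wave.meromorphic_M)) (fun l hl => by
      filter_upwards [h.hasPeriods_u l hl, h.hasPeriods_M l hl, h.hasPeriods_v l hl]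
        with z h1 h2 h3
      rw [h1, h2, h3]) (fun z hz => (order_uvMM_nonneg h.wave hz).2)
    (fun k => 0 * Q.poleResidue k
      + (25 / 96 * Q.κ ^ 3 + Q.κ * (Q.G + Q.G') / 3) * Q.poleResidue k ^ 2
      + -1 / 36 * Q.d * (Q.G - Q.G') * Q.poleResidue k ^ 3
      + 5 / 1152 * Q.d ^ 2 * Q.κ * Q.poleResidue k ^ 4
      + Q.e * Q.d * (65 / 576 * Q.κ ^ 2 + (Q.G + Q.G') / 9) * Q.poleResidue k ^ 5
      + 0 * Q.poleResidue k ^ 6 + -1 / 256 * Q.e * Q.d ^ 3 * Q.poleResidue k ^ 7) fun k => ?_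
  · have h1 := sum_poleResidue _ _ _ _ _ _ _ key
    by_contra! hne
    have hκ : (Q.κ : ℂ) ≠ 0 := by exact_mod_cast hne.1
    have := mul_ne_zero (mul_ne_zero (by norm_num : (5 / 1152 : ℂ) ≠ 0) (pow_ne_zero 2 hne.2)) hκ
    exact this h1
  · obtain ⟨U, V, N, g, e, h1, h2, h3⟩ := h.wave.exists_germ_residue (y k)
    rw [h.residue_y] at h3
    obtain ⟨s, a1, b1, n1, a2, b2, n2, a3, b3, n3, hs, hs3, jU, jV, jN, eu₁, ev₁, en₁, eu₂, ev₂,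
      en₂, eu₃, ev₃, en₃⟩ := g.exists_jets (by rw [h3]; exact Q.poleResidue_ne_zero k) h.re_e
    rw [h3] at hs jN eu₁ ev₁ eu₂ ev₂ eu₃ ev₃
    rw [hd] at ev₁ ev₂ ev₃
    obtain ⟨hn1, ha1, hb1, hn2, ha2, hb2, hn3, ha3, hb3⟩ :=
      laurent_coefficients (δ := Q.d * Q.poleResidue k) (G' := Q.G') hs3 eu₁ (by linear_combination ev₁) en₁ eu₂ (by linear_combination ev₂) en₂ eu₃
      (by linear_combination ev₃) en₃
    refine exists_hasJet_of ((jU.mul jN).mul (jV.mul jN)) ?_ ?_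
    · rw [hn1, ha1, hb1, hn2, ha2, hb2, hn3, ha3, hb3]
      set m := Q.poleResidue k
      set δ := Q.d * m with hδ
      linear_combination m ^ 2 * (-11 / 4608 * s ^ 2 * δ ^ 2 * Q.κ - 1 / 288 * Q.G * s ^ 2 * δ + 1
        / 288 * Q.G' * s ^ 2 * δ - 47 / 2304 * s * δ * Q.κ ^ 2 + 3 / 1024 * s * δ ^ 3 - 11 / 288 *
        Q.G * s * δ - 1 / 48 * Q.G * s * Q.κ - 11 / 288 * Q.G' * s * δ + 1 / 48 * Q.G' * s * Q.κ -
        43 / 4608 * δ ^ 2 * Q.κ - 3 / 64 * Q.κ ^ 3 + 1 / 288 * Q.G * δ - 1 / 8 * Q.G * Q.κ - 1 /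
        288 * Q.G' * δ - 1 / 8 * Q.G' * Q.κ) * hs3 + m ^ 2 * δ * (65 / 576 * Q.κ ^ 2 - 1 / 256 * δ
        ^ 2 + 1 / 9 * Q.G + 1 / 9 * Q.G') * hs
    · filter_upwards [e, self_mem_nhdsWithin] with z h4 h5
      have hz : z - y k ≠ 0 := sub_ne_zero.2 h5
      rw [h4.1, h4.2.1, h4.2.2]
      field_simp

end IsLatticeWave

end ReducedParams

theorem periods_comp_add (f : ℂ → ℂ) (b : ℂ) : periods (fun z => f (z + b)) = periods f := by
  have key : ∀ (f : ℂ → ℂ) (b : ℂ), periods f ≤ periods fun z => f (z + b) := by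
    intro f b l hl
    have h1 := eventually_codiscrete_add (mem_periods.1 hl) b
    rw [mem_periods]
    filter_upwards [h1] with z hz
    rw [← hz, add_right_comm]
  refine le_antisymm ?_ (key f b)
  have := key (fun z => f (z + b)) (-b)
  simpa using this

theorem tendsto_reflection (w : ℂ) : Tendsto (fun z => 2 * w - z) (𝓝[≠] w) (𝓝[≠] w) := by
  have h := tendsto_affine_nhdsNE (-1) (2 * w) w (by norm_num)
  rw [show -1 * w + 2 * w = w by ring] at h
  exact h.congr fun z => by ring

theorem eventually_codiscrete_reflection {p : ℂ → Prop} (h : ∀ᶠ z in codiscrete ℂ, p z) (b : ℂ) :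
    ∀ᶠ z in codiscrete ℂ, p (b - z) := by
  have h1 := eventually_codiscrete_affine h (-1) b (by norm_num)
  filter_upwards [h1] with z hz
  rwa [show b - z = -1 * z + b by ring]

theorem HasJet.exists_analyticAt {f F : ℂ → ℂ} {z₀ c₂ c₃ : ℂ} (hF : HasJet F z₀ 0 0 c₂ c₃)
    (hf : ∀ᶠ z in 𝓝[≠] z₀, f z = F z / (z - z₀) ^ 2) :
    ∃ A : ℂ → ℂ, AnalyticAt ℂ A z₀ ∧ A z₀ = c₂ ∧ ∀ᶠ z in 𝓝[≠] z₀, f z = A z := by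
  obtain ⟨R, hR, h⟩ := hF
  refine ⟨fun z => c₂ + c₃ * (z - z₀) + (z - z₀) ^ 2 * R z, by fun_prop, by simp, ?_⟩
  filter_upwards [hf, h.filter_mono nhdsWithin_le_nhds, self_mem_nhdsWithin] with z h1 h2 h3
  have hz : z - z₀ ≠ 0 := sub_ne_zero.2 h3
  rw [h1, h2]
  field_simp
  ring

namespace ReducedParams

variable {Q : ReducedParams} {u v M : ℂ → ℂ} {L : PeriodPair} {y : Fin 4 → ℂ}

theorem IsLatticeWave.comp_add (h : Q.IsLatticeWave u v M L y) (b : ℂ) :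
    Q.IsLatticeWave (fun z => u (z + b)) (fun z => v (z + b)) (fun z => M (z + b)) L
      fun k => y k - b where
  wave := h.wave.comp_add b
  lattice := by rw [periods_comp_add, periods_comp_add, h.lattice]
  re_e := h.re_e
  residue_y k := by rw [residue_comp_add, sub_add_cancel, h.residue_y]
  exists_residue_eq z hz := by
    rw [residue_comp_add] at hz ⊢
    exact h.exists_residue_eq _ hz

/-- Each of `u` and `v` has two poles in a period parallelogram outside of the poles of `M`. -/
theorem IsLatticeWave.card_zeros (h : Q.IsLatticeWave u v M L y) {S : Finset ℂ}
    (hS : ∀ x ∈ S, ∀ y ∈ S, x ≠ y → x - y ∉ L.lattice)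
    (hrep : ∀ z, (residue u z ≠ 0 ∨ residue v z ≠ 0 ∨ residue M z ≠ 0) →
      ∃ x ∈ S, z - x ∈ L.lattice) {w : ℂ → ℂ} (hsum : ∑ x ∈ S, residue w x = 0)
    (hre : ∀ z, residue M z ≠ 0 → (residue w z).re = -1 / 2)
    (hw : ∀ z, residue M z = 0 → residue w z = 0 ∨ residue w z = 1) :
    (S.filter fun z => residue M z = 0 ∧ residue w z ≠ 0).card = 2 := by
  classical
  -- the real parts of the residues are `-1/2` at the four poles of `M`, and `0` or `1` elsewhere
  have hT : (S.filter fun z => residue M z ≠ 0).card = 4 := by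
    have h1 : (S.filter fun z => residue M z ≠ 0).image (residue M)
        = Finset.univ.image Q.poleResidue := by
      ext m
      simp only [Finset.mem_image, Finset.mem_filter, Finset.mem_univ, true_and]
      constructor
      · rintro ⟨x, ⟨-, hx⟩, rfl⟩
        obtain ⟨k, hk⟩ := h.exists_residue_eq x hx
        exact ⟨k, hk.symm⟩
      · rintro ⟨k, rfl⟩
        have hk := h.residue_y k
        have hk0 : residue M (y k) ≠ 0 := by rw [hk]; exact Q.poleResidue_ne_zero k
        obtain ⟨x, hx, hyx⟩ := hrep (y k) (.inr (.inr hk0))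
        have h2 : residue M (y k) = residue M x := by
          rw [← residue_add_of_mem_periods (h.hasPeriods_M _ hyx) x, add_sub_cancel]
        exact ⟨x, ⟨hx, h2 ▸ hk0⟩, by rw [← h2, hk]⟩
    rw [← Finset.card_image_of_injOn (f := residue M), h1,
      Finset.card_image_of_injective _ Q.poleResidue_injective, Finset.card_univ, Fintype.card_fin]
    intro x hx x' hx' hxx'
    simp only [Finset.coe_filter, Set.mem_ofPred_eq] at hx hx'
    by_contra hne
    refine hS x' hx'.1 x hx.1 (Ne.symm hne) ?_
    rw [h.lattice]
    exact h.wave.sub_mem_periods hx.2 hxx'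
  have h1 := congrArg Complex.re hsum
  rw [re_sum, ← Finset.sum_filter_add_sum_filter_not S fun z => residue M z ≠ 0,
    Finset.sum_congr rfl fun x hx => hre x (Finset.mem_filter.1 hx).2, Finset.sum_const, hT] at h1
  have h2 : ∑ x ∈ S.filter (fun z => ¬ residue M z ≠ 0), (residue w x).re
      = (S.filter fun z => residue M z = 0 ∧ residue w z ≠ 0).card := by
    rw [Finset.sum_filter, Finset.card_filter, Nat.cast_sum]
    refine Finset.sum_congr rfl fun x _ => ?_
    by_cases hx : residue M x = 0
    · rcases hw x hx with h3 | h3 <;> simp [hx, h3]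
    · simp [hx]
  rw [h2] at h1
  have h3 : ((S.filter fun z => residue M z = 0 ∧ residue w z ≠ 0).card : ℝ) = 2 := by
    simp only [nsmul_eq_mul, zero_re] at h1
    push_cast at h1
    linarith
  exact_mod_cast h3

/-- Two zeros of `M` at which `u` (or `v`) has a pole represent all of them. -/
theorem IsLatticeWave.eq_or_eq_of_zeros (h : Q.IsLatticeWave u v M L y) {w : ℂ → ℂ}
    (hwuv : w = u ∨ w = v) {x₁ x₂ : ℂ} (hx : x₁ - x₂ ∉ L.lattice)
    (h₁ : residue M x₁ = 0 ∧ residue w x₁ ≠ 0) (h₂ : residue M x₂ = 0 ∧ residue w x₂ ≠ 0) {z : ℂ}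
    (hz : residue M z = 0 ∧ residue w z ≠ 0) : z - x₁ ∈ L.lattice ∨ z - x₂ ∈ L.lattice := by
  classical
  obtain ⟨S, hS, hrep, hu, hv, -⟩ := h.wave.exists_representatives h.lattice.le
  have hcard : (S.filter fun z => residue M z = 0 ∧ residue w z ≠ 0).card = 2 := by
    rcases hwuv with rfl | rfl
    · refine h.card_zeros hS hrep hu (fun z hz => ?_) fun z hz => (h.wave.residue_of_M hz).1
      obtain ⟨α, hα⟩ := h.wave.exists_poleData hz
      rw [hα.a_eq]
      norm_num
    · refine h.card_zeros hS hrep hv (fun z hz => ?_) fun z hz => (h.wave.residue_of_M hz).2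
      obtain ⟨α, hα⟩ := h.wave.exists_poleData hz
      rw [hα.b_eq]
      norm_num
  have hper : ∀ l ∈ L.lattice, l ∈ periods w := by
    intro l hl
    rcases hwuv with rfl | rfl
    · exact h.hasPeriods_u l hl
    · exact h.hasPeriods_v l hl
  have hex : ∀ z, residue M z = 0 ∧ residue w z ≠ 0 →
      ∃ x ∈ S.filter fun z => residue M z = 0 ∧ residue w z ≠ 0, z - x ∈ L.lattice := by
    intro z hz
    obtain ⟨x, hxS, hzx⟩ := hrep z (by rcases hwuv with rfl | rfl <;> tauto)
    refine ⟨x, Finset.mem_filter.2 ⟨hxS, ?_⟩, hzx⟩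
    rw [← residue_add_of_mem_periods (h.hasPeriods_M _ hzx) x,
      ← residue_add_of_mem_periods (hper _ hzx) x, add_sub_cancel]
    exact hz
  obtain ⟨t₁, ht₁, e₁⟩ := hex x₁ h₁
  obtain ⟨t₂, ht₂, e₂⟩ := hex x₂ h₂
  obtain ⟨t, ht, e⟩ := hex z hz
  have hne : t₁ ≠ t₂ := by
    rintro rfl
    refine hx ?_
    have := sub_mem e₁ e₂
    simpa using this
  have hset : S.filter (fun z => residue M z = 0 ∧ residue w z ≠ 0) = {t₁, t₂} := by
    refine (Finset.eq_of_subset_of_card_le ?_ ?_).symm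
    · intro x hx
      rcases Finset.mem_insert.1 hx with rfl | hx
      · exact ht₁
      · rw [Finset.mem_singleton.1 hx]
        exact ht₂
    · rw [hcard, Finset.card_pair hne]
  rw [hset, Finset.mem_insert, Finset.mem_singleton] at ht
  rcases ht with rfl | rfl
  · left
    have := sub_mem e e₁
    simpa using this
  · right
    have := sub_mem e e₂
    simpa using this

/-! ### The case `κ = 0`: rotational symmetry -/

theorem IsWave.rotate (h : Q.IsWave u v M) (hκ : Q.κ = 0) (hd : Q.d' = -Q.d) (he : Q.e' = -Q.e)
    (hG : Q.G' = -Q.G) :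
    Q.IsWave (fun z => I * v (I * z)) (fun z => I * u (I * z)) fun z => M (I * z) := by
  have hrot : ∀ {p : ℂ → Prop}, (∀ᶠ z in codiscrete ℂ, p z) → ∀ᶠ z in codiscrete ℂ, p (I * z) := by
    intro p hp
    simpa using eventually_codiscrete_affine hp I 0 I_ne_zero
  have mer : ∀ {f : ℂ → ℂ}, Meromorphic f → Meromorphic fun z => f (I * z) := by
    intro f hf
    simpa using meromorphic_comp_affine hf I 0
  have der : ∀ {f : ℂ → ℂ} (z : ℂ), deriv (fun z => f (I * z)) z = I * deriv f (I * z) := by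
    intro f z
    rw [deriv_comp_mul_left]
    rfl
  refine ⟨(Meromorphic.const I).mul (mer h.meromorphic_v),
    (Meromorphic.const I).mul (mer h.meromorphic_u), mer h.meromorphic_M, fun h0 => ?_, ?_, ?_, ?_⟩
  · refine h.ne_zero ?_
    have h1 := eventually_codiscrete_affine h0 (-I) 0 (by simp)
    filter_upwards [h1] with z hz
    rw [← hz]
    congr 1
    linear_combination z * I_sq
  · filter_upwards [hrot h.eq_v] with z hz
    rw [deriv_const_mul_field, der, hz, hd, he, hG]
    linear_combination (Q.d * M (I * z) + Q.e * M (I * z) ^ 2 + Q.G) * I_sq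
  · filter_upwards [hrot h.eq_u] with z hz
    rw [deriv_const_mul_field, der, hz, hd, he, hG]
    linear_combination (-Q.d * M (I * z) - Q.e * M (I * z) ^ 2 - Q.G) * I_sq
  · filter_upwards [hrot h.eq_M] with z hz
    rw [der, hz, hκ, ofReal_zero]
    ring

end ReducedParams

namespace ReducedParams

variable {Q : ReducedParams} {u v M : ℂ → ℂ} {L : PeriodPair} {y : Fin 4 → ℂ}

theorem residue_mul_I (f : ℂ → ℂ) (z₀ : ℂ) {ρ : ℂ}
    (h : Tendsto (fun z => (z - I * z₀) * f z) (𝓝[≠] (I * z₀)) (𝓝 ρ)) :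
    residue (fun z => f (I * z)) z₀ = -I * ρ := by
  refine residue_eq_of_tendsto ?_
  have h1 := tendsto_affine_nhdsNE I 0 z₀ I_ne_zero
  simp only [add_zero] at h1
  refine ((h.comp h1).const_mul (-I)).congr fun z => ?_
  simp only [Function.comp_apply]
  linear_combination -(z - z₀) * f (I * z) * I_sq

/-- If `κ = 0`, then after a translation a rotation by a right angle exchanges `u` and `v`. -/
theorem IsLatticeWave.exists_rotation (h : Q.IsLatticeWave u v M L y) (hκ : Q.κ = 0) :
    ∃ b, (∀ᶠ z in codiscrete ℂ, u (z + b) = I * v (I * z + b)) ∧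
      (∀ᶠ z in codiscrete ℂ, v (z + b) = I * u (I * z + b)) ∧
      ∀ᶠ z in codiscrete ℂ, M (z + b) = M (I * z + b) := by
  have hd : Q.d' = -Q.d := by linear_combination h.d_add_d'
  have hG : Q.G' = -Q.G := by
    have := h.G_add_G'
    rw [hκ] at this
    simp only [ofReal_zero] at this
    linear_combination this
  have hr := h.wave.rotate hκ hd h.e'_eq hG
  have h1 : residue (fun z => M (I * z)) (-I * y 1) = Q.poleResidue 0 := by
    have e1 : I * (-I * y 1) = y 1 := by linear_combination -y 1 * I_sq
    have h2 := (h.wave.tendsto_residue (y 1)).2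
    rw [h.residue_y, ← e1] at h2
    rw [residue_mul_I _ _ h2, poleResidue_eq (k := 1)]
    simp only [Fin.val_one, pow_one]
    linear_combination -Q.poleResidue 0 * I_sq
  have h2 : residue (fun z => M (I * z)) (-I * y 1) = residue M (y 0) := by rw [h1, h.residue_y]
  obtain ⟨e1, e2, e3⟩ := hr.eq_comp_add h.wave
    (by rw [h1]; exact Q.poleResidue_ne_zero 0) h2
  set τ := y 0 - -I * y 1
  have hI : (1 + I : ℂ) ≠ 0 := by
    intro h
    have := congrArg Complex.re h
    simp at this
  -- the fixed point of the rotation combined with the translation by `τ`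
  refine ⟨τ / (1 + I), ?_⟩
  have key : ∀ {f g : ℂ → ℂ}, (∀ᶠ z in codiscrete ℂ, g (I * z) = f (z + τ)) →
      ∀ᶠ z in codiscrete ℂ, f (z + τ / (1 + I)) = g (I * z + τ / (1 + I)) := by
    intro f g hfg
    filter_upwards [eventually_codiscrete_add hfg (τ / (1 + I) - τ)] with z hz
    rw [show z + (τ / (1 + I) - τ) + τ = z + τ / (1 + I) by ring] at hz
    rw [← hz]
    congr 1
    field_simp
    linear_combination -τ * I_sq
  exact ⟨key (f := u) (g := fun z => I * v z) e1, key (f := v) (g := fun z => I * u z) e2,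
    key (f := M) (g := M) e3⟩

/-- A wave which is rotated into itself by a right angle about the origin. -/
structure IsSymmetricWave (Q : ReducedParams) (u v M : ℂ → ℂ) (L : PeriodPair) (y : Fin 4 → ℂ) :
    Prop extends Q.IsLatticeWave u v M L y where
  κ_eq : Q.κ = 0
  rot_u : ∀ᶠ z in codiscrete ℂ, u z = I * v (I * z)
  rot_v : ∀ᶠ z in codiscrete ℂ, v z = I * u (I * z)
  rot_M : ∀ᶠ z in codiscrete ℂ, M z = M (I * z)

theorem IsLatticeWave.exists_isSymmetricWave (h : Q.IsLatticeWave u v M L y) (hκ : Q.κ = 0) :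
    ∃ u₁ v₁ M₁ y₁, Q.IsSymmetricWave u₁ v₁ M₁ L y₁ := by
  obtain ⟨b, h1, h2, h3⟩ := h.exists_rotation hκ
  exact ⟨_, _, _, _, h.comp_add b, hκ, h1, h2, h3⟩

namespace IsSymmetricWave

theorem eventually_mul_I {p : ℂ → Prop} (hp : ∀ᶠ z in codiscrete ℂ, p z) :
    ∀ᶠ z in codiscrete ℂ, p (I * z) := by
  simpa using eventually_codiscrete_affine hp I 0 I_ne_zero

theorem odd (h : Q.IsSymmetricWave u v M L y) : (∀ᶠ z in codiscrete ℂ, u (-z) = -u z) ∧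
    (∀ᶠ z in codiscrete ℂ, v (-z) = -v z) ∧ ∀ᶠ z in codiscrete ℂ, M (-z) = M z := by
  have e : ∀ z : ℂ, I * (I * z) = -z := fun z => by linear_combination z * I_sq
  refine ⟨?_, ?_, ?_⟩
  · filter_upwards [h.rot_u, eventually_mul_I h.rot_v] with z h1 h2
    rw [e] at h2
    rw [h1, h2]
    linear_combination u (-z) * I_sq
  · filter_upwards [h.rot_v, eventually_mul_I h.rot_u] with z h1 h2
    rw [e] at h2
    rw [h1, h2]
    linear_combination v (-z) * I_sq
  · filter_upwards [h.rot_M, eventually_mul_I h.rot_M] with z h1 h2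
    rw [e] at h2
    rw [h1, h2]

theorem I_mul_mem (h : Q.IsSymmetricWave u v M L y) {l : ℂ} (hl : l ∈ L.lattice) :
    I * l ∈ L.lattice := by
  have hv := h.hasPeriods_v l hl
  have hM := h.hasPeriods_M l hl
  have key : ∀ {f g : ℂ → ℂ} {c : ℂ}, (∀ᶠ z in codiscrete ℂ, f z = c * g (I * z)) →
      (fun z => g (z - l)) =ᶠ[codiscrete ℂ] g → I * l ∈ periods f := by
    intro f g c hfg hgl
    rw [mem_periods]
    filter_upwards [hfg, eventually_codiscrete_add hfg (I * l), eventually_mul_I hgl]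
      with z h1 h2 h3
    rw [h2, h1, show I * (z + I * l) = I * z - l by linear_combination l * I_sq, h3]
  rw [h.lattice]
  exact ⟨key h.rot_u (h.hasPeriods_v.sub_mem hl),
    key (c := 1) (h.rot_M.mono fun z hz => by rw [hz, one_mul]) (h.hasPeriods_M.sub_mem hl)⟩

/-- `u` and `v` are odd, and `M` is even, about each half period. -/
theorem reflect (h : Q.IsSymmetricWave u v M L y) {w : ℂ} (hw : 2 * w ∈ L.lattice) :
    (∀ᶠ z in codiscrete ℂ, u (2 * w - z) = -u z) ∧
    (∀ᶠ z in codiscrete ℂ, v (2 * w - z) = -v z) ∧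
    ∀ᶠ z in codiscrete ℂ, M (2 * w - z) = M z := by
  have key : ∀ {f : ℂ → ℂ}, HasPeriods f L →
      ∀ᶠ z in codiscrete ℂ, f (2 * w - z) = f (-z) := by
    intro f hf
    have h1 := eventually_codiscrete_reflection (hf _ hw) 0
    filter_upwards [h1] with z hz
    rw [zero_sub] at hz
    rw [← hz]
    congr 1
    ring
  obtain ⟨h1, h2, h3⟩ := h.odd
  refine ⟨?_, ?_, ?_⟩
  · filter_upwards [key h.hasPeriods_u, h1] with z h4 h5
    rw [h4, h5]
  · filter_upwards [key h.hasPeriods_v, h2] with z h4 h5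
    rw [h4, h5]
  · filter_upwards [key h.hasPeriods_M, h3] with z h4 h5
    rw [h4, h5]

/-- `M` vanishes at the half periods that are not congruent to their images under the rotation, and
both `u` and `v` have poles there: otherwise `u`, `v`, `M` would have the same values `0`, `0`,
`M(w)` at `w` and at `i w`, so that `(i - 1) w` would be a period. -/
theorem residue_half_period (h : Q.IsSymmetricWave u v M L y) {w : ℂ} (hw : 2 * w ∈ L.lattice)
    (hIw : (I - 1) * w ∉ L.lattice) :
    residue M w = 0 ∧ residue u w = 1 ∧ residue v w = 1 := by
  obtain ⟨ru, rv, rM⟩ := h.reflect hw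
  have hM0 : residue M w = 0 := by
    have h1 := (h.wave.tendsto_residue w).2
    have h2 := h1.comp (tendsto_reflection w)
    have h3 : Tendsto (fun z => (z - w) * M z) (𝓝[≠] w) (𝓝 (-residue M w)) := by
      refine h2.neg.congr' ?_
      filter_upwards [nhdsNE_of_codiscrete rM w] with z hz
      simp only [Function.comp_apply]
      rw [hz]
      ring
    have h4 := tendsto_nhds_unique h1 h3
    linear_combination h4 / 2
  obtain ⟨U, V, N, g, e, a1, a2, a3⟩ := h.wave.exists_germ_residue w
  rw [hM0] at a3
  obtain ⟨K, hK, hNK, hUVK, hKode⟩ := g.exists_analytic_M a3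
  have eK : ∀ᶠ z in 𝓝[≠] w, M z = K z := by
    filter_upwards [e, self_mem_nhdsWithin] with z h4 h5
    rw [h4.2.2, hNK, mul_div_cancel_left₀ _ (sub_ne_zero.2 h5)]
  have hr := tendsto_reflection w
  have cr : ContinuousAt (fun z : ℂ => 2 * w - z) w := by fun_prop
  have comp : ∀ {f : ℂ → ℂ}, ContinuousAt f w → ContinuousAt (fun z => f (2 * w - z)) w := by
    intro f hf
    refine ContinuousAt.comp (f := fun z => 2 * w - z) ?_ cr
    rwa [show 2 * w - w = w by ring]
  have hKK : ∀ᶠ z in 𝓝[≠] w, K (2 * w - z) = K z := by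
    filter_upwards [eK, hr.eventually eK, nhdsNE_of_codiscrete rM w] with z h1 h2 h3
    rw [← h1, ← h2, h3]
  rw [← a1, ← a2]
  have hU := g.U_eq_zero_or_one a3
  have hV := g.V_eq_zero_or_one a3
  refine ⟨hM0, ?_⟩
  by_cases hKw : K w = 0
  · -- the order of the zero is even, hence equal to two
    by_contra hne
    obtain ⟨K₁, hK₁, hKK₁⟩ := exists_eq_sub_mul hK hKw
    have hK₁w : K₁ w = 0 := by
      have h1 : ∀ᶠ z in 𝓝[≠] w, K₁ (2 * w - z) = -K₁ z := by
        filter_upwards [hKK, self_mem_nhdsWithin] with z h1 h2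
        rw [hKK₁, hKK₁] at h1
        refine mul_left_cancel₀ (sub_ne_zero.2 h2) ?_
        linear_combination -h1
      have h2 := eq_of_eventually_nhdsNE (comp hK₁.continuousAt) hK₁.continuousAt.neg h1
      simp only [show 2 * w - w = w by ring, Pi.neg_apply] at h2
      linear_combination h2 / 2
    have hode : ∀ᶠ z in 𝓝[≠] w, (z - w) * deriv K₁ z = (U z + V z - 1) * K₁ z := by
      filter_upwards [hKode.filter_mono nhdsWithin_le_nhds, self_mem_nhdsWithin,
        hK₁.eventually_analyticAt.filter_mono nhdsWithin_le_nhds] with z h1 h2 h3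
      have h4 : HasDerivAt K (1 * K₁ z + (z - w) * deriv K₁ z) z := by
        have : K = fun z => (z - w) * K₁ z := funext hKK₁
        rw [this]
        exact ((hasDerivAt_id z).sub_const w).mul h3.differentiableAt.hasDerivAt
      rw [h4.deriv, hKK₁, h.κ_eq, ofReal_zero] at h1
      refine mul_left_cancel₀ (sub_ne_zero.2 h2) ?_
      linear_combination h1
    have aK₁ := hK₁.deriv
    have aU := g.analyticAt_U
    have aV := g.analyticAt_V
    have hode' := eventuallyEq_nhds_of_nhdsNE (f := fun z => (z - w) * deriv K₁ z)
      (g := fun z => (U z + V z - 1) * K₁ z) (AnalyticAt.continuousAt (𝕜 := ℂ) (by fun_prop))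
      (AnalyticAt.continuousAt (𝕜 := ℂ) (by fun_prop)) hode
    -- unless `U w = V w = 1`, the exponent `U w + V w - 1` of `K₁` is not positive, so `K₁ = 0`
    have hzero := eventually_zero_of_fuchsian (fun _ : Unit => K₁) (fun _ => hK₁) (fun _ => hK₁w)
      (fun _ _ z => U z + V z - 1) (fun _ _ => AnalyticAt.continuousAt (𝕜 := ℂ) (by fun_prop))
      (fun _ => by simpa using hode') (fun n hn f hf _ => ?_) ()
    · refine h.wave.ne_zero (eventuallyEq_codiscrete_of_nhdsNE h.wave.meromorphic_M
        (Meromorphic.const 0) (z := w) ?_)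
      filter_upwards [eK, hzero.filter_mono nhdsWithin_le_nhds] with z h1 h2
      rw [h1, hKK₁, h2, mul_zero]
    · have h1 := hf ()
      rw [Fintype.sum_unique] at h1
      have h2 : ((n : ℂ) - (U w + V w - 1)) * f () = 0 := by linear_combination h1
      refine (mul_eq_zero.1 h2).resolve_left fun h3 => ?_
      have h4 : (n : ℂ) + 1 = U w + V w := by linear_combination h3
      rcases hU with hU | hU <;> rcases hV with hV | hV <;> rw [hU, hV] at h4
      · have : n + 1 = 0 := by
          rw [add_zero] at h4
          exact_mod_cast h4
        omega
      · have : n + 1 = 0 + 1 := by exact_mod_cast h4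
        omega
      · have : n + 1 = 1 + 0 := by exact_mod_cast h4
        omega
      · exact hne ⟨hU, hV⟩
  · -- otherwise `u` and `v` are regular at `w`, and vanish there since they are odd about `w`
    exfalso
    have hUV : U w + V w = 0 := (mul_eq_zero.1 hUVK).resolve_right hKw
    have hU0 : U w = 0 := by
      rcases hU with hU | hU
      · exact hU
      · rcases hV with hV | hV <;> rw [hU, hV] at hUV <;> norm_num at hUV
    have hV0 : V w = 0 := by rw [hU0, zero_add] at hUV; exact hUV
    obtain ⟨A, hA, hUA⟩ := exists_eq_sub_mul g.analyticAt_U hU0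
    obtain ⟨B, hB, hVB⟩ := exists_eq_sub_mul g.analyticAt_V hV0
    have eA : ∀ᶠ z in 𝓝[≠] w, u z = A z := by
      filter_upwards [e, self_mem_nhdsWithin] with z h4 h5
      rw [h4.1, hUA, mul_div_cancel_left₀ _ (sub_ne_zero.2 h5)]
    have eB : ∀ᶠ z in 𝓝[≠] w, v z = B z := by
      filter_upwards [e, self_mem_nhdsWithin] with z h4 h5
      rw [h4.2.1, hVB, mul_div_cancel_left₀ _ (sub_ne_zero.2 h5)]
    have van : ∀ {f F : ℂ → ℂ}, ContinuousAt F w → (∀ᶠ z in 𝓝[≠] w, f z = F z) →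
        (∀ᶠ z in codiscrete ℂ, f (2 * w - z) = -f z) → F w = 0 := by
      intro f F hF hfF hf
      have h1 : ∀ᶠ z in 𝓝[≠] w, F (2 * w - z) = -F z := by
        filter_upwards [hfF, hr.eventually hfF, nhdsNE_of_codiscrete hf w] with z h1 h2 h3
        rw [← h1, ← h2, h3]
      have h2 := eq_of_eventually_nhdsNE (comp hF) hF.neg h1
      simp only [show 2 * w - w = w by ring, Pi.neg_apply] at h2
      linear_combination h2 / 2
    have hA0 := van hA.continuousAt eA ru
    have hB0 := van hB.continuousAt eB rv
    -- the translate of the wave by `(i - 1) w`, near `w`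
    have hz : ∀ z : ℂ, I * (-I * z) = z := fun z => by linear_combination -z * I_sq
    have t1 : Tendsto (fun z => -I * z + (w + I * w)) (𝓝[≠] w) (𝓝[≠] w) := by
      have := tendsto_affine_nhdsNE (-I) (w + I * w) w (by simp)
      rwa [show -I * w + (w + I * w) = w by ring] at this
    have aff : ∀ {F : ℂ → ℂ}, AnalyticAt ℂ F w →
        AnalyticAt ℂ (fun z => F (-I * z + (w + I * w))) w := by
      intro F hF
      refine hF.fun_comp_of_eq (g := F) (f := fun z => -I * z + (w + I * w)) (by fun_prop) ?_
      ring
    have rot : ∀ {f F k : ℂ → ℂ} {c : ℂ}, (∀ᶠ z in codiscrete ℂ, f z = c * k (I * z)) →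
        (∀ᶠ z in 𝓝[≠] w, f z = F z) →
        ∀ᶠ z in 𝓝[≠] w, c * k (z + (I - 1) * w) = F (-I * z + (w + I * w)) := by
      intro f F k c hf hF
      filter_upwards [t1.eventually hF, t1.eventually (nhdsNE_of_codiscrete hf w)] with z h1 h2
      rw [← h1, h2]
      congr 2
      linear_combination (z - w) * I_sq
    have s1 := rot (c := I) h.rot_u eA
    have s2 := rot (c := I) h.rot_v eB
    have s3 := rot (c := 1) (k := M) (h.rot_M.mono fun z hz => by rw [hz, one_mul]) eK
    have hI2 := I_sq
    obtain ⟨q1, q2⟩ := h.wave.eq_of_regular (h.wave.comp_add ((I - 1) * w)) hA hB hK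
      (A₂ := fun z => -I * B (-I * z + (w + I * w))) (B₂ := fun z => -I * A (-I * z + (w + I * w)))
      (K₂ := fun z => K (-I * z + (w + I * w))) (analyticAt_const.mul (aff hB))
      (analyticAt_const.mul (aff hA)) (aff hK)
      (by filter_upwards [eA, eB, eK] with z h1 h2 h3; exact ⟨h1, h2, h3⟩)
      (by
        filter_upwards [s1, s2, s3] with z h1 h2 h3
        refine ⟨?_, ?_, ?_⟩
        · linear_combination -I * h2 + u (z + (I - 1) * w) * hI2
        · linear_combination -I * h1 + v (z + (I - 1) * w) * hI2
        · linear_combination h3)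
      (by rw [show -I * w + (w + I * w) = w by ring, hA0, hB0]; ring)
      (by rw [show -I * w + (w + I * w) = w by ring, hA0, hB0]; ring)
      (by rw [show -I * w + (w + I * w) = w by ring])
    refine hIw ?_
    rw [h.lattice]
    exact ⟨q2.symm, q1.symm⟩

end IsSymmetricWave

end ReducedParams

theorem HasJet.of_eq {f : ℂ → ℂ} {z₀ c₀ c₁ c₂ c₃ d₀ d₁ d₂ : ℂ} (hf : HasJet f z₀ c₀ c₁ c₂ c₃)
    (h₀ : c₀ = d₀) (h₁ : c₁ = d₁) (h₂ : c₂ = d₂) : HasJet f z₀ d₀ d₁ d₂ c₃ := by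
  subst h₀ h₁ h₂
  exact hf

namespace ReducedParams

variable {Q : ReducedParams} {u v M : ℂ → ℂ} {L : PeriodPair} {y : Fin 4 → ℂ}

namespace IsSymmetricWave

/-- If all half periods were congruent to their images under the rotation, applying this to
`ω₁ / 2` and to `(i - 1) ω₁ / 4` would give `ω₁ / 2 ∈ Λ`. -/
theorem exists_half_period (h : Q.IsSymmetricWave u v M L y) :
    ∃ w, 2 * w ∈ L.lattice ∧ (I - 1) * w ∉ L.lattice := by
  by_contra! hall
  have h1 := hall (L.ω₁ / 2) (by rw [mul_div_cancel₀ _ two_ne_zero]; exact L.ω₁_mem_lattice)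
  have h2 := h.I_mul_mem (hall ((I - 1) * (L.ω₁ / 2) / 2) (by
    rwa [mul_div_cancel₀ _ two_ne_zero]))
  refine L.ω₁_div_two_notMem_lattice ?_
  convert h2 using 1
  linear_combination (-I * L.ω₁ / 4 + L.ω₁ / 2) * I_sq

/-- At the points where `M` is regular, `u` and `v` have the same residue: the residue theorem
leaves room for two poles only of each of them, and the half periods provide these. -/
theorem residue_u_eq_residue_v (h : Q.IsSymmetricWave u v M L y) :
    (∃ w, residue M w = 0 ∧ residue u w = 1 ∧ residue v w = 1) ∧
    ∀ z, residue M z = 0 → (residue u z = 0 ∧ residue v z = 0) ∨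
      (residue u z = 1 ∧ residue v z = 1) := by
  obtain ⟨w, hw, hIw⟩ := h.exists_half_period
  obtain ⟨m1, u1, v1⟩ := h.residue_half_period hw hIw
  have hw' : 2 * (I * w) ∈ L.lattice := by
    rw [mul_left_comm]
    exact h.I_mul_mem hw
  have hIw' : (I - 1) * (I * w) ∉ L.lattice := by
    intro hmem
    have h1 := neg_mem (h.I_mul_mem hmem)
    refine hIw ?_
    convert h1 using 1
    linear_combination (I - 1) * w * I_sq
  obtain ⟨m2, u2, v2⟩ := h.residue_half_period hw' hIw'
  have hne : w - I * w ∉ L.lattice := by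
    intro hmem
    refine hIw ?_
    convert neg_mem hmem using 1
    ring
  refine ⟨⟨w, m1, u1, v1⟩, fun z hz => ?_⟩
  have trans : ∀ x, residue u x = 1 → residue v x = 1 → z - x ∈ L.lattice →
      residue u z = 1 ∧ residue v z = 1 := by
    intro x hu hv hzx
    have e1 := residue_add_of_mem_periods (mem_periods.2 (h.hasPeriods_u _ hzx)) x
    have e2 := residue_add_of_mem_periods (mem_periods.2 (h.hasPeriods_v _ hzx)) x
    rw [add_sub_cancel] at e1 e2
    exact ⟨e1.trans hu, e2.trans hv⟩
  by_cases hu : residue u z = 0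
  · by_cases hv : residue v z = 0
    · exact .inl ⟨hu, hv⟩
    · right
      rcases h.eq_or_eq_of_zeros (.inr rfl) hne ⟨m1, by simp [v1]⟩ ⟨m2, by simp [v2]⟩ ⟨hz, hv⟩
        with h1 | h1
      exacts [trans _ u1 v1 h1, trans _ u2 v2 h1]
  · right
    rcases h.eq_or_eq_of_zeros (.inl rfl) hne ⟨m1, by simp [u1]⟩ ⟨m2, by simp [u2]⟩ ⟨hz, hu⟩
      with h1 | h1
    exacts [trans _ u1 v1 h1, trans _ u2 v2 h1]

end IsSymmetricWave

/-- The value at a common pole of `u` and `v` of a combination that is regular there. -/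
theorem IsWave.exists_analytic_of_residue_eq_one (h : Q.IsWave u v M)
    (hG : Q.G' = -Q.G) {w : ℂ} (hM : residue M w = 0) (hu : residue u w = 1)
    (hv : residue v w = 1) (c : ℂ) : ∃ A : ℂ → ℂ, AnalyticAt ℂ A w ∧ A w = -4 / 3 * Q.G ∧
      ∀ᶠ z in 𝓝[≠] w, u z ^ 2 - v z ^ 2 + Q.e * M z ^ 2 + c * M z = A z := by
  obtain ⟨U, V, N, g, e, h1, h2, h3⟩ := h.exists_germ_residue w
  rw [hM] at h3
  obtain ⟨K, hK, hNK, hUVK, -⟩ := g.exists_analytic_M h3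
  have hKw : K w = 0 := by
    rw [h1, h2, hu, hv] at hUVK
    simpa using hUVK
  obtain ⟨a1, a2, a3, jU⟩ := exists_hasJet g.analyticAt_U
  obtain ⟨b1, b2, b3, jV⟩ := exists_hasJet g.analyticAt_V
  obtain ⟨k1, k2, k3, jK⟩ := exists_hasJet hK
  rw [h1, hu] at jU
  rw [h2, hv] at jV
  rw [hKw] at jK
  have jN := jK.id_mul.congr (.of_forall hNK)
  have j1 : HasJet (fun z => (z - w) ^ 2) w 0 0 1 0 :=
    ⟨fun _ => 0, analyticAt_const, .of_forall fun z => by ring⟩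
  have jN2 := jN.mul jN
  have kU := (((jU.add ((jU.mul jU).const_mul (-1))).add ((jN.id_mul).const_mul (-Q.d))).add
    (jN2.const_mul (-Q.e))).add (j1.const_mul (-Q.G))
  have kV := (((jV.add ((jV.mul jV).const_mul (-1))).add ((jN.id_mul).const_mul (-Q.d'))).add
    (jN2.const_mul (-Q.e'))).add (j1.const_mul (-Q.G'))
  obtain ⟨-, u1, u2, -⟩ := jU.id_mul_deriv.unique (kU.congr (g.eq_U.mono fun z hz => by
    rw [hz]; ring))
  obtain ⟨-, v1, v2, -⟩ := jV.id_mul_deriv.unique (kV.congr (g.eq_V.mono fun z hz => by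
    rw [hz]; ring))
  have ha1 : a1 = 0 := by linear_combination u1 / 2
  have hb1 : b1 = 0 := by linear_combination v1 / 2
  rw [ha1] at u2 jU
  rw [hb1] at v2 jV
  refine HasJet.exists_analyticAt (((((jU.mul jU).add ((jV.mul jV).const_mul (-1))).add
    (jN2.const_mul Q.e)).add (jN.id_mul.const_mul c)).of_eq (by ring) (by ring) ?_) ?_
  · linear_combination 2 / 3 * u2 - 2 / 3 * v2 + 2 / 3 * hG
  · filter_upwards [e, self_mem_nhdsWithin] with z h4 h5
    have hz : z - w ≠ 0 := sub_ne_zero.2 h5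
    rw [h4.1, h4.2.1, h4.2.2]
    field_simp
    ring

/-- A wave all of whose residues vanish at a point is regular there. -/
theorem IsWave.exists_analytic_of_residue_eq_zero (h : Q.IsWave u v M) {w : ℂ}
    (hM : residue M w = 0) (hu : residue u w = 0) (hv : residue v w = 0) :
    ∃ A B K : ℂ → ℂ, AnalyticAt ℂ A w ∧ AnalyticAt ℂ B w ∧ AnalyticAt ℂ K w ∧
      ∀ᶠ z in 𝓝[≠] w, u z = A z ∧ v z = B z ∧ M z = K z := by
  obtain ⟨U, V, N, g, e, h1, h2, h3⟩ := h.exists_germ_residue w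
  obtain ⟨A, hA, hUA⟩ := exists_eq_sub_mul g.analyticAt_U (h1.trans hu)
  obtain ⟨B, hB, hVB⟩ := exists_eq_sub_mul g.analyticAt_V (h2.trans hv)
  obtain ⟨K, hK, hNK⟩ := exists_eq_sub_mul g.analyticAt_N (h3.trans hM)
  refine ⟨A, B, K, hA, hB, hK, ?_⟩
  filter_upwards [e, self_mem_nhdsWithin] with z h4 h5
  have hz : z - w ≠ 0 := sub_ne_zero.2 h5
  rw [h4.1, h4.2.1, h4.2.2, hUA, hVB, hNK]
  field_simp
  simp

/-! ### Vanishing of the linear term -/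

/-- The linear term of the reduced system vanishes. If `κ = 0`, the symmetry of the wave makes
`u² - v² + e M² + (5/4) d M` an entire elliptic function, hence a constant; its values at the poles
of `M` and at the double zeros of `M` differ by a multiple of `d²`. -/
theorem IsLatticeWave.d_eq_zero (h : Q.IsLatticeWave u v M L y) : Q.d = 0 := by
  rcases h.κ_mul_d with hκ | hd
  swap
  · exact hd
  obtain ⟨u, v, M, y, h⟩ := h.exists_isSymmetricWave hκ
  have hd : Q.d' = -Q.d := by linear_combination h.d_add_d'
  have hG : Q.G' = -Q.G := by
    have := h.G_add_G'
    rw [hκ] at this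
    simp only [ofReal_zero] at this
    linear_combination this
  obtain ⟨⟨w, mw, uw, vw⟩, hres⟩ := h.residue_u_eq_residue_v
  set f : ℂ → ℂ := fun z => u z ^ 2 - v z ^ 2 + Q.e * M z ^ 2 + 5 / 4 * Q.d * M z with hf
  -- the coefficient `5/4` of `d M` makes the simple poles cancel
  have hpole : ∀ z, residue M z ≠ 0 → ∃ s, s = Q.e * residue M z ^ 2 ∧ ∃ A : ℂ → ℂ,
      AnalyticAt ℂ A z ∧ A z = 1 / 32 * s * (Q.d * residue M z) ^ 2 - 4 / 3 * Q.G ∧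
      ∀ᶠ x in 𝓝[≠] z, f x = A x := by
    intro z hz
    obtain ⟨U, V, N, g, e, h1, h2, h3⟩ := h.wave.exists_germ_residue z
    obtain ⟨s, a1, b1, n1, a2, b2, n2, a3, b3, n3, hs, hs3, jU, jV, jN, eu₁, ev₁, en₁, eu₂, ev₂,
      en₂, eu₃, ev₃, en₃⟩ := g.exists_jets (h3 ▸ hz) h.re_e
    rw [h3] at hs jN eu₁ ev₁ eu₂ ev₂ eu₃ ev₃
    rw [hd] at ev₁ ev₂ ev₃
    obtain ⟨hn1, ha1, hb1, hn2, ha2, hb2, -⟩ :=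
      laurent_coefficients (δ := Q.d * residue M z) (G' := Q.G') hs3 eu₁
      (by linear_combination ev₁) en₁ eu₂ (by linear_combination ev₂) en₂ eu₃
      (by linear_combination ev₃) en₃
    rw [hκ] at hn1 ha1 hb1 hn2 ha2 hb2
    simp only [ofReal_zero] at hn1 ha1 hb1 hn2 ha2 hb2
    refine ⟨s, hs, HasJet.exists_analyticAt (((((jU.mul jU).add ((jV.mul jV).const_mul (-1))).add
      ((jN.mul jN).const_mul Q.e)).add (jN.id_mul.const_mul (5 / 4 * Q.d))).of_eq ?_ ?_ ?_) ?_⟩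
    · linear_combination -hs
    · rw [ha1, hb1, hn1]
      set m := residue M z
      linear_combination 3 / 8 * (Q.d * m) * hs3 - 1 / 4 * s * (Q.d * m) * hs
    · rw [ha1, hb1, hn1, ha2, hb2, hn2, hG]
      set m := residue M z
      linear_combination (1 / 64 * s * (Q.d * m) ^ 2 + 4 / 9 * Q.G) * hs3
        - (2 / 9 * Q.G * s - 7 / 96 * (Q.d * m) ^ 2 + 1 / 64 * s ^ 2 * (Q.d * m) ^ 2) * hs
    · filter_upwards [e, self_mem_nhdsWithin] with x h4 h5
      have hz : x - z ≠ 0 := sub_ne_zero.2 h5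
      rw [hf]
      simp only
      rw [h4.1, h4.2.1, h4.2.2]
      field_simp
      ring
  have hfL : HasPeriods f L := fun l hl => by
    filter_upwards [h.hasPeriods_u l hl, h.hasPeriods_v l hl, h.hasPeriods_M l hl] with z h1 h2 h3
    simp only [hf]
    rw [h1, h2, h3]
  have hmu := h.wave.meromorphic_u
  have hmv := h.wave.meromorphic_v
  have hmM := h.wave.meromorphic_M
  have hfm : Meromorphic f := fun z => by
    have := hmu z
    have := hmv z
    have := hmM z
    fun_prop
  obtain ⟨C, hC⟩ := eventuallyEq_const_of_hasPeriods hfm hfL fun z => by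
    by_cases hz : residue M z = 0
    · rcases hres z hz with ⟨h1, h2⟩ | ⟨h1, h2⟩
      · obtain ⟨A, B, K, hA, hB, hK, hABK⟩ := h.wave.exists_analytic_of_residue_eq_zero hz h1 h2
        refine order_nonneg_of_eventuallyEq
          (g := fun z => A z ^ 2 - B z ^ 2 + Q.e * K z ^ 2 + 5 / 4 * Q.d * K z) (by fun_prop) ?_
        filter_upwards [hABK] with x hx
        simp only [hf]
        rw [hx.1, hx.2.1, hx.2.2]
      · obtain ⟨A, hA, -, hfA⟩ :=
          h.wave.exists_analytic_of_residue_eq_one hG hz h1 h2 (5 / 4 * Q.d)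
        exact order_nonneg_of_eventuallyEq hA hfA
    · obtain ⟨s, -, A, hA, -, hfA⟩ := hpole z hz
      exact order_nonneg_of_eventuallyEq hA hfA
  have value : ∀ {z : ℂ} {A : ℂ → ℂ}, AnalyticAt ℂ A z → (∀ᶠ x in 𝓝[≠] z, f x = A x) →
      A z = C := by
    intro z A hA hfA
    refine eq_of_eventually_nhdsNE hA.continuousAt continuousAt_const ?_
    filter_upwards [hfA, nhdsNE_of_codiscrete hC z] with x h1 h2
    rw [← h1, h2]
  obtain ⟨A, hA, hAw, hfA⟩ :=
    h.wave.exists_analytic_of_residue_eq_one hG mw uw vw (5 / 4 * Q.d)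
  have hm : residue M (y 0) ≠ 0 := by
    rw [h.residue_y]
    exact Q.poleResidue_ne_zero 0
  obtain ⟨s, hs, B, hB, hBy, hfB⟩ := hpole (y 0) hm
  have h1 := value hA hfA
  have h2 := value hB hfB
  have h3 : s * (Q.d * residue M (y 0)) ^ 2 = 0 := by
    linear_combination 32 * (h2 - hBy - h1 + hAw)
  have hs0 : s ≠ 0 := by
    rw [hs]
    exact mul_ne_zero Q.e_ne_zero (pow_ne_zero 2 hm)
  exact (mul_eq_zero.1 (pow_eq_zero_iff two_ne_zero |>.1
    ((mul_eq_zero.1 h3).resolve_left hs0))).resolve_right hm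

end ReducedParams

/-! ### The closed form -/

namespace Params

theorem residueψ_zero : residueψ 0 = 1 := by simp [residueψ]

theorem residueψ_one : residueψ 1 = (-1 + I * (√3 : ℝ)) / 2 := by
  have h1 : (((1 : Fin 3) : ℕ) : ℂ) * (2 * I * Real.pi / 3)
      = ((Real.pi - Real.pi / 3 : ℝ) : ℂ) * I := by
    push_cast
    simp only [Fin.val_one, Nat.cast_one]
    ring
  rw [residueψ, h1, exp_mul_I, ← ofReal_cos, ← ofReal_sin, Real.cos_pi_sub, Real.sin_pi_sub,
    Real.cos_pi_div_three, Real.sin_pi_div_three]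
  push_cast
  ring

theorem residueψ_two : residueψ 2 = (-1 - I * (√3 : ℝ)) / 2 := by
  have h1 : residueψ 2 = residueψ 1 ^ 2 := by
    rw [residueψ, residueψ, ← exp_nat_mul]
    congr 1
    simp
  have h3 : (((√3 : ℝ) : ℂ)) ^ 2 = 3 := by
    rw [← ofReal_pow, Real.sq_sqrt (by norm_num)]
    norm_num
  rw [h1, residueψ_one]
  linear_combination 1 / 4 * I ^ 2 * h3 + 3 / 4 * I_sq

end Params

namespace ReducedParams

variable {Q : ReducedParams} {u v M : ℂ → ℂ} {L : PeriodPair} {y : Fin 4 → ℂ}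

/-- For `d = 0` the reduced system is invariant under `M ↦ -M`. -/
theorem IsWave.neg (h : Q.IsWave u v M) (hd : Q.d = 0) : Q.IsWave u v fun z => -M z where
  meromorphic_u := h.meromorphic_u
  meromorphic_v := h.meromorphic_v
  meromorphic_M := fun z => (h.meromorphic_M z).fun_neg
  ne_zero h0 := h.ne_zero (h0.mono fun z hz => neg_eq_zero.1 hz)
  eq_u := by
    filter_upwards [h.eq_u] with z hz
    rw [hz, hd]
    ring
  eq_v := by
    have hd' : Q.d' = 0 := by simp [d', hd]
    filter_upwards [h.eq_v] with z hz
    rw [hz, hd']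
    ring
  eq_M := by
    filter_upwards [h.eq_M] with z hz
    rw [deriv.fun_neg, hz]
    ring

theorem residue_neg (f : ℂ → ℂ) (z₀ : ℂ) {ρ : ℂ}
    (h : Tendsto (fun z => (z - z₀) * f z) (𝓝[≠] z₀) (𝓝 ρ)) :
    residue (fun z => -f z) z₀ = -ρ :=
  residue_eq_of_tendsto (h.neg.congr fun z => by ring)

namespace IsLatticeWave

/-- The translations between poles of `M` with opposite residues preserve `u` and change the sign
of `M`. -/
theorem sub_mem_periods_of_residue_neg (h : Q.IsLatticeWave u v M L y) {z₁ z₂ : ℂ}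
    (h₁ : residue M z₁ ≠ 0) (h₂ : residue M z₂ = -residue M z₁) :
    z₂ - z₁ ∈ periods u ∧ M =ᶠ[codiscrete ℂ] fun z => -M (z + (z₂ - z₁)) := by
  obtain ⟨e1, -, e3⟩ := h.wave.eq_comp_add (h.wave.neg h.d_eq_zero) (z₂ := z₂) h₁
    (by rw [residue_neg _ _ (h.wave.tendsto_residue z₂).2, h₂, neg_neg])
  exact ⟨e1.symm, e3⟩

theorem residue_y_two (h : Q.IsLatticeWave u v M L y) : residue M (y 2) = -residue M (y 0) := by
  rw [h.residue_y, h.residue_y, poleResidue_eq (k := 2)]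
  simp

theorem residue_y_ne_zero (h : Q.IsLatticeWave u v M L y) (k : Fin 4) : residue M (y k) ≠ 0 := by
  rw [h.residue_y]
  exact Q.poleResidue_ne_zero k

/-- The residues of `u` are `-1/2 - i√3/2` at `y 0` and `-1/2 + i√3/2` at `y 1`. -/
theorem residue_u_y (h : Q.IsLatticeWave u v M L y) :
    residue u (y 0) = Params.residueψ 2 ∧ residue u (y 1) = Params.residueψ 1 := by
  have hei : (Q.e.im : ℂ) ≠ 0 := by exact_mod_cast Q.he
  rw [h.wave.residue_u_eq (h.residue_y_ne_zero 0), h.wave.residue_u_eq (h.residue_y_ne_zero 1),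
    h.residue_y, h.residue_y, poleResidue_sq, poleResidue_sq, Params.residueψ_one,
    Params.residueψ_two]
  constructor <;> · field_simp; simp <;> ring

theorem sub_y_mem_lattice (h : Q.IsLatticeWave u v M L y) {z : ℂ} {k : Fin 4}
    (hz : residue M z = Q.poleResidue k) : z - y k ∈ L.lattice := by
  rw [h.lattice]
  exact h.wave.sub_mem_periods (h.residue_y_ne_zero k) ((h.residue_y k).trans hz.symm)

theorem y_sub_y_notMem (h : Q.IsLatticeWave u v M L y) {j k : Fin 4} (hjk : j ≠ k) :
    y j - y k ∉ L.lattice := by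
  intro hmem
  refine hjk (Q.poleResidue_injective ?_)
  rw [← h.residue_y, ← h.residue_y,
    ← residue_add_of_mem_periods (mem_periods.2 (h.hasPeriods_M _ hmem)) (y k), add_sub_cancel]

/-- Modulo the periods of `u`, the poles of `M` reduce to two points, since those of opposite
residues differ by a period of `u`. -/
theorem sub_y_mem_periods_u (h : Q.IsLatticeWave u v M L y) {z : ℂ} (hz : residue M z ≠ 0) :
    z - y 0 ∈ periods u ∨ z - y 1 ∈ periods u := by
  obtain ⟨k, hk⟩ := h.exists_residue_eq z hz
  have h0 : ∀ j : Fin 4, residue M z = -residue M (y j) → z - y j ∈ periods u := fun j hj =>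
    (h.sub_mem_periods_of_residue_neg (h.residue_y_ne_zero j) hj).1
  have h1 : ∀ j : Fin 4, residue M z = Q.poleResidue j → z - y j ∈ periods u := fun j hj =>
    h.hasPeriods_u _ (h.sub_y_mem_lattice hj)
  have hI3 : I ^ 3 = -I := by linear_combination I * I_sq
  fin_cases k
  · exact .inl (h1 0 hk)
  · exact .inr (h1 1 hk)
  · refine .inl (h0 0 ?_)
    rw [hk, poleResidue_eq, h.residue_y]
    simp
  · refine .inr (h0 1 ?_)
    rw [hk, poleResidue_eq, h.residue_y, poleResidue_eq (k := 1)]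
    simp [hI3]

/-- The periods of `u` alone form a lattice, which contains that of the wave with index two. -/
theorem exists_lattice_u (h : Q.IsLatticeWave u v M L y) :
    ∃ Lu : PeriodPair, Lu.lattice = periods u := by
  have hu : meromorphicOrderAt u (y 0) < 0 := by
    rw [h.wave.order_u_neg_iff, h.residue_u_y.1]
    exact exp_ne_zero _
  obtain ⟨r, hr, hdisj⟩ := exists_ball_disjoint_periods h.wave.meromorphic_u hu
  exact exists_periodPair_lattice_eq _ hr hdisj L h.hasPeriods_u

theorem y_zero_sub_y_one_notMem (h : Q.IsLatticeWave u v M L y) : y 0 - y 1 ∉ periods u := by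
  intro hmem
  have h1 := residue_add_of_mem_periods hmem (y 1)
  rw [add_sub_cancel, h.residue_u_y.1, h.residue_u_y.2, Params.residueψ_one,
    Params.residueψ_two] at h1
  have h3 : ((√3 : ℝ) : ℂ) ≠ 0 := by simp
  refine h3 ?_
  linear_combination I * h1 + ((√3 : ℝ) : ℂ) * I_sq

theorem order_u_nonneg_of_residue_eq_zero (h : Q.IsWave u v M) {z : ℂ} (hz : residue u z = 0) :
    0 ≤ meromorphicOrderAt u z :=
  not_lt.1 fun h1 => (h.order_u_neg_iff z).1 h1 hz

/-- The residues of `u` at the poles of `M` do not add up to zero, so that `u` has another pole. -/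
theorem exists_pole_of_residue_one (h : Q.IsLatticeWave u v M L y) :
    ∃ z, residue M z = 0 ∧ residue u z = 1 := by
  obtain ⟨Lu, hLu⟩ := h.exists_lattice_u
  have hsep : ∀ i j : Fin 2, i ≠ j → ![y 0, y 1] i - ![y 0, y 1] j ∉ Lu.lattice := by
    rw [hLu]
    have h1 := h.y_zero_sub_y_one_notMem
    intro i j hij
    fin_cases i <;> fin_cases j
    · exact absurd rfl hij
    · exact h1
    · exact fun hmem => h1 (by simpa using neg_mem hmem)
    · exact absurd rfl hij
  by_contra! hno
  have hreg : ∀ z, (∀ i ∈ (Finset.univ : Finset (Fin 2)), z - ![y 0, y 1] i ∉ Lu.lattice) →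
      0 ≤ meromorphicOrderAt u z := by
    intro z hz
    refine order_u_nonneg_of_residue_eq_zero h.wave ?_
    by_cases hM : residue M z = 0
    · exact (h.wave.residue_of_M hM).1.resolve_right (hno z hM)
    · rw [hLu] at hz
      rcases h.sub_y_mem_periods_u hM with h2 | h2
      · exact absurd h2 (hz 0 (Finset.mem_univ _))
      · exact absurd h2 (hz 1 (Finset.mem_univ _))
  have h1 := (sum_residues_of_simple_poles h.wave.meromorphic_u (L := Lu)
    (hasPeriods_iff.2 hLu.le) Finset.univ ![y 0, y 1] (fun i => residue u (![y 0, y 1] i))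
    (fun i _ j _ hij => hsep i j hij) (fun i _ => (h.wave.exists_eq_residue_div_add _).1) hreg).1
  simp only [Fin.sum_univ_two, Matrix.cons_val_zero, Matrix.cons_val_one] at h1
  rw [h.residue_u_y.1, h.residue_u_y.2, Params.residueψ_one, Params.residueψ_two] at h1
  have h2 : (-1 : ℂ) = 0 := by linear_combination h1
  norm_num at h2

/-- The pole of `u` of residue one is unique modulo the periods of `u`. -/
theorem sub_mem_periods_of_residue_one (h : Q.IsLatticeWave u v M L y) {z₁ z₂ : ℂ}
    (h₁ : residue M z₁ = 0 ∧ residue u z₁ = 1) (h₂ : residue M z₂ = 0 ∧ residue u z₂ = 1) :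
    z₂ - z₁ ∈ periods u := by
  obtain ⟨hτ, hMτ⟩ := h.sub_mem_periods_of_residue_neg (h.residue_y_ne_zero 0) h.residue_y_two
  set τ := y 2 - y 0 with hτ'
  -- `z₁` and `z₁ + τ` are inequivalent modulo `L` and exhaust the poles of `u` where `M` is regular
  have hτL : z₁ - (z₁ + τ) ∉ L.lattice := by
    intro hmem
    refine h.y_sub_y_notMem (j := 0) (k := 2) (by decide) ?_
    convert hmem using 1
    rw [hτ']
    ring
  have h3 : residue M (z₁ + τ) = 0 ∧ residue u (z₁ + τ) = 1 := by
    refine ⟨?_, by rw [residue_add_of_mem_periods hτ, h₁.2]⟩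
    have h4 := residue_congr hMτ z₁
    rw [h₁.1] at h4
    have h5 := (h.wave.comp_add τ).tendsto_residue z₁
    rw [residue_neg (fun z => M (z + τ)) z₁ h5.2, residue_comp_add] at h4
    exact neg_eq_zero.1 h4.symm
  rcases h.eq_or_eq_of_zeros (.inl rfl) hτL ⟨h₁.1, by simp [h₁.2]⟩ ⟨h3.1, by simp [h3.2]⟩
    ⟨h₂.1, by simp [h₂.2]⟩ with h4 | h4
  · exact h.hasPeriods_u _ h4
  · have h5 := add_mem (mem_periods.2 (h.hasPeriods_u _ h4)) hτ
    convert h5 using 1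
    ring

end IsLatticeWave

/-- At a pole of `u` where `M` is regular, the constant terms of `u` and of `M` vanish. -/
theorem IsWave.exists_analytic_of_residue_one (h : Q.IsWave u v M) {z₀ : ℂ}
    (hM : residue M z₀ = 0) (hu : residue u z₀ = 1) :
    (∃ A : ℂ → ℂ, AnalyticAt ℂ A z₀ ∧ A z₀ = 0 ∧ ∀ᶠ z in 𝓝[≠] z₀, u z = 1 / (z - z₀) + A z) ∧
    ∃ K : ℂ → ℂ, AnalyticAt ℂ K z₀ ∧ K z₀ = 0 ∧ ∀ᶠ z in 𝓝[≠] z₀, M z = K z := by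
  obtain ⟨U, V, N, g, e, h1, h2, h3⟩ := h.exists_germ_residue z₀
  rw [hM] at h3
  obtain ⟨K, hK, hNK, hUVK, -⟩ := g.exists_analytic_M h3
  have hU : U z₀ = 1 := h1.trans hu
  have hKz : K z₀ = 0 := by
    refine (mul_eq_zero.1 hUVK).resolve_left ?_
    rw [hU]
    rcases g.V_eq_zero_or_one h3 with hV | hV <;> rw [hV] <;> norm_num
  obtain ⟨a1, a2, a3, jU⟩ := exists_hasJet g.analyticAt_U
  obtain ⟨k1, k2, k3, jK⟩ := exists_hasJet hK
  rw [hU] at jU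
  have jN := jK.id_mul.congr (.of_forall hNK)
  have j1 : HasJet (fun z => (z - z₀) ^ 2) z₀ 0 0 1 0 :=
    ⟨fun _ => 0, analyticAt_const, .of_forall fun z => by ring⟩
  have kU := (((jU.add ((jU.mul jU).const_mul (-1))).add ((jN.id_mul).const_mul (-Q.d))).add
    ((jN.mul jN).const_mul (-Q.e))).add (j1.const_mul (-Q.G))
  obtain ⟨-, u1, -⟩ := jU.id_mul_deriv.unique (kU.congr (g.eq_U.mono fun z hz => by
    rw [hz]; ring))
  have ha1 : a1 = 0 := by linear_combination u1 / 2
  obtain ⟨R, hR, hUR⟩ := jU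
  refine ⟨⟨fun z => a1 + a2 * (z - z₀) + a3 * (z - z₀) ^ 2 + (z - z₀) ^ 3 * R z, by fun_prop,
    by simp [ha1], ?_⟩, K, hK, hKz, ?_⟩
  · filter_upwards [e, hUR.filter_mono nhdsWithin_le_nhds, self_mem_nhdsWithin] with z h4 h5 h6
    have hz : z - z₀ ≠ 0 := sub_ne_zero.2 h6
    rw [h4.1, h5]
    field_simp
    ring
  · filter_upwards [e, self_mem_nhdsWithin] with z h4 h5
    rw [h4.2.2, hNK, mul_div_cancel_left₀ _ (sub_ne_zero.2 h5)]

/-- The expansions in zeta functions of a wave with the pole of `u` of residue one at the origin.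
The lattice of `u` is the whole group of its periods. -/
theorem IsLatticeWave.closed_form_of_residue_zero (h : Q.IsLatticeWave u v M L y)
    (hM : residue M 0 = 0) (hu : residue u 0 = 1) :
    ∃ (Lu : PeriodPair) (x : Fin 3 → ℂ), x 0 = 0 ∧ (∀ k, y k ∉ L.lattice) ∧
      HasSimplePoles u Lu x Params.residueψ ∧ HasSimplePoles M L y Q.poleResidue ∧
      (u =ᶠ[codiscrete ℂ] fun z => weierstrassZeta Lu z
        + ∑ k ∈ ({1, 2} : Finset (Fin 3)), Params.residueψ k *
          (weierstrassZeta Lu (z - x k) + weierstrassZeta Lu (x k))) ∧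
      M =ᶠ[codiscrete ℂ] fun z => ∑ k : Fin 4, Q.poleResidue k *
        (weierstrassZeta L (z - y k) + weierstrassZeta L (y k)) := by
  obtain ⟨Lu, hLu⟩ := h.exists_lattice_u
  have hyL : ∀ k, y k ∉ L.lattice := by
    intro k hk
    have h1 := residue_add_of_mem_periods (mem_periods.2 (h.hasPeriods_M _ hk)) 0
    rw [zero_add, hM] at h1
    exact h.residue_y_ne_zero k h1
  set x : Fin 3 → ℂ := ![0, y 1, y 0] with hx
  have hρ : ∀ k, residue u (x k) = Params.residueψ k := by
    intro k
    fin_cases k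
    · simp [hx, hu, Params.residueψ_zero]
    · simpa [hx] using h.residue_u_y.2
    · simpa [hx] using h.residue_u_y.1
  have hinj : ∀ j k, residue u (x j) = residue u (x k) → j = k := by
    have h3 : √3 ≠ 0 := by simp
    intro j k hjk
    rw [hρ, hρ] at hjk
    have e1 := Params.residueψ_zero
    have e2 := Params.residueψ_one
    have e3 := Params.residueψ_two
    have r := congrArg Complex.re hjk
    have i := congrArg Complex.im hjk
    have : -√3 / 2 ≠ √3 / 2 := fun h => h3 (by linarith)
    fin_cases j <;> fin_cases k <;> simp [e1, e2, e3] at r i ⊢ <;> first | linarith | skip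
    all_goals exfalso; apply h3; linarith
  have hsep : ∀ j k, j ≠ k → x j - x k ∉ Lu.lattice := by
    intro j k hjk hmem
    rw [hLu] at hmem
    have h1 := residue_add_of_mem_periods hmem (x k)
    rw [add_sub_cancel] at h1
    exact hjk (hinj j k h1)
  have hcov : ∀ z, residue u z ≠ 0 → ∃ k, z - x k ∈ Lu.lattice := by
    intro z hz
    rw [hLu]
    by_cases hMz : residue M z = 0
    · refine ⟨0, h.sub_mem_periods_of_residue_one ⟨hM, hu⟩ ⟨hMz, ?_⟩⟩
      exact (h.wave.residue_of_M hMz).1.resolve_left hz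
    · rcases h.sub_y_mem_periods_u hMz with h1 | h1
      · exact ⟨2, h1⟩
      · exact ⟨1, h1⟩
  have hpu : HasPeriods u Lu := hasPeriods_iff.2 hLu.le
  obtain ⟨-, C, hC⟩ := sum_residues_of_simple_poles h.wave.meromorphic_u hpu Finset.univ x
    Params.residueψ (fun i _ j _ hij => hsep i j hij)
    (fun i _ => by
      rw [← hρ]
      exact (h.wave.exists_eq_residue_div_add _).1)
    (fun z hz => order_u_nonneg_of_residue_eq_zero h.wave (by
      by_contra hne
      obtain ⟨k, hk⟩ := hcov z hne
      exact hz k (Finset.mem_univ _) hk))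
  obtain ⟨-, C', hC'⟩ := sum_residues_of_simple_poles h.wave.meromorphic_M h.hasPeriods_M
    Finset.univ y Q.poleResidue (fun i _ j _ hij => h.y_sub_y_notMem hij)
    (fun i _ => by
      rw [← h.residue_y]
      exact (h.wave.exists_eq_residue_div_add _).2.2)
    (fun z hz => not_lt.1 fun h1 => by
      obtain ⟨k, hk⟩ := h.exists_residue_eq z ((h.wave.order_M_neg_iff z).1 h1)
      exact hz k (Finset.mem_univ _) (h.sub_y_mem_lattice hk))
  obtain ⟨⟨A, hA, hA0, huA⟩, K, hK, hK0, hMK⟩ := h.wave.exists_analytic_of_residue_one hM hu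
  -- the constants `C` and `C'` are determined at the origin, where `u - 1/z` and `M` vanish
  have hzeta : ∀ (L : PeriodPair) (c : ℂ), c ∉ L.lattice →
      ContinuousAt (fun z => weierstrassZeta L (z - c)) 0 := fun L c hc =>
    (analyticAt_comp_sub (analyticAt_zeta L (by simpa using hc))).continuousAt
  refine ⟨Lu, x, rfl, hyL, ⟨hpu, hsep, fun z => ?_, fun k => ?_⟩,
    ⟨h.hasPeriods_M, fun j k => h.y_sub_y_notMem, fun z => ?_, fun k => ?_⟩, ?_, ?_⟩
  · rw [h.wave.order_u_neg_iff]
    refine ⟨hcov z, ?_⟩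
    rintro ⟨k, hk⟩
    rw [hLu] at hk
    have h1 := residue_add_of_mem_periods hk (x k)
    rw [add_sub_cancel] at h1
    rw [h1, hρ]
    exact exp_ne_zero _
  · rw [← hρ]
    exact (h.wave.tendsto_residue _).1
  · rw [h.wave.order_M_neg_iff]
    constructor
    · intro hz
      obtain ⟨k, hk⟩ := h.exists_residue_eq z hz
      exact ⟨k, h.sub_y_mem_lattice hk⟩
    · rintro ⟨k, hk⟩
      have h1 := residue_add_of_mem_periods (mem_periods.2 (h.hasPeriods_M _ hk)) (y k)
      rw [add_sub_cancel] at h1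
      rw [h1]
      exact h.residue_y_ne_zero k
  · rw [← h.residue_y]
    exact (h.wave.tendsto_residue _).2
  · have hx12 : ∀ k : Fin 3, k ≠ 0 → x k ∉ Lu.lattice := fun k hk => by
      simpa [hx] using hsep k 0 hk
    obtain ⟨E, hE, hζE⟩ := exists_zeta_eq_inv_add Lu (zero_mem _)
    have hE0 : E 0 = 0 := by
      have h1 : ∀ z, E (-z) = -E z := fun z => by
        have := zeta_neg Lu z
        rw [hζE, hζE] at this
        simp only [sub_zero, div_neg] at this
        linear_combination this
      have h2 := h1 0
      rw [neg_zero] at h2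
      linear_combination h2 / 2
    have c1 := hzeta Lu _ (hx12 1 (by decide))
    have c2 := hzeta Lu _ (hx12 2 (by decide))
    have h1 := eq_of_eventually_nhdsNE (z := 0) hA.continuousAt
      (g := fun z => E z + Params.residueψ 1 * weierstrassZeta Lu (z - x 1)
        + Params.residueψ 2 * weierstrassZeta Lu (z - x 2) + C)
      (by have := hE.continuousAt; fun_prop) (by
        filter_upwards [huA, nhdsNE_of_codiscrete hC 0] with z h1 h2
        rw [h1, Fin.sum_univ_three, show x 0 = 0 from rfl, sub_zero, hζE z,
          Params.residueψ_zero] at h2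
        linear_combination h2)
    simp only [zero_sub, zeta_neg, hA0, hE0] at h1
    filter_upwards [hC] with z hz
    rw [hz, Fin.sum_univ_three, Finset.sum_pair (by decide), show x 0 = 0 from rfl, sub_zero,
      Params.residueψ_zero]
    linear_combination -h1
  · have c := fun k => hzeta L _ (hyL k)
    have h1 := eq_of_eventually_nhdsNE (z := 0) hK.continuousAt
      (g := fun z => ∑ k, Q.poleResidue k * weierstrassZeta L (z - y k) + C')
      (by fun_prop) (by
        filter_upwards [hMK, nhdsNE_of_codiscrete hC' 0] with z h1 h2
        rw [← h1, h2])
    simp only [zero_sub, zeta_neg, hK0] at h1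
    filter_upwards [hC'] with z hz
    rw [hz]
    simp only [mul_add, Finset.sum_add_distrib]
    simp only [mul_neg, Finset.sum_neg_distrib] at h1
    linear_combination -h1

end ReducedParams

/-! ### A Jacobian elliptic function -/

/-- Uniqueness for analytic solutions of `f'' = a f + b f³`. -/
theorem eventuallyEq_of_second_order {f₁ f₂ : ℂ → ℂ} {z₀ a b : ℂ} (h₁ : AnalyticAt ℂ f₁ z₀)
    (h₂ : AnalyticAt ℂ f₂ z₀) (e₁ : ∀ᶠ z in 𝓝 z₀, deriv (deriv f₁) z = a * f₁ z + b * f₁ z ^ 3)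
    (e₂ : ∀ᶠ z in 𝓝 z₀, deriv (deriv f₂) z = a * f₂ z + b * f₂ z ^ 3) (h : f₁ z₀ = f₂ z₀)
    (h' : deriv f₁ z₀ = deriv f₂ z₀) : ∀ᶠ z in 𝓝 z₀, f₁ z = f₂ z := by
  have d₁ := h₁.deriv
  have d₂ := h₂.deriv
  have key := eventually_zero_of_fuchsian (z₀ := z₀)
    ![fun z => f₁ z - f₂ z, fun z => deriv f₁ z - deriv f₂ z]
    (fun i => by fin_cases i <;> simp <;> fun_prop)
    (fun i => by fin_cases i <;> simp [h, h'])
    ![![fun _ => 0, fun z => z - z₀],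
      ![fun z => (z - z₀) * (a + b * (f₁ z ^ 2 + f₁ z * f₂ z + f₂ z ^ 2)), fun _ => 0]]
    (fun i j => AnalyticAt.continuousAt (𝕜 := ℂ) (by
      fin_cases i <;> fin_cases j <;> simp <;> fun_prop)) ?_
    (fun n hn w hw i => by
      have hw0 := hw 0
      have hw1 := hw 1
      have hn0 : (n : ℂ) ≠ 0 := by exact_mod_cast (by omega : n ≠ 0)
      simp [Fin.sum_univ_two] at hw0 hw1
      fin_cases i
      · exact hw0.resolve_left (by omega)
      · exact hw1.resolve_left (by omega)) 0
  · filter_upwards [key] with z hz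
    simpa [sub_eq_zero] using hz
  · intro i
    fin_cases i
    · filter_upwards [h₁.eventually_analyticAt, h₂.eventually_analyticAt] with z g1 g2
      simp [Fin.sum_univ_two, deriv_fun_sub g1.differentiableAt g2.differentiableAt]
    · filter_upwards [d₁.eventually_analyticAt, d₂.eventually_analyticAt, e₁, e₂] with z g1 g2 g3 g4
      simp [Fin.sum_univ_two, deriv_fun_sub g1.differentiableAt g2.differentiableAt]
      rw [g3, g4]
      ring

/-- The germ at the origin of the solution of `g'² = (1 - α g²)(1 + β g²)`, `g(0) = 0`,
`g'(0) = 1`. -/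
structure IsJacobiGerm (α β : ℂ) (g : ℂ → ℂ) : Prop where
  analyticAt : AnalyticAt ℂ g 0
  zero : g 0 = 0
  deriv_zero : deriv g 0 = 1
  eq : ∀ᶠ z in 𝓝 0, deriv g z ^ 2 = (1 - α * g z ^ 2) * (1 + β * g z ^ 2)

/-- Differentiation of the first order equation. -/
theorem second_order_of_first_order {α β : ℂ} {g : ℂ → ℂ} {z : ℂ} (hg : AnalyticAt ℂ g z)
    (h0 : deriv g z ≠ 0)
    (h : ∀ᶠ x in 𝓝 z, deriv g x ^ 2 = (1 - α * g x ^ 2) * (1 + β * g x ^ 2)) :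
    deriv (deriv g) z = (β - α) * g z + -2 * α * β * g z ^ 3 := by
  have d0 := hg.differentiableAt.hasDerivAt
  have d1 := hg.deriv.differentiableAt.hasDerivAt
  have e1 := (d1.fun_pow 2).deriv
  have e2 := ((((d0.fun_pow 2).const_mul α).const_sub 1).mul
    (((d0.fun_pow 2).const_mul β).const_add 1)).deriv
  have e3 := EventuallyEq.deriv_eq h
  rw [e1] at e3
  have e4 := e3.trans e2
  refine mul_left_cancel₀ h0 ?_
  push_cast at e4
  linear_combination e4 / 2

namespace IsJacobiGerm

variable {α β : ℂ} {g : ℂ → ℂ}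

theorem eventually_deriv_deriv (h : IsJacobiGerm α β g) :
    ∀ᶠ z in 𝓝 0, deriv (deriv g) z = (β - α) * g z + -2 * α * β * g z ^ 3 := by
  have h1 : ∀ᶠ z in 𝓝 0, deriv g z ≠ 0 :=
    h.analyticAt.deriv.continuousAt.eventually_ne (by simp [h.deriv_zero])
  filter_upwards [h.analyticAt.eventually_analyticAt, h1, h.eq.eventually_nhds] with z h2 h3 h4
  exact second_order_of_first_order h2 h3 h4

theorem eventuallyEq {g' : ℂ → ℂ} (h : IsJacobiGerm α β g) (h' : IsJacobiGerm α β g') :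
    ∀ᶠ z in 𝓝 0, g z = g' z :=
  eventuallyEq_of_second_order h.analyticAt h'.analyticAt h.eventually_deriv_deriv
    h'.eventually_deriv_deriv (h.zero.trans h'.zero.symm) (h.deriv_zero.trans h'.deriv_zero.symm)

end IsJacobiGerm

/-- The duplication formula: the operator producing `g` on a disc from `g` on the disc of half
the radius. -/
noncomputable def duplication (k : ℂ) (f : ℂ → ℂ) (z : ℂ) : ℂ :=
  2 * f (z / 2) * deriv f (z / 2) / (1 + k * f (z / 2) ^ 4)

theorem meromorphicAt_comp_half {f : ℂ → ℂ} {z : ℂ} (h : MeromorphicAt f (z / 2)) :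
    MeromorphicAt (fun x => f (x / 2)) z :=
  MeromorphicAt.comp_analyticAt (g := fun x : ℂ => x / 2) h (by fun_prop)

theorem meromorphicAt_duplication {k : ℂ} {f : ℂ → ℂ} {z : ℂ} (h : MeromorphicAt f (z / 2)) :
    MeromorphicAt (duplication k f) z := by
  have h1 := meromorphicAt_comp_half h
  have h2 := meromorphicAt_comp_half h.deriv
  unfold duplication
  fun_prop

theorem tendsto_half : Tendsto (fun z : ℂ => z / 2) (𝓝 0) (𝓝 0) := by
  have : ContinuousAt (fun z : ℂ => z / 2) 0 := by fun_prop
  simpa [ContinuousAt] using this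

theorem duplication_congr {k : ℂ} {f g : ℂ → ℂ} (h : ∀ᶠ z in 𝓝 0, f z = g z) :
    ∀ᶠ z in 𝓝 0, duplication k f z = duplication k g z := by
  filter_upwards [tendsto_half.eventually h.eventually_nhds] with z hz
  rw [duplication, duplication, EventuallyEq.deriv_eq hz, hz.self_of_nhds]

/-- Both sides satisfy `f'' = (β - α) f - 2 α β f³` with the same initial values. -/
theorem IsJacobiGerm.duplication_eq {α β : ℂ} {g : ℂ → ℂ} (h : IsJacobiGerm α β g) :
    ∀ᶠ z in 𝓝 0, duplication (α * β) g z = g z := by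
  have c0 : Tendsto (fun z : ℂ => g (z / 2)) (𝓝 0) (𝓝 0) := by
    have := h.analyticAt.continuousAt.tendsto.comp tendsto_half
    rwa [h.zero] at this
  have hD : ∀ᶠ z in 𝓝 (0 : ℂ), 1 + α * β * g (z / 2) ^ 4 ≠ 0 := by
    have h1 : Tendsto (fun z : ℂ => 1 + α * β * g (z / 2) ^ 4) (𝓝 0) (𝓝 (1 + α * β * 0 ^ 4)) :=
      ((c0.pow 4).const_mul _).const_add _
    exact h1.eventually_ne (by simp)
  have dhalf : ∀ {f : ℂ → ℂ} {z : ℂ}, AnalyticAt ℂ f (z / 2) →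
      HasDerivAt (fun z => f (z / 2)) (deriv f (z / 2) / 2) z := by
    intro f z hf
    have h1 := hf.differentiableAt.hasDerivAt.comp z ((hasDerivAt_id z).div_const 2)
    rwa [mul_one_div] at h1
  have d1 : ∀ᶠ z in 𝓝 0, HasDerivAt (duplication (α * β) g)
      ((1 + 2 * (β - α) * g (z / 2) ^ 2 - 6 * (α * β) * g (z / 2) ^ 4
        - 2 * (β - α) * (α * β) * g (z / 2) ^ 6 + (α * β) ^ 2 * g (z / 2) ^ 8)
        / (1 + α * β * g (z / 2) ^ 4) ^ 2) z := by
    filter_upwards [hD, tendsto_half.eventually h.analyticAt.eventually_analyticAt,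
      tendsto_half.eventually h.eq, tendsto_half.eventually h.eventually_deriv_deriv]
      with z h1 h2 h3 h4
    have hA := dhalf h2
    have hB := dhalf h2.deriv
    rw [h4] at hB
    refine (((hA.const_mul 2).fun_mul hB).fun_div (((hA.fun_pow 4).const_mul _).const_add 1)
      h1).congr_deriv ?_
    congr 1
    push_cast
    linear_combination (1 - 3 * (α * β) * g (z / 2) ^ 4) * h3
  have dG : ∀ᶠ z in 𝓝 0, deriv (deriv (duplication (α * β) g)) z
      = (β - α) * duplication (α * β) g z + -2 * α * β * duplication (α * β) g z ^ 3 := by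
    filter_upwards [hD, tendsto_half.eventually h.analyticAt.eventually_analyticAt,
      tendsto_half.eventually h.eq, d1.eventually_nhds] with z h1 h2 h3 h4
    have hA := dhalf h2
    have h5 := EventuallyEq.deriv_eq (h4.mono fun x hx => hx.deriv)
    have h6 := ((((((hA.fun_pow 2).const_mul (2 * (β - α))).const_add 1).fun_sub
      ((hA.fun_pow 4).const_mul (6 * (α * β)))).fun_sub
      ((hA.fun_pow 6).const_mul (2 * (β - α) * (α * β)))).fun_add
      ((hA.fun_pow 8).const_mul ((α * β) ^ 2))).fun_div
      ((((hA.fun_pow 4).const_mul (α * β)).const_add 1).fun_pow 2) (pow_ne_zero 2 h1)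
    rw [h5, h6.deriv, duplication]
    clear h4 h5 h6 hA h2
    generalize g (z / 2) = a at *
    generalize deriv g (z / 2) = b at *
    generalize hE : 1 + α * β * a ^ 4 = E at *
    push_cast
    field_simp
    subst hE
    linear_combination (32 * α * β * a ^ 3 * b) * h3
  have aG : AnalyticAt ℂ (duplication (α * β) g) 0 := by
    have e0 : AnalyticAt ℂ (fun z : ℂ => g (z / 2)) 0 :=
      h.analyticAt.fun_comp_of_eq (g := g) (f := fun z => z / 2) (by fun_prop) (by simp)
    have e1 : AnalyticAt ℂ (fun z : ℂ => deriv g (z / 2)) 0 :=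
      h.analyticAt.deriv.fun_comp_of_eq (g := deriv g) (f := fun z => z / 2) (by fun_prop)
        (by simp)
    exact ((analyticAt_const.mul e0).mul e1).div (analyticAt_const.add
      (analyticAt_const.mul (e0.pow 4))) hD.self_of_nhds
  refine eventuallyEq_of_second_order aG h.analyticAt dG h.eventually_deriv_deriv ?_ ?_
  · simp [duplication, h.zero]
  · rw [d1.self_of_nhds.deriv]
    simp [h.zero, h.deriv_zero]

/-- A function meromorphic on `ℂ` which extends a germ as above. -/
structure IsJacobi (α β : ℂ) (g : ℂ → ℂ) : Prop where
  meromorphic : Meromorphic g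
  exists_germ : ∃ g₀, IsJacobiGerm α β g₀ ∧ ∀ᶠ z in 𝓝[≠] 0, g z = g₀ z

/-- The duplication formula extends the germ to the whole plane. -/
theorem IsJacobiGerm.exists_isJacobi {α β : ℂ} {g₀ : ℂ → ℂ} (h : IsJacobiGerm α β g₀) :
    ∃ g, IsJacobi α β g := by
  obtain ⟨r, hr, hball⟩ := Metric.eventually_nhds_iff_ball.1 h.analyticAt.eventually_analyticAt
  -- `s n` is meromorphic on the disc of radius `2 ^ n * r` and extends the germ
  set s : ℕ → ℂ → ℂ := fun n => (duplication (α * β))^[n] g₀ with hs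
  have hsucc : ∀ n, s (n + 1) = duplication (α * β) (s n) := fun n =>
    Function.iterate_succ_apply' _ _ _
  have hmer : ∀ n : ℕ, ∀ z : ℂ, ‖z‖ < 2 ^ n * r → MeromorphicAt (s n) z := by
    intro n
    induction n with
    | zero => exact fun z hz => (hball z (by simpa using hz)).meromorphicAt
    | succ n ih =>
      intro z hz
      rw [hsucc]
      refine meromorphicAt_duplication (ih _ ?_)
      rw [norm_div, Complex.norm_ofNat, div_lt_iff₀ two_pos]
      rw [pow_succ] at hz
      linarith
  have hgerm : ∀ n : ℕ, ∀ᶠ z in 𝓝 0, s n z = g₀ z := by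
    intro n
    induction n with
    | zero => exact .of_forall fun _ => rfl
    | succ n ih =>
      filter_upwards [duplication_congr (k := α * β) ih, h.duplication_eq] with z h1 h2
      rw [hsucc, h1, h2]
  have hagree : ∀ n m : ℕ, n ≤ m → ∀ z₀ : ℂ, ‖z₀‖ < 2 ^ n * r →
      ∀ᶠ z in 𝓝[≠] z₀, s n z = s m z := by
    intro n m hnm z₀ hz₀
    have h1 : MeromorphicOn (s n - s m) (Metric.ball 0 (2 ^ n * r)) := by
      intro z hz
      have hz' : ‖z‖ < 2 ^ n * r := by simpa using hz
      refine (hmer n z hz').sub (hmer m z (hz'.trans_le ?_))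
      gcongr
      norm_num
    have h2 : meromorphicOrderAt (s n - s m) z₀ = ⊤ := by
      by_contra hne
      refine h1.meromorphicOrderAt_ne_top_of_isPreconnected (y := 0)
        (convex_ball _ _).isPreconnected (x := z₀) (by simpa using hz₀)
        (Metric.mem_ball_self (by positivity)) hne ?_
      rw [meromorphicOrderAt_eq_top_iff]
      filter_upwards [(hgerm n).filter_mono nhdsWithin_le_nhds,
        (hgerm m).filter_mono nhdsWithin_le_nhds] with z h3 h4
      simp [h3, h4]
    filter_upwards [meromorphicOrderAt_eq_top_iff.1 h2] with z hz
    exact sub_eq_zero.1 hz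
  -- the index is chosen so that neighbouring points use functions defined at both of them
  set g : ℂ → ℂ := fun z => s (⌈‖z‖ / r⌉₊ + 1) z with hg
  have hlt : ∀ n : ℕ, n * r < 2 ^ n * r := fun n => by
    have : (n : ℝ) < 2 ^ n := by exact_mod_cast Nat.lt_two_pow_self
    gcongr
  have hloc : ∀ z₀ : ℂ, ∀ᶠ z in 𝓝[≠] z₀, g z = s (⌈‖z₀‖ / r⌉₊ + 2) z := by
    intro z₀
    set N := ⌈‖z₀‖ / r⌉₊ + 2
    have h1 : ∀ᶠ z in 𝓝[≠] z₀, ∀ k ∈ Finset.range (N + 1), ‖z₀‖ < 2 ^ k * r → s k z = s N z := by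
      rw [Filter.eventually_all_finset]
      intro k hk
      by_cases hkz : ‖z₀‖ < 2 ^ k * r
      · filter_upwards [hagree k N (by simpa [Nat.lt_succ_iff] using hk) z₀ hkz] with z hz
        exact fun _ => hz
      · exact .of_forall fun z h => absurd h hkz
    filter_upwards [h1, mem_nhdsWithin_of_mem_nhds (Metric.ball_mem_nhds z₀ hr)] with z h2 h3
    rw [mem_ball_iff_norm] at h3
    refine h2 _ ?_ ?_
    · rw [Finset.mem_range]
      have h4 : ⌈‖z‖ / r⌉₊ ≤ ⌈‖z₀‖ / r⌉₊ + 1 := by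
        refine Nat.ceil_le.2 ?_
        have h5 := Nat.le_ceil (‖z₀‖ / r)
        have h6 : ‖z‖ ≤ ‖z₀‖ + r := by
          have := norm_sub_norm_le z z₀
          linarith
        have h7 : ‖z‖ / r ≤ ‖z₀‖ / r + 1 := by
          rw [div_add_one hr.ne']
          gcongr
        push_cast
        linarith
      omega
    · refine lt_trans ?_ (hlt _)
      have h5 := Nat.le_ceil (‖z‖ / r)
      rw [div_le_iff₀ hr] at h5
      have h6 : ‖z₀‖ < ‖z‖ + r := by
        have := norm_sub_norm_le z₀ z
        rw [norm_sub_rev] at this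
        linarith
      push_cast
      linarith
  refine ⟨g, fun z₀ => ?_, g₀, h, ?_⟩
  · refine (hmer (⌈‖z₀‖ / r⌉₊ + 2) z₀ (lt_of_le_of_lt ?_ (hlt _))).congr
      ((hloc z₀).mono fun z hz => hz.symm)
    have h5 := Nat.le_ceil (‖z₀‖ / r)
    rw [div_le_iff₀ hr] at h5
    push_cast
    nlinarith
  · filter_upwards [hloc 0, (hgerm _).filter_mono nhdsWithin_le_nhds] with z h1 h2
    rw [h1, h2]

/-- On a convex neighbourhood of the segment `[0, π/2]`, a primitive `T` of
`(α + β sin² θ)^{-1/2}`. The function `g` of the next lemmas is given there by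
`g(T(θ)) = sin θ / √α`. -/
theorem exists_elliptic_integral {α β : ℝ} (hα : 0 < α) (hβ : 0 < β) :
    ∃ (Ω : Set ℂ) (T : ℂ → ℂ) (w : ℂ → ℂ) (x₀ : ℝ), IsOpen Ω ∧ IsPreconnected Ω ∧ 0 ∈ Ω ∧
      (Real.pi / 2 : ℂ) ∈ Ω ∧ (∀ θ ∈ Ω, HasDerivAt T (w θ) θ) ∧
      (∀ θ ∈ Ω, w θ ^ 2 * (α + β * sin θ ^ 2) = 1) ∧ w 0 * (√α : ℝ) = 1 ∧ T 0 = 0 ∧ 0 < x₀ ∧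
      T (Real.pi / 2) = x₀ := by
  set f : ℂ → ℂ := fun θ => α + β * sin θ ^ 2 with hf
  set w : ℂ → ℂ := fun θ => (f θ) ^ (-(1 / 2) : ℂ) with hw
  have hfc : Continuous f := by fun_prop
  set S : Set ℂ := segment ℝ (0 : ℂ) (Real.pi / 2 : ℂ) with hS
  have hreal : ∀ x : ℝ, f x = ((α + β * Real.sin x ^ 2 : ℝ) : ℂ) := fun x => by
    simp [hf]
  have hpos : ∀ x : ℝ, 0 < α + β * Real.sin x ^ 2 := fun x => by positivity
  have hSreal : ∀ θ ∈ S, ∃ x : ℝ, θ = x := by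
    rintro θ ⟨a, b, -, -, -, rfl⟩
    exact ⟨b * (Real.pi / 2), by simp⟩
  have hSc : IsCompact S := by
    rw [hS, segment_eq_image_lineMap]
    exact isCompact_Icc.image (by fun_prop)
  have hU : IsOpen {θ : ℂ | 0 < (f θ).re} :=
    isOpen_lt continuous_const (continuous_re.comp hfc)
  obtain ⟨δ, hδ, hδU⟩ := hSc.exists_thickening_subset_open hU fun θ hθ => by
    obtain ⟨x, rfl⟩ := hSreal θ hθ
    simp only [Set.mem_ofPred_eq, hreal, ofReal_re]
    exact hpos x
  set Ω := Metric.thickening δ S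
  have hΩ : IsOpen Ω := Metric.isOpen_thickening
  have hconv : Convex ℝ Ω := (convex_segment _ _).thickening δ
  have hSΩ : S ⊆ Ω := Metric.self_subset_thickening hδ S
  have h0 : (0 : ℂ) ∈ Ω := hSΩ (left_mem_segment ℝ _ _)
  have h1 : (Real.pi / 2 : ℂ) ∈ Ω := hSΩ (right_mem_segment ℝ _ _)
  have hslit : ∀ θ ∈ Ω, f θ ∈ slitPlane := fun θ hθ => Or.inl (hδU hθ)
  have hwd : DifferentiableOn ℂ w Ω := fun θ hθ => by
    have hfd : DifferentiableAt ℂ f θ := by fun_prop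
    exact (hfd.cpow (differentiableAt_const _) (hslit θ hθ)).differentiableWithinAt
  obtain ⟨T, hT⟩ := hconv.exists_forall_hasDerivWithinAt hwd
  have hT' : ∀ θ ∈ Ω, HasDerivAt T (w θ) θ := fun θ hθ => (hT θ hθ).hasDerivAt (hΩ.mem_nhds hθ)
  have hwreal : ∀ x : ℝ, w x = (((α + β * Real.sin x ^ 2) ^ (-(1 / 2) : ℝ) : ℝ) : ℂ) := fun x => by
    rw [hw]
    simp only
    rw [hreal, ofReal_cpow (hpos x).le]
    push_cast
    rfl
  have hxS : ∀ x : ℝ, x ∈ Set.uIcc 0 (Real.pi / 2) → (x : ℂ) ∈ Ω := fun x hx => by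
    have hpi := Real.pi_pos
    rw [Set.uIcc_of_le (by positivity)] at hx
    refine hSΩ ⟨1 - x / (Real.pi / 2), x / (Real.pi / 2), ?_, ?_, by ring, ?_⟩
    · rw [sub_nonneg, div_le_one (by positivity)]
      exact hx.2
    · exact div_nonneg hx.1 (by positivity)
    · simp
  have hcont : Continuous fun x : ℝ => (α + β * Real.sin x ^ 2) ^ (-(1 / 2) : ℝ) :=
    Continuous.rpow_const (by fun_prop) fun x => Or.inl (hpos x).ne'
  have hint : ∫ x in (0 : ℝ)..(Real.pi / 2),
      (((α + β * Real.sin x ^ 2) ^ (-(1 / 2) : ℝ) : ℝ) : ℂ)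
      = T ((Real.pi / 2 : ℝ) : ℂ) - T ((0 : ℝ) : ℂ) := by
    refine intervalIntegral.integral_eq_sub_of_hasDerivAt (f := fun x : ℝ => T x) (fun x hx => ?_)
      ((continuous_ofReal.comp hcont).intervalIntegrable _ _)
    rw [← hwreal]
    exact (hT' x (hxS x hx)).comp_ofReal
  refine ⟨Ω, fun θ => T θ - T 0, w,
    ∫ x in (0 : ℝ)..(Real.pi / 2), (α + β * Real.sin x ^ 2) ^ (-(1 / 2) : ℝ), hΩ,
    hconv.isPreconnected, h0, h1, fun θ hθ => (hT' θ hθ).sub_const _, fun θ hθ => ?_, ?_,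
    sub_self _, ?_, ?_⟩
  · have hne : f θ ≠ 0 := slitPlane_ne_zero (hslit θ hθ)
    have h2 : w θ ^ 2 = (f θ)⁻¹ := by
      rw [hw]
      simp only
      rw [← cpow_nat_mul]
      norm_num [cpow_neg_one]
    rw [h2]
    exact inv_mul_cancel₀ hne
  · have h2 := hwreal 0
    rw [ofReal_zero] at h2
    rw [h2, ← ofReal_mul, Real.sqrt_eq_rpow]
    simp only [Real.sin_zero, ne_eq, OfNat.ofNat_ne_zero, not_false_eq_true, zero_pow, mul_zero,
      add_zero]
    rw [← Real.rpow_add hα]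
    norm_num
  · refine intervalIntegral.intervalIntegral_pos_of_pos (hcont.intervalIntegrable _ _)
      (fun x => Real.rpow_pos_of_pos (hpos x) _) (by have := Real.pi_pos; positivity)
  · rw [← intervalIntegral.integral_ofReal, hint]
    push_cast
    rfl

/-- Inversion of the elliptic integral near a point. -/
theorem exists_inverse_elliptic_integral {α β : ℝ} (hα : 0 < α) {Ω : Set ℂ} {T w : ℂ → ℂ}
    (hΩ : IsOpen Ω) (hT : ∀ θ ∈ Ω, HasDerivAt T (w θ) θ)
    (hw : ∀ θ ∈ Ω, w θ ^ 2 * (α + β * sin θ ^ 2) = 1) {θ₀ : ℂ} (hθ₀ : θ₀ ∈ Ω) :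
    ∃ s : ℂ → ℂ, AnalyticAt ℂ s (T θ₀) ∧ s (T θ₀) = sin θ₀ / (√α : ℝ) ∧
      deriv s (T θ₀) * (w θ₀ * (√α : ℝ)) = cos θ₀ ∧
      (∀ᶠ θ in 𝓝 θ₀, s (T θ) = sin θ / (√α : ℝ)) ∧
      (∀ᶠ z in 𝓝 (T θ₀), deriv s z ^ 2 = (1 - α * s z ^ 2) * (1 + β * s z ^ 2)) ∧
      ∃ φ : ℂ → ℂ, ContinuousAt φ (T θ₀) ∧ φ (T θ₀) = θ₀ ∧
        (∀ᶠ z in 𝓝 (T θ₀), T (φ z) = z) ∧ ∀ᶠ z in 𝓝 (T θ₀), s z = sin (φ z) / (√α : ℝ) := by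
  have hsq : ((√α : ℝ) : ℂ) ^ 2 = α := by
    rw [← ofReal_pow, Real.sq_sqrt hα.le]
  have hne : ((√α : ℝ) : ℂ) ≠ 0 := by
    exact_mod_cast (Real.sqrt_pos.2 hα).ne'
  have hα' : (α : ℂ) ≠ 0 := by exact_mod_cast hα.ne'
  have hw0 : ∀ θ ∈ Ω, w θ ≠ 0 := fun θ hθ h0 => by
    have := hw θ hθ
    simp [h0] at this
  have hTa : AnalyticAt ℂ T θ₀ := by
    have hd : DifferentiableOn ℂ T Ω := fun θ hθ =>
      (hT θ hθ).differentiableAt.differentiableWithinAt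
    exact hd.analyticAt (hΩ.mem_nhds hθ₀)
  have hT0 : deriv T θ₀ ≠ 0 := by
    rw [(hT θ₀ hθ₀).deriv]
    exact hw0 θ₀ hθ₀
  set φ := hTa.hasStrictDerivAt.localInverse _ _ _ hT0 with hφ
  have hφa : AnalyticAt ℂ φ (T θ₀) := hTa.analyticAt_localInverse hT0
  have hleft : ∀ᶠ θ in 𝓝 θ₀, φ (T θ) = θ := HasStrictDerivAt.eventually_left_inverse ..
  have hright : ∀ᶠ z in 𝓝 (T θ₀), T (φ z) = z := HasStrictDerivAt.eventually_right_inverse ..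
  have hφ0 : φ (T θ₀) = θ₀ := hleft.self_of_nhds
  set s : ℂ → ℂ := fun z => sin (φ z) / (√α : ℝ) with hs
  have hsa : AnalyticAt ℂ s (T θ₀) := by
    have : AnalyticAt ℂ (fun z => sin (φ z)) (T θ₀) :=
      analyticAt_sin.fun_comp hφa
    exact this.div analyticAt_const hne
  have hmem : ∀ᶠ z in 𝓝 (T θ₀), φ z ∈ Ω :=
    hφa.continuousAt.eventually (by rw [hφ0]; exact hΩ.mem_nhds hθ₀)
  have hds : ∀ᶠ z in 𝓝 (T θ₀), deriv s z * (w (φ z) * (√α : ℝ)) = cos (φ z) := by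
    filter_upwards [hφa.eventually_analyticAt, hmem, hright.eventually_nhds] with z h1 h2 h3
    have d1 := h1.differentiableAt.hasDerivAt
    have d2 : HasDerivAt (fun x => T (φ x)) (w (φ z) * deriv φ z) z := (hT _ h2).comp z d1
    have d3 : w (φ z) * deriv φ z = 1 :=
      d2.deriv.symm.trans ((EventuallyEq.deriv_eq h3).trans (deriv_id z))
    have d4 := (d1.csin.div_const (√α : ℝ)).deriv
    rw [hs, d4]
    field_simp
    linear_combination cos (φ z) * d3
  refine ⟨s, hsa, by rw [hs]; simp only [hφ0], ?_, hleft.mono fun θ h => by rw [hs]; simp only [h],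
    ?_, φ, hφa.continuousAt, hφ0, hright, .of_forall fun _ => rfl⟩
  · have := hds.self_of_nhds
    rwa [hφ0] at this
  · filter_upwards [hds, hmem] with z h1 h2
    have h3 := hw _ h2
    have h4 : s z * (√α : ℝ) = sin (φ z) := by
      rw [hs]
      field_simp
    have h5 := sin_sq_add_cos_sq (φ z)
    rw [← h4, ← h1] at h5
    rw [← h4] at h3
    have h6 := hw0 _ h2
    set W := w (φ z)
    set r := ((√α : ℝ) : ℂ)
    have h7 : W ^ 2 * r ^ 2 ≠ 0 := mul_ne_zero (pow_ne_zero 2 h6) (pow_ne_zero 2 hne)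
    refine mul_left_cancel₀ h7 ?_
    rw [← hsq] at h3 ⊢
    generalize s z = x at *
    linear_combination h5 - (1 - r ^ 2 * x ^ 2) * h3

/-- The germ is obtained by inverting the elliptic integral at the origin. -/
theorem exists_isJacobiGerm {α β : ℝ} (hα : 0 < α) (hβ : 0 < β) : ∃ g, IsJacobiGerm α β g := by
  obtain ⟨Ω, T, w, x₀, hΩ, -, h0, -, hT, hw, hw0, hT0, -⟩ := exists_elliptic_integral hα hβ
  obtain ⟨s, hs, hs0, hds, -, heq, -⟩ := exists_inverse_elliptic_integral hα hΩ hT hw h0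
  rw [hT0] at *
  refine ⟨s, hs, by simpa using hs0, ?_, heq⟩
  rwa [hw0, mul_one, cos_zero] at hds

namespace IsJacobi

variable {α β : ℂ} {g : ℂ → ℂ}

theorem first_order (h : IsJacobi α β g) :
    ∀ᶠ z in codiscrete ℂ, deriv g z ^ 2 = (1 - α * g z ^ 2) * (1 + β * g z ^ 2) := by
  obtain ⟨g₀, h0, hg⟩ := h.exists_germ
  have hm := h.meromorphic
  refine eventuallyEq_codiscrete_of_nhdsNE (z := 0) (f := fun z => deriv g z ^ 2)
    (g := fun z => (1 - α * g z ^ 2) * (1 + β * g z ^ 2)) (fun z => (hm z).deriv.fun_pow 2)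
    (fun z => ?_) ?_
  · have := hm z
    fun_prop
  · filter_upwards [eventually_nhdsNE_nhds hg, h0.eq.filter_mono nhdsWithin_le_nhds] with z h1 h2
    rw [EventuallyEq.deriv_eq h1, h1.self_of_nhds, h2]

theorem second_order (h : IsJacobi α β g) :
    ∀ᶠ z in codiscrete ℂ, deriv (deriv g) z = (β - α) * g z + -2 * α * β * g z ^ 3 := by
  obtain ⟨g₀, h0, hg⟩ := h.exists_germ
  have hm := h.meromorphic
  refine eventuallyEq_codiscrete_of_nhdsNE (z := 0) (f := deriv (deriv g))
    (g := fun z => (β - α) * g z + -2 * α * β * g z ^ 3) (fun z => (hm z).deriv.deriv)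
    (fun z => ?_) ?_
  · have := hm z
    fun_prop
  · filter_upwards [eventually_nhdsNE_nhds hg,
      h0.eventually_deriv_deriv.filter_mono nhdsWithin_le_nhds] with z h1 h2
    rw [EventuallyEq.deriv_eq (EventuallyEq.deriv h1), h1.self_of_nhds, h2]

theorem odd (h : IsJacobi α β g) : ∀ᶠ z in codiscrete ℂ, g (-z) = -g z := by
  obtain ⟨g₀, h0, hg⟩ := h.exists_germ
  have t : Tendsto (fun z : ℂ => -z) (𝓝 0) (𝓝 0) := by
    simpa using (continuous_neg (G := ℂ)).tendsto 0
  have hneg : IsJacobiGerm α β fun z => -g₀ (-z) := by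
    have hd : ∀ z, deriv (fun z => -g₀ (-z)) z = deriv g₀ (-z) := fun z => by
      rw [deriv.fun_neg, deriv_comp_neg, neg_neg]
    refine ⟨?_, by simp [h0.zero], by rw [hd]; simp [h0.deriv_zero], ?_⟩
    · exact (h0.analyticAt.fun_comp_of_eq (g := g₀) (f := fun z => -z) (by fun_prop)
        (by simp)).neg
    · filter_upwards [t.eventually h0.eq] with z hz
      rw [hd, hz]
      ring
  have t' : Tendsto (fun z : ℂ => -z) (𝓝[≠] 0) (𝓝[≠] 0) := by
    simpa using tendsto_affine_nhdsNE (-1) 0 0 (by norm_num)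
  refine eventuallyEq_codiscrete_of_nhdsNE (z := 0) (f := fun z => g (-z)) (g := fun z => -g z)
    (by simpa using meromorphic_comp_affine h.meromorphic (-1) 0)
    (fun z => (h.meromorphic z).fun_neg) ?_
  filter_upwards [hg, t'.eventually hg, (hneg.eventuallyEq h0).filter_mono nhdsWithin_le_nhds]
    with z h1 h2 h3
  rw [h1, h2]
  linear_combination -h3

/-- A real period: with `x₀` the value of the elliptic integral over `[0, π/2]`, the function is
even about `x₀`, where it has a critical point. -/
theorem exists_period {α β : ℝ} (h : IsJacobi α β g) (hα : 0 < α) (hβ : 0 < β) :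
    ∃ x₀ : ℝ, 0 < x₀ ∧ ((4 * x₀ : ℝ) : ℂ) ∈ periods g := by
  obtain ⟨Ω, T, w, x₀, hΩ, hconn, h0, h1, hT, hw, hw0, hT0, hx₀, hTx⟩ :=
    exists_elliptic_integral hα hβ
  obtain ⟨g₀, hg₀, hg⟩ := h.exists_germ
  have hm := h.meromorphic
  have hw_ne : ∀ θ ∈ Ω, w θ ≠ 0 := fun θ hθ h0 => by
    have := hw θ hθ
    simp [h0] at this
  have hTd : DifferentiableOn ℂ T Ω := fun θ hθ =>
    (hT θ hθ).differentiableAt.differentiableWithinAt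
  -- the identity theorem carries `g (T θ) = sin θ / √α` from `θ = 0` to `θ = π / 2`
  have hgT : ∀ᶠ θ in 𝓝[≠] (Real.pi / 2 : ℂ), g (T θ) = sin θ / (√α : ℝ) := by
    have hmer : MeromorphicOn (fun θ => g (T θ) - sin θ / (√α : ℝ)) Ω := fun θ hθ => by
      have h2 : AnalyticAt ℂ T θ := hTd.analyticAt (hΩ.mem_nhds hθ)
      have h3 : MeromorphicAt (fun θ => g (T θ)) θ := MeromorphicAt.comp_analyticAt (hm _) h2
      have h4 : MeromorphicAt (fun θ : ℂ => sin θ / (√α : ℝ)) θ :=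
        analyticAt_sin.meromorphicAt.fun_div (.const _ _)
      exact h3.fun_sub h4
    have htop : meromorphicOrderAt (fun θ => g (T θ) - sin θ / (√α : ℝ)) (Real.pi / 2 : ℂ) = ⊤ := by
      by_contra hne
      refine hmer.meromorphicOrderAt_ne_top_of_isPreconnected hconn h1 h0 hne ?_
      rw [meromorphicOrderAt_eq_top_iff]
      obtain ⟨s, hs, hs0, hds, hsT, heq, -⟩ := exists_inverse_elliptic_integral hα hΩ hT hw h0
      rw [hT0] at hs hs0 hds heq
      have hsg : IsJacobiGerm α β s := ⟨hs, by simpa using hs0, by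
        rwa [hw0, mul_one, cos_zero] at hds, heq⟩
      have t : Tendsto T (𝓝[≠] 0) (𝓝[≠] 0) := by
        simpa [hT0] using (hT 0 h0).tendsto_nhdsNE (hw_ne 0 h0)
      filter_upwards [t.eventually hg, hsT.filter_mono nhdsWithin_le_nhds,
        t.eventually ((hg₀.eventuallyEq hsg).filter_mono nhdsWithin_le_nhds)] with θ h2 h3 h4
      rw [h2, h4, h3, sub_self]
    filter_upwards [meromorphicOrderAt_eq_top_iff.1 htop] with θ hθ
    exact sub_eq_zero.1 hθ
  obtain ⟨s, hs, -, hds, -, -, φ, hφ, hφ1, hTφ, hsφ⟩ :=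
    exists_inverse_elliptic_integral hα hΩ hT hw h1
  rw [hTx] at hs hds hφ hφ1 hTφ hsφ
  have hgs : ∀ᶠ z in 𝓝[≠] (x₀ : ℂ), g z = s z := by
    have t : Tendsto φ (𝓝[≠] (x₀ : ℂ)) (𝓝[≠] (Real.pi / 2 : ℂ)) := by
      refine tendsto_nhdsWithin_iff.2 ⟨?_, ?_⟩
      · have := hφ.tendsto
        rw [hφ1] at this
        exact this.mono_left nhdsWithin_le_nhds
      · filter_upwards [hTφ.filter_mono nhdsWithin_le_nhds, self_mem_nhdsWithin] with z h2 h3 h4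
        refine h3 ?_
        rw [Set.mem_singleton_iff] at h4 ⊢
        rw [← h2, h4, hTx]
    filter_upwards [t.eventually hgT, hTφ.filter_mono nhdsWithin_le_nhds,
      hsφ.filter_mono nhdsWithin_le_nhds] with z h2 h3 h4
    rw [h4, ← h2, h3]
  -- the critical point of the sine at `π / 2`
  have hds0 : deriv s x₀ = 0 := by
    rw [cos_pi_div_two] at hds
    refine (mul_eq_zero.1 hds).resolve_right (mul_ne_zero (hw_ne _ h1) ?_)
    exact_mod_cast (Real.sqrt_pos.2 hα).ne'
  have e1 : ∀ᶠ z in 𝓝 (x₀ : ℂ), deriv (deriv s) z = (β - α) * s z + -2 * α * β * s z ^ 3 := by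
    refine eventuallyEq_nhds_of_nhdsNE (f := deriv (deriv s))
      (g := fun z => (β - α) * s z + -2 * α * β * s z ^ 3) hs.deriv.deriv.continuousAt
      (AnalyticAt.continuousAt (𝕜 := ℂ) (by fun_prop)) ?_
    filter_upwards [eventually_nhdsNE_nhds hgs, nhdsNE_of_codiscrete h.second_order x₀]
      with z h2 h3
    rw [← EventuallyEq.deriv_eq (EventuallyEq.deriv h2), ← h2.self_of_nhds, h3]
  have t : Tendsto (fun z : ℂ => 2 * x₀ - z) (𝓝 (x₀ : ℂ)) (𝓝 (x₀ : ℂ)) := by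
    have : ContinuousAt (fun z : ℂ => 2 * x₀ - z) x₀ := by fun_prop
    have h2 := this.tendsto
    rwa [show (2 * x₀ - x₀ : ℂ) = x₀ by ring] at h2
  have hrefl : ∀ᶠ z in 𝓝 (x₀ : ℂ), s (2 * x₀ - z) = s z := by
    have hd : deriv (fun z => s (2 * x₀ - z)) = fun z => -deriv s (2 * x₀ - z) :=
      funext fun z => deriv_comp_const_sub (f := s) (2 * x₀ : ℂ) z
    refine eventuallyEq_of_second_order (f₁ := fun z => s (2 * x₀ - z)) (a := β - α)
      (b := -2 * α * β) ?_ hs ?_ e1 (by ring_nf) ?_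
    · exact hs.fun_comp_of_eq (g := s) (f := fun z => 2 * x₀ - z) (by fun_prop) (by ring)
    · filter_upwards [t.eventually e1] with z hz
      rw [hd, deriv.fun_neg, deriv_comp_const_sub (f := deriv s), neg_neg, hz]
    · rw [hd, hds0]
      simp only
      rw [show (2 * x₀ - x₀ : ℂ) = x₀ by ring, hds0, neg_zero]
  have hsym : ∀ᶠ z in codiscrete ℂ, g (2 * x₀ - z) = g z := by
    refine eventuallyEq_codiscrete_of_nhdsNE (z := x₀) (f := fun z => g (2 * x₀ - z)) (g := g)
      ?_ hm ?_
    · have := meromorphic_comp_affine hm (-1) (2 * x₀)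
      intro z
      refine (this z).congr (.of_forall fun x => ?_)
      simp only
      congr 1
      ring
    · filter_upwards [hgs, (tendsto_reflection (x₀ : ℂ)).eventually hgs,
        hrefl.filter_mono nhdsWithin_le_nhds] with z h2 h3 h4
      rw [h2, h3, h4]
  -- evenness about `x₀` and oddness about the origin
  have hanti : ∀ᶠ z in codiscrete ℂ, g (z + 2 * x₀) = -g z := by
    have h2 := eventually_codiscrete_reflection hsym 0
    filter_upwards [h2, h.odd] with z h3 h4
    rw [← h4, ← zero_sub, ← h3]
    congr 1
    ring
  refine ⟨x₀, hx₀, ?_⟩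
  rw [mem_periods]
  filter_upwards [hanti, eventually_codiscrete_add hanti (2 * x₀)] with z h2 h3
  rw [show z + ((4 * x₀ : ℝ) : ℂ) = z + 2 * x₀ + 2 * x₀ by push_cast; ring, h3, h2, neg_neg]

/-- Rotation of the variable by a right angle exchanges the parameters. -/
theorem rotate (h : IsJacobi α β g) : IsJacobi β α fun z => -I * g (I * z) := by
  obtain ⟨g₀, h0, hg⟩ := h.exists_germ
  have hmul : Tendsto (fun z : ℂ => I * z) (𝓝 0) (𝓝 0) := by
    have : ContinuousAt (fun z : ℂ => I * z) 0 := by fun_prop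
    simpa using this.tendsto
  refine ⟨fun z => ?_, fun z => -I * g₀ (I * z), ⟨?_, by simp [h0.zero], ?_, ?_⟩, ?_⟩
  · have := meromorphic_comp_affine h.meromorphic I 0 z
    simp only [add_zero] at this
    exact (MeromorphicAt.const _ _).fun_mul this
  · exact analyticAt_const.mul
      (h0.analyticAt.fun_comp_of_eq (g := g₀) (f := fun z => I * z) (by fun_prop) (by simp))
  · rw [deriv_const_mul_field, deriv_comp_mul_left]
    simp [h0.deriv_zero]
  · filter_upwards [hmul.eventually h0.eq] with z hz
    rw [deriv_const_mul_field, deriv_comp_mul_left, smul_eq_mul]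
    linear_combination I ^ 4 * hz + ((1 - α * g₀ (I * z) ^ 2) * (1 + β * g₀ (I * z) ^ 2)
      * (I ^ 2 - 1) - α * g₀ (I * z) ^ 2 - β * -g₀ (I * z) ^ 2
      + (I ^ 2 - 1) * α * β * g₀ (I * z) ^ 4) * I_sq
  · have h1 := tendsto_affine_nhdsNE I 0 0 I_ne_zero
    simp only [mul_zero, add_zero] at h1
    filter_upwards [h1.eventually hg] with z hz
    rw [hz]

end IsJacobi

/-- The function with parameters `α, β > 0` is doubly periodic, with a rectangular lattice. -/
theorem exists_isJacobi_periods {α β : ℝ} (hα : 0 < α) (hβ : 0 < β) :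
    ∃ g, IsJacobi α β g ∧ ∃ L : PeriodPair, HasPeriods g L := by
  obtain ⟨g₀, h0⟩ := exists_isJacobiGerm hα hβ
  obtain ⟨g, h⟩ := h0.exists_isJacobi
  obtain ⟨x, hx, hxp⟩ := h.exists_period hα hβ
  obtain ⟨y, hy, hyp⟩ := h.rotate.exists_period hβ hα
  have hyp' : I * ((4 * y : ℝ) : ℂ) ∈ periods g := by
    rw [mem_periods] at hyp ⊢
    have h1 := eventually_codiscrete_affine hyp (-I) 0 (by simp)
    filter_upwards [h1] with z hz
    have h2 := mul_left_cancel₀ (by simp : -I ≠ 0) hz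
    rw [show I * (-I * z + 0 + ((4 * y : ℝ) : ℂ)) = z + I * ((4 * y : ℝ) : ℂ) by
      linear_combination -z * I_sq, show I * (-I * z + 0) = z by linear_combination -z * I_sq] at h2
    exact h2
  refine ⟨g, h, ⟨((4 * x : ℝ) : ℂ), I * ((4 * y : ℝ) : ℂ), ?_⟩, ?_⟩
  · rw [LinearIndependent.pair_iff]
    intro s t hst
    have hre := congrArg Complex.re hst
    have him := congrArg Complex.im hst
    simp at hre him
    exact ⟨hre.resolve_right hx.ne', him.resolve_right hy.ne'⟩
  · rw [hasPeriods_iff, PeriodPair.lattice, Submodule.span_le]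
    rintro l (rfl | rfl)
    · exact hxp
    · exact hyp'

/-! ### Existence of elliptic waves -/

/-- A system satisfied by rational functions of `g` and `g'`, where
`g'² = 1 - κ²/8 g² - (t²/4 + 3 κ⁴/256) g⁴`. -/
structure IsSystemAt (κ t : ℂ) (W V Z : ℂ → ℂ) (z : ℂ) : Prop where
  hasDerivAt_W : HasDerivAt W (Z z * V z - κ / 4 * W z) z
  hasDerivAt_V : HasDerivAt V (Z z * W z + κ / 4 * V z) z
  hasDerivAt_Z : HasDerivAt Z ((W z ^ 2 + V z ^ 2) / 8) z
  mul_eq : V z * W z = 4 * Z z ^ 2 + 3 / 4 * κ ^ 2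
  sq_eq : V z ^ 2 = W z ^ 2 + 4 * (κ * Z z + 2 * t)

/-- `W = X - Y`, `V = X + Y` with `X = 2 / g` and `Y` regular at the origin. -/
theorem isSystemAt_of_jacobi {κ t : ℂ} {g : ℂ → ℂ} {z : ℂ} (hg : AnalyticAt ℂ g z)
    (h0 : g z ≠ 0) (hD : 16 + κ ^ 2 * g z ^ 2 ≠ 0)
    (h1 : deriv g z ^ 2 = 1 - κ ^ 2 / 8 * g z ^ 2 - (t ^ 2 / 4 + 3 * κ ^ 4 / 256) * g z ^ 4)
    (h2 : deriv (deriv g) z = -κ ^ 2 / 8 * g z - 2 * (t ^ 2 / 4 + 3 * κ ^ 4 / 256) * g z ^ 3) :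
    IsSystemAt κ t
      (fun z => 2 / g z - (16 * t * g z - 8 * κ * deriv g z) / (16 + κ ^ 2 * g z ^ 2))
      (fun z => 2 / g z + (16 * t * g z - 8 * κ * deriv g z) / (16 + κ ^ 2 * g z ^ 2))
      (fun z => -(16 * deriv g z + 2 * κ * t * g z ^ 3) / (g z * (16 + κ ^ 2 * g z ^ 2))) z := by
  have d0 := hg.differentiableAt.hasDerivAt
  have d1 := hg.deriv.differentiableAt.hasDerivAt
  rw [h2] at d1
  have dD := ((d0.fun_pow 2).const_mul (κ ^ 2)).const_add 16
  have dx := (hasDerivAt_const z (2 : ℂ)).fun_div d0 h0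
  have dy := ((d0.const_mul (16 * t)).fun_sub (d1.const_mul (8 * κ))).fun_div dD hD
  have dZ := (((d1.const_mul 16).fun_add ((d0.fun_pow 3).const_mul (2 * κ * t))).fun_neg).fun_div
    (d0.fun_mul dD) (mul_ne_zero h0 hD)
  refine ⟨(dx.fun_sub dy).congr_deriv ?_, (dx.fun_add dy).congr_deriv ?_, dZ.congr_deriv ?_, ?_, ?_⟩
  all_goals
    generalize g z = a at *
    generalize deriv g z = p at *
    generalize hE : 16 + κ ^ 2 * a ^ 2 = E at *
    push_cast
    field_simp
    subst hE
  · linear_combination (-16384 * a ^ 3 * κ ^ 3 - 131072 * a * κ) * h1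
  · linear_combination (16384 * a ^ 3 * κ ^ 3 + 131072 * a * κ) * h1
  · linear_combination (262144 * a ^ 2 * κ ^ 2 + 2097152) * h1
  · linear_combination (-256 * a ^ 2 * κ ^ 2 - 4096) * h1
  · ring

/-- The equation of `u` and, with `-I` for `I`, the equation of `v`. -/
theorem riccati_of_system {J r κ t Z R S : ℂ} (hJ : J ^ 2 = -1) (hr : r ^ 2 = 3)
    (h1 : R * S = 4 * Z ^ 2 + 3 / 4 * κ ^ 2) (h2 : R ^ 2 * S = S + 4 * (κ * Z + 2 * t)) :
    ((1 + R ^ 2) * S / 8 * R + Z * (Z + κ / 2 * R - Z * R ^ 2)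
      + J * (r * ((1 + R ^ 2) * S / 8) - r * κ / 4 * (Z + κ / 2 * R - Z * R ^ 2))) / 2
    = -(((Z * R - 5 / 4 * κ + J * (r * Z - r * κ / 4 * R)) / 2) ^ 2 - J * r / 4 * S
      + (-7 / 16 * κ ^ 2 - J * (3 / 2 * r * t))) := by
  linear_combination (1 / 16 * (1 + R ^ 2) - J * r / 8 * R) * h1 + 3 / 16 * J * r * h2
    + (r * Z - r * κ / 4 * R) ^ 2 / 4 * hJ - (Z - κ / 4 * R) ^ 2 / 4 * hr

/-- Parameters `α, β > 0` for which `(1 - α x²)(1 + β x²)` is the polynomial of the system. -/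
theorem exists_jacobi_parameters {κ t : ℝ} (h : κ ≠ 0 ∨ t ≠ 0) :
    ∃ α β : ℝ, 0 < α ∧ 0 < β ∧ α - β = κ ^ 2 / 8 ∧ α * β = t ^ 2 / 4 + 3 * κ ^ 4 / 256 := by
  have hP : 0 < t ^ 2 / 4 + 3 * κ ^ 4 / 256 := by
    rcases h with h | h <;> positivity
  set P := t ^ 2 / 4 + 3 * κ ^ 4 / 256
  set s := κ ^ 2 / 16 with hs
  set r := √(s ^ 2 + P) with hr
  have hr2 : r ^ 2 = s ^ 2 + P := Real.sq_sqrt (by positivity)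
  have hs0 : 0 ≤ s := by positivity
  have hsr : s < r := by
    rw [hr]
    exact Real.lt_sqrt_of_sq_lt (by linarith)
  exact ⟨r + s, r - s, by linarith, by linarith, by rw [hs]; ring, by linear_combination hr2⟩

namespace ReducedParams

variable {Q : ReducedParams}

/-- Under the constraints, the reduced system has an elliptic solution, rational in a Jacobian
elliptic function and its derivative. -/
theorem exists_isWave (hd : Q.d = 0) (he : Q.e.re = 0) (hG : Q.G.re = -7 / 16 * Q.κ ^ 2)
    (hne : Q.κ ≠ 0 ∨ Q.G.im ≠ 0) :
    ∃ u v M, Q.IsWave u v M ∧ IsNondegenerateElliptic M := by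
  set ε := Q.e.im with hε
  have hε0 : (ε : ℂ) ≠ 0 := by exact_mod_cast Q.he
  have hr2 : √3 ^ 2 = 3 := Real.sq_sqrt (by norm_num)
  have hr0 : √3 ≠ 0 := by simp
  set t : ℝ := -2 * Q.G.im / (3 * √3) with ht
  have hτ : Q.G.im = -(3 / 2 * √3 * t) := by
    rw [ht]
    field_simp
  have heI : Q.e = I * ε := by
    rw [Complex.ext_iff]
    simp [he, hε]
  have heI' : Q.e' = -I * ε := by
    rw [e', Complex.ext_iff]
    simp [he, hε]
  have hGI : Q.G = -7 / 16 * (Q.κ : ℂ) ^ 2 - I * (3 / 2 * (√3 : ℝ) * t) := by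
    rw [← re_add_im Q.G, hG, hτ]
    push_cast
    ring
  have hGI' : Q.G' = -7 / 16 * (Q.κ : ℂ) ^ 2 - -I * (3 / 2 * (√3 : ℝ) * t) := by
    rw [G', hGI]
    simp [map_ofNat]
  have hd' : Q.d' = 0 := by simp [d', hd]
  obtain ⟨α, β, hα, hβ, h1, h2⟩ := exists_jacobi_parameters (κ := Q.κ) (t := t) (by
    refine hne.imp id fun h => ?_
    rintro h0
    rw [hτ, h0] at h
    simp at h)
  obtain ⟨g, hg, L, hL⟩ := exists_isJacobi_periods hα hβ
  have h1' : (α : ℂ) - β = (Q.κ : ℂ) ^ 2 / 8 := by exact_mod_cast h1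
  have h2' : (α : ℂ) * β = (t : ℂ) ^ 2 / 4 + 3 * (Q.κ : ℂ) ^ 4 / 256 := by exact_mod_cast h2
  set κ : ℂ := (Q.κ : ℂ) with hκ
  set W : ℂ → ℂ := fun z =>
    2 / g z - (16 * t * g z - 8 * κ * deriv g z) / (16 + κ ^ 2 * g z ^ 2) with hW
  set V : ℂ → ℂ := fun z =>
    2 / g z + (16 * t * g z - 8 * κ * deriv g z) / (16 + κ ^ 2 * g z ^ 2) with hV
  set Z : ℂ → ℂ := fun z =>
    -(16 * deriv g z + 2 * κ * t * g z ^ 3) / (g z * (16 + κ ^ 2 * g z ^ 2)) with hZ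
  have hm := hg.meromorphic
  have hm' := hm.deriv
  have mW : Meromorphic W := fun z => by
    have := hm z
    have := hm' z
    fun_prop
  have mV : Meromorphic V := fun z => by
    have := hm z
    have := hm' z
    fun_prop
  have mZ : Meromorphic Z := fun z => by
    have := hm z
    have := hm' z
    fun_prop
  obtain ⟨g₀, hg₀, hgg₀⟩ := hg.exists_germ
  -- `W` has a simple pole at the origin
  have tW : Tendsto (fun z => z * W z) (𝓝[≠] 0) (𝓝 2) := by
    have c0 := hg₀.analyticAt.continuousAt.tendsto
    have c1 := hg₀.analyticAt.deriv.continuousAt.tendsto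
    rw [hg₀.zero] at c0
    obtain ⟨k, hk, hgk⟩ := exists_eq_sub_mul hg₀.analyticAt hg₀.zero
    have hk0 : k 0 = 1 := by
      have e1 : HasDerivAt (fun z => (z - 0) * k z) (1 * k 0 + (0 - 0) * deriv k 0) 0 :=
        ((hasDerivAt_id (0 : ℂ)).sub_const 0).mul hk.differentiableAt.hasDerivAt
      rw [← funext hgk] at e1
      have e2 := e1.deriv
      rw [hg₀.deriv_zero] at e2
      linear_combination -e2
    have c2 := hk.continuousAt.tendsto
    rw [hk0] at c2
    have key : Tendsto (fun z => 2 / k z - z * ((16 * t * g₀ z - 8 * κ * deriv g₀ z)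
        / (16 + κ ^ 2 * g₀ z ^ 2))) (𝓝 0) (𝓝 (2 / 1 - 0 * ((16 * t * 0 - 8 * κ * deriv g₀ 0)
        / (16 + κ ^ 2 * 0 ^ 2)))) :=
      (tendsto_const_nhds.div c2 one_ne_zero).sub (tendsto_id.mul
        (((c0.const_mul _).sub (c1.const_mul _)).div (((c0.pow 2).const_mul _).const_add _)
          (by norm_num)))
    have key' := key.mono_left (nhdsWithin_le_nhds (s := {0}ᶜ))
    rw [zero_mul, sub_zero, div_one] at key'
    refine key'.congr' ?_
    filter_upwards [eventually_nhdsNE_nhds hgg₀, self_mem_nhdsWithin] with z h3 h4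
    have hz : z ≠ 0 := h4
    rw [hW]
    simp only
    rw [EventuallyEq.deriv_eq h3, h3.self_of_nhds, mul_sub]
    congr 1
    rw [hgk, sub_zero]
    field_simp
  have hWne : ∀ a : ℂ, ¬ W =ᶠ[codiscrete ℂ] fun _ => a := by
    intro a ha
    have e1 : Tendsto (fun z => z * W z) (𝓝[≠] 0) (𝓝 (0 * a)) := by
      have e2 : Tendsto (fun z : ℂ => z * a) (𝓝[≠] 0) (𝓝 (0 * a)) :=
        (tendsto_id.mul_const a).mono_left nhdsWithin_le_nhds
      refine e2.congr' ?_
      filter_upwards [nhdsNE_of_codiscrete ha 0] with z hz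
      rw [hz]
    have := tendsto_nhds_unique tW e1
    simp at this
  have hgne : ∀ a : ℂ, ¬ g =ᶠ[codiscrete ℂ] fun _ => a := by
    intro a ha
    have e1 := deriv_congr_codiscrete ha
    refine hWne (2 / a - (16 * t * a - 8 * κ * 0) / (16 + κ ^ 2 * a ^ 2)) ?_
    filter_upwards [ha, e1] with z h3 h4
    rw [hW]
    simp only
    rw [h3, h4, deriv_const]
  have gne : ∀ a : ℂ, ∀ᶠ z in codiscrete ℂ, g z ≠ a := fun a =>
    eventually_ne_codiscrete hm (Meromorphic.const a) (hgne a)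
  have hsys : ∀ᶠ z in codiscrete ℂ, IsSystemAt κ t W V Z z := by
    have hD : ∀ᶠ z in codiscrete ℂ, 16 + κ ^ 2 * g z ^ 2 ≠ 0 := by
      filter_upwards [gne (4 * I / κ), gne (-(4 * I / κ))] with z h3 h4 h5
      by_cases hκ0 : κ = 0
      · norm_num [hκ0] at h5
      · have h6 : (κ * g z - 4 * I) * (κ * g z + 4 * I) = 0 := by
          linear_combination h5 - 16 * I_sq
        rcases mul_eq_zero.1 h6 with h7 | h7
        · exact h3 (by field_simp; linear_combination h7)
        · exact h4 (by field_simp; linear_combination h7)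
    filter_upwards [eventually_analyticAt_codiscrete hm, gne 0, hD, hg.first_order,
      hg.second_order] with z h3 h4 h5 h6 h7
    refine isSystemAt_of_jacobi h3 h4 h5 ?_ ?_
    · rw [h6]
      linear_combination -g z ^ 2 * h1' - g z ^ 4 * h2'
    · rw [h7]
      linear_combination -g z * h1' - 2 * g z ^ 3 * h2'
  have hW0 : ∀ᶠ z in codiscrete ℂ, W z ≠ 0 :=
    eventually_ne_codiscrete mW (Meromorphic.const 0) (hWne 0)
  -- `M = c W` and, with `R = V / W`,
  -- `u + v = Z R - 5/4 κ`, `(u - v) / i = √3 (Z - κ/4 R)`; `u` and `v` correspond to `J = ± i` below.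
  obtain ⟨c, hc⟩ : ∃ c : ℂ, c ^ 2 = -(√3 : ℝ) / (4 * ε) :=
    ⟨(-(√3 : ℝ) / (4 * ε) : ℂ) ^ (1 / 2 : ℂ), by
      rw [← cpow_nat_mul]
      norm_num⟩
  have hc0 : c ≠ 0 := by
    rintro rfl
    have h3 : ((√3 : ℝ) : ℂ) ≠ 0 := by simp
    rw [zero_pow two_ne_zero, eq_comm, div_eq_zero_iff, neg_eq_zero] at hc
    exact hc.elim h3 (mul_ne_zero (by norm_num) hε0)
  have hcε : ε * c ^ 2 = -((√3 : ℝ) : ℂ) / 4 := by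
    rw [hc]
    field_simp
  have hr2' : ((√3 : ℝ) : ℂ) ^ 2 = 3 := by exact_mod_cast hr2
  set r : ℂ := ((√3 : ℝ) : ℂ)
  let R : ℂ → ℂ := fun z => V z / W z
  let f : ℂ → ℂ → ℂ := fun J z =>
    (Z z * R z - 5 / 4 * κ + J * (r * Z z - r * κ / 4 * R z)) / 2
  have mf : ∀ J, Meromorphic (f J) := fun J z => by
    have := mV z
    have := mW z
    have := mZ z
    fun_prop
  have hf : ∀ J : ℂ, J ^ 2 = -1 → ∀ᶠ z in codiscrete ℂ, deriv (f J) z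
      = -(f J z ^ 2 - J * r / 4 * W z ^ 2 + (-7 / 16 * κ ^ 2 - J * (3 / 2 * r * t))) := by
    intro J hJ
    filter_upwards [hsys, hW0] with z h3 h4
    have dR : HasDerivAt R (Z z + κ / 2 * R z - Z z * R z ^ 2) z := by
      refine (h3.hasDerivAt_V.fun_div h3.hasDerivAt_W h4).congr_deriv ?_
      simp only [R]
      field_simp
      ring
    have dZ : HasDerivAt Z ((1 + R z ^ 2) * W z ^ 2 / 8) z := by
      refine h3.hasDerivAt_Z.congr_deriv ?_
      simp only [R]
      field_simp
    have dF := ((((dZ.fun_mul dR).sub_const (5 / 4 * κ)).fun_add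
      (((dZ.const_mul r).fun_sub (dR.const_mul (r * κ / 4))).const_mul J)).div_const 2)
    rw [dF.deriv]
    have e1 : R z * W z ^ 2 = 4 * Z z ^ 2 + 3 / 4 * κ ^ 2 := by
      rw [← h3.mul_eq]
      simp only [R]
      field_simp
    have e2 : R z ^ 2 * W z ^ 2 = W z ^ 2 + 4 * (κ * Z z + 2 * t) := by
      rw [← h3.sq_eq]
      simp only [R]
      field_simp
    exact riccati_of_system hJ hr2' e1 e2
  refine ⟨f I, f (-I), fun z => c * W z, ⟨mf I, mf (-I), fun z => ?_, fun h0 => ?_, ?_, ?_, ?_⟩,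
    fun z => ?_, ⟨L, ?_⟩, ?_⟩
  · exact (MeromorphicAt.const _ _).fun_mul (mW z)
  · refine hWne 0 (h0.mono fun z hz => ?_)
    exact (mul_eq_zero.1 hz).resolve_left hc0
  · filter_upwards [hf I I_sq] with z hz
    rw [hz, hd, heI, hGI]
    linear_combination I * W z ^ 2 * hcε
  · filter_upwards [hf (-I) (by simp)] with z hz
    rw [hz, hd', heI', hGI']
    linear_combination -I * W z ^ 2 * hcε
  · filter_upwards [hsys, hW0] with z h3 h4
    rw [deriv_const_mul_field, h3.hasDerivAt_W.deriv]
    simp only [f, R]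
    field_simp
    ring
  · exact (MeromorphicAt.const _ _).fun_mul (mW z)
  · intro l hl
    filter_upwards [hL l hl, hL.deriv l hl] with z h3 h4
    rw [hW]
    simp only
    rw [h3, h4]
  · rintro ⟨a, ha⟩
    refine hWne (a / c) (ha.mono fun z hz => ?_)
    exact (eq_div_iff hc0).2 ((mul_comm _ _).trans hz)

end ReducedParams

/-! ### From the travelling wave system to the reduced system -/

namespace Params

variable (P : Params)

/-- The parameters of the reduced system obeyed by `u = ψ - k`, `v = M'/M - ψ - k̄` and `M`, where
`k = i c / (2 p)`: this translation removes the terms of first degree in `ψ`. -/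
noncomputable def reduced : ReducedParams where
  d := P.q / P.p
  e := P.r / P.p
  G := (P.ω - I * P.γ) / P.p + (P.c / P.p) ^ 2 / 4
  κ := P.c * P.si
  he := P.him

/-- The constant `k = i c / (2 p)` by which `ψ` is translated. -/
noncomputable def shift : ℂ := I * P.c / P.p / 2

theorem one_div_p : 1 / P.p = P.sr - I * P.si := by
  apply Complex.ext <;> simp [sr, si]

theorem shift_eq : P.shift = I * (P.c * P.sr / 2) + P.c * P.si / 2 := by
  have h1 : P.shift = I * P.c * (1 / P.p) / 2 := by
    rw [shift]
    ring
  rw [h1, one_div_p]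
  linear_combination -(P.c * P.si / 2 : ℂ) * I_sq

theorem shift_add_conj : P.shift + starRingEnd ℂ P.shift = (P.reduced.κ : ℂ) := by
  rw [shift_eq]
  simp only [map_add, map_mul, conj_I, conj_ofReal, map_div₀, reduced, ofReal_mul, map_ofNat]
  ring

theorem conj_shift : starRingEnd ℂ P.shift = -(I * P.c / starRingEnd ℂ P.p / 2) := by
  simp only [shift, map_mul, conj_I, conj_ofReal, map_div₀, map_ofNat]
  ring

theorem conj_p_ne_zero : starRingEnd ℂ P.p ≠ 0 := by
  simpa using P.hp

theorem reduced_d' : P.reduced.d' = starRingEnd ℂ P.q / starRingEnd ℂ P.p := by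
  simp [reduced, ReducedParams.d']

theorem reduced_e' : P.reduced.e' = starRingEnd ℂ P.r / starRingEnd ℂ P.p := by
  simp [reduced, ReducedParams.e']

theorem reduced_G' : P.reduced.G'
    = (P.ω + I * P.γ) / starRingEnd ℂ P.p + (P.c / starRingEnd ℂ P.p) ^ 2 / 4 := by
  simp [reduced, ReducedParams.G', Complex.conj_ofNat]

theorem residueM_eq : P.residueM = P.reduced.poleResidue := rfl

variable {P}

/-- The companion `M'/M - ψ - k̄` of `ψ - k`, expressed by `κ = k + k̄`. -/
noncomputable def companion (P : Params) (ψ M : ℂ → ℂ) (z : ℂ) : ℂ :=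
  deriv M z / M z - P.reduced.κ - (ψ z - P.shift)

theorem deriv_companion {ψ M : ℂ → ℂ} {z : ℂ} (hψ : AnalyticAt ℂ ψ z) (hM : AnalyticAt ℂ M z)
    (h : M z ≠ 0) : deriv (companion P ψ M) z
      = (deriv (deriv M) z * M z - deriv M z ^ 2) / M z ^ 2 - deriv ψ z := by
  have h1 := (hM.deriv.differentiableAt.hasDerivAt.fun_div hM.differentiableAt.hasDerivAt h)
  have h2 := (h1.sub_const (P.reduced.κ : ℂ)).fun_sub
    (hψ.differentiableAt.hasDerivAt.sub_const P.shift)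
  exact h2.deriv.trans (by ring)

/-- The first equation of the system, in terms of `ψ - k`. -/
theorem eq_iff_reduced (D ψ m : ℂ) :
    P.p * (D + ψ ^ 2) + P.q * m + P.r * m ^ 2 - I * P.c * ψ + P.ω - I * P.γ = 0 ↔
      D = -((ψ - P.shift) ^ 2 + P.reduced.d * m + P.reduced.e * m ^ 2 + P.reduced.G) := by
  have hp := P.hp
  have key : D + ((ψ - P.shift) ^ 2 + P.reduced.d * m + P.reduced.e * m ^ 2 + P.reduced.G)
      = (P.p * (D + ψ ^ 2) + P.q * m + P.r * m ^ 2 - I * P.c * ψ + P.ω - I * P.γ) / P.p := by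
    simp only [reduced, shift]
    field_simp
    linear_combination 4 * (P.c : ℂ) ^ 2 * I_sq
  rw [eq_neg_iff_add_eq_zero, key, div_eq_zero_iff, or_iff_left hp]

/-- The second equation of the system, in terms of the companion of `ψ - k`. -/
theorem eq_conj_iff_reduced {D D₁ D₂ ψ m : ℂ} (hm : m ≠ 0) :
    (starRingEnd ℂ P.p) * (D₂ - 2 * ψ * D₁ - D * m + ψ ^ 2 * m)
      + ((starRingEnd ℂ P.q) * m + (starRingEnd ℂ P.r) * m ^ 2) * m
      + I * P.c * (D₁ - ψ * m) + (P.ω + I * P.γ) * m = 0 ↔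
    (D₂ * m - D₁ ^ 2) / m ^ 2 - D = -((D₁ / m - P.reduced.κ - (ψ - P.shift)) ^ 2
      + P.reduced.d' * m + P.reduced.e' * m ^ 2 + P.reduced.G') := by
  have hp := P.conj_p_ne_zero
  have h1 : D₁ / m - P.reduced.κ - (ψ - P.shift)
      = D₁ / m - ψ + I * P.c / starRingEnd ℂ P.p / 2 := by
    rw [← shift_add_conj, conj_shift]
    ring
  have key : (D₂ * m - D₁ ^ 2) / m ^ 2 - D + ((D₁ / m - P.reduced.κ - (ψ - P.shift)) ^ 2
      + P.reduced.d' * m + P.reduced.e' * m ^ 2 + P.reduced.G')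
      = ((starRingEnd ℂ P.p) * (D₂ - 2 * ψ * D₁ - D * m + ψ ^ 2 * m)
      + ((starRingEnd ℂ P.q) * m + (starRingEnd ℂ P.r) * m ^ 2) * m
      + I * P.c * (D₁ - ψ * m) + (P.ω + I * P.γ) * m) / (starRingEnd ℂ P.p * m) := by
    rw [h1, reduced_d', reduced_e', reduced_G']
    field_simp
    linear_combination 4 * (P.c : ℂ) ^ 2 * m ^ 2 * I_sq
  rw [eq_neg_iff_add_eq_zero, key, div_eq_zero_iff, or_iff_left (mul_ne_zero hp hm)]

/-- The system for `(ψ, M)` implies the reduced system. -/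
theorem IsMeromorphicWave.isWave {ψ M : ℂ → ℂ} (h : P.IsMeromorphicWave ψ M) :
    P.reduced.IsWave (fun z => ψ z - P.shift) (companion P ψ M) M where
  meromorphic_u := h.meromorphic_ψ.sub fun z => MeromorphicAt.const _ _
  meromorphic_v := ((h.meromorphic_M.deriv.div h.meromorphic_M).sub
    fun z => MeromorphicAt.const _ _).sub (h.meromorphic_ψ.sub fun z => MeromorphicAt.const _ _)
  meromorphic_M := h.meromorphic_M
  ne_zero := h.ne_zero
  eq_u := by
    filter_upwards [h.eq] with z hz
    rw [deriv_sub_const]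
    exact (eq_iff_reduced _ _ _).1 hz
  eq_v := by
    filter_upwards [h.eq_conj, eventually_analyticAt_codiscrete h.meromorphic_ψ,
      eventually_analyticAt_codiscrete h.meromorphic_M, eventually_ne_codiscrete h.meromorphic_M
        (fun z => MeromorphicAt.const 0 _) h.ne_zero] with z hz h1 h2 h3
    rw [deriv_companion h1 h2 h3]
    exact (eq_conj_iff_reduced h3).1 hz
  eq_M := by
    filter_upwards [eventually_ne_codiscrete h.meromorphic_M
        (fun z => MeromorphicAt.const 0 _) h.ne_zero] with z h3
    simp only [companion]
    field_simp
    ring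

/-- Conversely, solutions of the reduced system yield meromorphic waves. -/
theorem _root_.CGL5.ReducedParams.IsWave.isMeromorphicWave {u v M : ℂ → ℂ}
    (h : P.reduced.IsWave u v M) : P.IsMeromorphicWave (fun z => u z + P.shift) M where
  meromorphic_ψ := h.meromorphic_u.add fun z => MeromorphicAt.const _ _
  meromorphic_M := h.meromorphic_M
  ne_zero := h.ne_zero
  eq := by
    filter_upwards [h.eq_u] with z hz
    refine (eq_iff_reduced _ _ _).2 ?_
    rw [deriv_add_const, hz, add_sub_cancel_right]
  eq_conj := by
    have hM := eventually_ne_codiscrete h.meromorphic_M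
      (fun z => MeromorphicAt.const 0 _) h.ne_zero
    have hv : v =ᶠ[codiscrete ℂ] companion P (fun z => u z + P.shift) M := by
      filter_upwards [hM, h.eq_M] with z h3 h4
      simp only [companion, h4]
      field_simp
      ring
    filter_upwards [h.eq_v, hv, deriv_congr_codiscrete hv,
      eventually_analyticAt_codiscrete h.meromorphic_u,
      eventually_analyticAt_codiscrete h.meromorphic_M, hM] with z hz h1 h2 h3 h4 h5
    refine (eq_conj_iff_reduced h5).2 ?_
    rw [h1, h2, deriv_companion (ψ := fun z => u z + P.shift) (h3.fun_add analyticAt_const) h4 h5]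
      at hz
    exact hz

end Params

theorem HasPeriods.add_const {f : ℂ → ℂ} {L : PeriodPair} (h : HasPeriods f L) (a : ℂ) :
    HasPeriods (fun z => f z + a) L := by
  intro l hl
  filter_upwards [h l hl] with z hz
  rw [hz]

theorem IsNondegenerateElliptic.add_const {f : ℂ → ℂ} (h : IsNondegenerateElliptic f) (a : ℂ) :
    IsNondegenerateElliptic fun z => f z + a := by
  obtain ⟨h1, ⟨L, h2⟩, h3⟩ := h
  refine ⟨h1.add fun z => MeromorphicAt.const _ _, ⟨L, h2.add_const a⟩, ?_⟩
  rintro ⟨b, hb⟩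
  refine h3 ⟨b - a, hb.mono fun z hz => ?_⟩
  exact eq_sub_of_add_eq hz

theorem meromorphicOrderAt_add_const_neg_iff {f : ℂ → ℂ} {z : ℂ} (hf : MeromorphicAt f z) (a : ℂ) :
    meromorphicOrderAt (fun z => f z + a) z < 0 ↔ meromorphicOrderAt f z < 0 := by
  have key : ∀ (g : ℂ → ℂ) (b : ℂ), MeromorphicAt g z → 0 ≤ meromorphicOrderAt g z →
      0 ≤ meromorphicOrderAt (fun z => g z + b) z := by
    intro g b hg h
    obtain ⟨g₁, h1, h2⟩ := exists_analyticAt_of_order_nonneg hg h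
    refine order_nonneg_of_eventuallyEq (h1.add (analyticAt_const (v := b))) ?_
    filter_upwards [h2] with x hx
    simp [hx]
  rw [← not_le, ← not_le, not_iff_not]
  refine ⟨fun h => ?_, key f a hf⟩
  simpa using key _ (-a) (hf.fun_add (MeromorphicAt.const a z)) h

theorem HasSimplePoles.add_const {n : ℕ} {f : ℂ → ℂ} {L : PeriodPair} {x ρ : Fin n → ℂ}
    (h : HasSimplePoles f L x ρ) (hf : Meromorphic f) (a : ℂ) :
    HasSimplePoles (fun z => f z + a) L x ρ := by
  obtain ⟨h1, h2, h3, h4⟩ := h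
  refine ⟨h1.add_const a, h2, fun z => ?_, fun k => ?_⟩
  · rw [meromorphicOrderAt_add_const_neg_iff (hf z), h3]
  · have h5 : Tendsto (fun z => (z - x k) * a) (𝓝[≠] (x k)) (𝓝 0) := by
      have h6 : Tendsto (fun z => (z - x k) * a) (𝓝 (x k)) (𝓝 ((x k - x k) * a)) :=
        Continuous.tendsto (by fun_prop) _
      rw [sub_self, zero_mul] at h6
      exact h6.mono_left nhdsWithin_le_nhds
    simpa [mul_add] using (h4 k).add h5

namespace Params

variable {P : Params}

theorem IsEllipticWave.exists_isLatticeWave {ψ M : ℂ → ℂ} (h : P.IsEllipticWave ψ M) :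
    ∃ v L y, P.reduced.IsLatticeWave (fun z => ψ z - P.shift) v M L y := by
  obtain ⟨h1, h2⟩ := h
  refine ⟨_, h1.isWave.exists_isLatticeWave (h2.imp_left fun h3 => ?_)⟩
  simpa [sub_eq_add_neg] using h3.add_const (-P.shift)

theorem constraints_iff : P.Constraints ↔ P.reduced.d = 0 ∧ P.reduced.e.re = 0 ∧
    P.reduced.G.re = -7 / 16 * P.reduced.κ ^ 2 := by
  have h1 : P.reduced.d = 0 ↔ P.q = 0 := by
    simp [reduced, P.hp]
  have h2 : ((P.γ + I * P.ω) / P.p).im = ((P.ω - I * P.γ) / P.p).re := by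
    have : (P.γ + I * P.ω) / P.p = I * ((P.ω - I * P.γ) / P.p) := by
      linear_combination (P.γ / P.p : ℂ) * I_sq
    rw [this, I_mul_im]
  have h3 : (((P.c : ℂ) / P.p) ^ 2 / 4).re = ((P.c * P.sr) ^ 2 - (P.c * P.si) ^ 2) / 4 := by
    have h4 : ((P.c : ℂ) / P.p) ^ 2 / 4
        = ((((P.c * P.sr) ^ 2 - (P.c * P.si) ^ 2) / 4 : ℝ) : ℂ)
          + I * ((-(P.c ^ 2 * P.sr * P.si) / 2 : ℝ) : ℂ) := by
      rw [div_eq_mul_one_div (P.c : ℂ) P.p, one_div_p]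
      push_cast
      linear_combination ((P.c * P.si) ^ 2 / 4 : ℂ) * I_sq
    rw [h4, add_re, ofReal_re, I_mul_re, ofReal_im]
    ring
  have h5 : P.reduced.G.re = ((P.ω - I * P.γ) / P.p).re
      + ((P.c * P.sr) ^ 2 - (P.c * P.si) ^ 2) / 4 := by
    rw [← h3]
    rfl
  have h6 : P.reduced.κ = P.c * P.si := rfl
  rw [Constraints, h1, h2, h5, h6]
  refine and_congr_right fun _ => and_congr_right fun _ => ?_
  constructor <;> intro h <;> linarith

/-- Since `γ ≠ 0`, the reduced system is not the degenerate one with `κ = 0` and `G = 0`, in which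
the elliptic functions of the existence proof would degenerate to rational ones. -/
theorem κ_ne_zero_or (h : P.reduced.G.re = -7 / 16 * P.reduced.κ ^ 2) :
    P.reduced.κ ≠ 0 ∨ P.reduced.G.im ≠ 0 := by
  by_contra! hc
  obtain ⟨h1, h2⟩ := hc
  -- then `ω - i γ = -c² / (4 p)`, whose imaginary part vanishes as `c s_i = 0`
  have hG : P.reduced.G = 0 := by
    apply Complex.ext
    · rw [h, h1]
      simp
    · simpa using h2
  have h3 : (P.c : ℂ) * P.si = 0 := by
    have h4 : P.c * P.si = 0 := h1
    exact_mod_cast h4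
  have hp := P.hp
  have h6 : (P.ω - I * P.γ) + P.c ^ 2 * (1 / P.p) / 4 = P.p * P.reduced.G := by
    simp only [reduced]
    field_simp
  rw [hG, one_div_p, mul_zero] at h6
  have h7 : ((P.ω + P.c ^ 2 * P.sr / 4 : ℝ) : ℂ) + I * ((-P.γ : ℝ) : ℂ) = 0 := by
    push_cast
    linear_combination h6 + I * P.c / 4 * h3
  have h8 := congrArg Complex.im h7
  rw [add_im, ofReal_im, I_mul_im, ofReal_re, zero_im] at h8
  exact P.hγ (by linarith)

theorem exists_isEllipticWave_iff : (∃ ψ M : ℂ → ℂ, P.IsEllipticWave ψ M) ↔ P.Constraints := by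
  rw [constraints_iff]
  constructor
  · rintro ⟨ψ, M, h⟩
    obtain ⟨v, L, y, h1⟩ := h.exists_isLatticeWave
    refine ⟨h1.d_eq_zero, h1.re_e, ?_⟩
    have h2 := congrArg Complex.re h1.G_add_G'
    have h3 : (-7 / 8 * (P.reduced.κ : ℂ) ^ 2) = ((-7 / 8 * P.reduced.κ ^ 2 : ℝ) : ℂ) := by
      push_cast
      ring
    rw [h3, ofReal_re, add_re, ReducedParams.G', conj_re] at h2
    linarith
  · rintro ⟨h1, h2, h3⟩
    obtain ⟨u, v, M, h4, h5⟩ := P.reduced.exists_isWave h1 h2 h3 (κ_ne_zero_or h3)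
    exact ⟨_, M, h4.isMeromorphicWave, .inr h5⟩

/-- Any two elliptic waves have poles of `M` with the same residue, and these determine them. -/
theorem IsEllipticWave.eq_translate {ψ₁ M₁ ψ₂ M₂ : ℂ → ℂ} (h₁ : P.IsEllipticWave ψ₁ M₁)
    (h₂ : P.IsEllipticWave ψ₂ M₂) : ∃ τ : ℂ,
      (ψ₂ =ᶠ[codiscrete ℂ] fun ξ => ψ₁ (τ + ξ)) ∧ M₂ =ᶠ[codiscrete ℂ] fun ξ => M₁ (τ + ξ) := by
  obtain ⟨v₁, L₁, y₁, h1⟩ := h₁.exists_isLatticeWave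
  obtain ⟨v₂, L₂, y₂, h2⟩ := h₂.exists_isLatticeWave
  obtain ⟨h3, -, h4⟩ := h2.wave.eq_comp_add h1.wave (z₁ := y₂ 0) (z₂ := y₁ 0)
    (by rw [h2.residue_y]; exact ReducedParams.poleResidue_ne_zero 0)
    (by rw [h1.residue_y, h2.residue_y])
  refine ⟨y₁ 0 - y₂ 0, ?_, ?_⟩
  · filter_upwards [h3] with z hz
    rw [add_comm]
    exact sub_left_inj.1 hz
  · filter_upwards [h4] with z hz
    rw [add_comm]
    exact hz

/-- The origin of the closed form is the pole of residue `1` of `ψ`. -/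
theorem IsEllipticWave.closed_form {ψ M : ℂ → ℂ} (h : P.IsEllipticWave ψ M) :
    ∃ (ξ₀ : ℂ) (Lψ LM : PeriodPair) (x : Fin 3 → ℂ) (y : Fin 4 → ℂ),
      x 0 = 0 ∧ (∀ k, y k ∉ LM.lattice) ∧
      HasSimplePoles (fun ξ => ψ (ξ₀ + ξ)) Lψ x residueψ ∧
      HasSimplePoles (fun ξ => M (ξ₀ + ξ)) LM y P.residueM ∧
      (∀ᶠ ξ in codiscrete ℂ, ψ (ξ₀ + ξ) - I * (P.c * P.sr / 2) =
        P.c * P.si / 2 + weierstrassZeta Lψ ξ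
          + ∑ k ∈ ({1, 2} : Finset (Fin 3)), residueψ k *
              (weierstrassZeta Lψ (ξ - x k) + weierstrassZeta Lψ (x k))) ∧
      ∀ᶠ ξ in codiscrete ℂ, M (ξ₀ + ξ) = ∑ k : Fin 4, P.residueM k *
        (weierstrassZeta LM (ξ - y k) + weierstrassZeta LM (y k)) := by
  obtain ⟨v, L, y, h1⟩ := h.exists_isLatticeWave
  obtain ⟨ξ₀, h2, h3⟩ := h1.exists_pole_of_residue_one
  obtain ⟨Lu, x, h4, h5, h6, h7, h8, h9⟩ := (h1.comp_add ξ₀).closed_form_of_residue_zero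
    (by rw [residue_comp_add, zero_add, h2])
    (by rw [residue_comp_add (fun z => ψ z - P.shift), zero_add, h3])
  refine ⟨ξ₀, Lu, L, x, fun k => y k - ξ₀, h4, h5, ?_, ?_, ?_, ?_⟩
  · have h10 := h6.add_const (h1.comp_add ξ₀).wave.meromorphic_u P.shift
    simpa only [sub_add_cancel, add_comm _ ξ₀] using h10
  · simpa only [residueM_eq, add_comm _ ξ₀] using h7
  · filter_upwards [h8] with z hz
    rw [shift_eq] at hz
    rw [add_comm ξ₀ z]
    linear_combination hz
  · filter_upwards [h9] with z hz
    rw [add_comm ξ₀ z]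
    exact hz

end Params

/-! ### Travelling waves of the partial differential equation -/

theorem tendsto_ofReal_nhdsNE (x : ℝ) :
    Tendsto (fun y : ℝ => (y : ℂ)) (𝓝[≠] x) (𝓝[≠] (x : ℂ)) := by
  refine tendsto_nhdsWithin_iff.2 ⟨?_, ?_⟩
  · exact continuous_ofReal.continuousAt.tendsto.mono_left nhdsWithin_le_nhds
  · filter_upwards [self_mem_nhdsWithin] with y hy
    exact fun h => hy (ofReal_injective h)

/-- A meromorphic function vanishing on a real interval is zero. -/
theorem eventuallyEq_zero_of_real {F : ℂ → ℂ} (hF : Meromorphic F) (x : ℝ)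
    (h : ∀ᶠ y : ℝ in 𝓝[≠] x, F y = 0) : ∀ᶠ z in codiscrete ℂ, F z = 0 :=
  eventuallyEq_codiscrete_of_frequently hF (fun z => MeromorphicAt.const 0 z)
    ((tendsto_ofReal_nhdsNE x).frequently h.frequently)

theorem deriv_eq_of_real {f : ℂ → ℂ} {g : ℝ → ℂ} {g' : ℂ} {x : ℝ} (hf : AnalyticAt ℂ f x)
    (h : ∀ᶠ y : ℝ in 𝓝 x, f y = g y) (hg : HasDerivAt g g' x) : deriv f x = g' :=
  (hf.differentiableAt.hasDerivAt.comp_ofReal.congr_of_eventuallyEq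
    (h.mono fun _ hy => hy.symm)).unique hg

namespace Params

variable {P : Params}

/-- The ordinary differential equation obeyed by the profile of a travelling wave. -/
theorem profile_equation {a : ℝ → ℂ} {ξ : ℝ} (ha : DifferentiableAt ℝ a ξ)
    (h : P.SolvesPDEAt (P.amplitude a) ξ 0) :
    P.p * deriv (deriv a) ξ - I * P.c * deriv a ξ + P.ω * a ξ
      + P.q * (‖a ξ‖ ^ 2 : ℝ) * a ξ + P.r * ((‖a ξ‖ ^ 2 : ℝ) : ℂ) ^ 2 * a ξ - I * P.γ * a ξ = 0 := by
  have h0 : ∀ y, P.amplitude a y 0 = a y := fun y => by simp [amplitude]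
  have h1 : deriv (fun s => P.amplitude a ξ s) 0 = -P.c * deriv a ξ - I * P.ω * a ξ := by
    have e1 : HasDerivAt (fun s : ℝ => ξ - P.c * s) (-P.c) 0 := by
      simpa using ((hasDerivAt_id (0 : ℝ)).const_mul P.c).const_sub ξ
    have e2 : HasDerivAt (fun s : ℝ => a (ξ - P.c * s)) ((-P.c) • deriv a ξ) 0 := by
      refine HasDerivAt.scomp (0 : ℝ) ?_ e1
      simpa using ha.hasDerivAt
    have e3 : HasDerivAt (fun s : ℝ => exp (-(I * P.ω * s))) (-(I * P.ω)) 0 := by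
      have e4 : HasDerivAt (fun s : ℂ => exp (-(I * P.ω * s))) (-(I * P.ω)) ((0 : ℝ) : ℂ) := by
        simpa using (((hasDerivAt_id (0 : ℂ)).const_mul (I * (P.ω : ℂ))).fun_neg).cexp
      exact e4.comp_ofReal
    rw [show (fun s => P.amplitude a ξ s)
      = fun s : ℝ => a (ξ - P.c * s) * exp (-(I * P.ω * s)) from rfl, (e2.fun_mul e3).deriv]
    simp
    ring
  have h2 : (fun y => P.amplitude a y 0) = a := funext h0
  rw [SolvesPDEAt, h1, h2, h0, iteratedDeriv_succ, iteratedDeriv_one] at h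
  push_cast at h ⊢
  linear_combination h + P.ω * a ξ * I_sq

/-- Travelling waves yield meromorphic waves: both equations hold on the real interval, the second
one being the complex conjugate of the first, and extend to `ℂ` by the identity theorem. -/
theorem isMeromorphicWave_of_travelling_wave {a : ℝ → ℂ} {α β : ℝ} {ψ M : ℂ → ℂ} (hαβ : α < β)
    (ha : ContDiffOn ℝ 2 a (Set.Ioo α β)) (ha0 : ∀ ξ ∈ Set.Ioo α β, a ξ ≠ 0)
    (hA : ∀ x t : ℝ, x - P.c * t ∈ Set.Ioo α β → P.SolvesPDEAt (P.amplitude a) x t)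
    (hψ : Meromorphic ψ) (hM : Meromorphic M)
    (h : ∀ ξ ∈ Set.Ioo α β,
      ψ (ξ : ℂ) = deriv a ξ / a ξ ∧ M (ξ : ℂ) = ((‖a ξ‖ ^ 2 : ℝ) : ℂ)) :
    P.IsMeromorphicWave ψ M := by
  obtain ⟨x₀, hx₀⟩ : (Set.Ioo α β).Nonempty := Set.nonempty_Ioo.2 hαβ
  have hnhds : ∀ ξ ∈ Set.Ioo α β, ∀ᶠ y in 𝓝 ξ, y ∈ Set.Ioo α β :=
    fun ξ hξ => Ioo_mem_nhds hξ.1 hξ.2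
  have d1 : ∀ ξ ∈ Set.Ioo α β, HasDerivAt a (deriv a ξ) ξ := fun ξ hξ =>
    ((ha.differentiableOn (by norm_num)).differentiableAt (hnhds ξ hξ)).hasDerivAt
  have d2 : ∀ ξ ∈ Set.Ioo α β, HasDerivAt (deriv a) (deriv (deriv a) ξ) ξ := fun ξ hξ =>
    (((ha.deriv_of_isOpen (m := 1) isOpen_Ioo (by norm_num)).differentiableOn
      (by norm_num)).differentiableAt (hnhds ξ hξ)).hasDerivAt
  have hm : ∀ ξ, ((‖a ξ‖ ^ 2 : ℝ) : ℂ) = a ξ * starRingEnd ℂ (a ξ) := fun ξ => by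
    rw [mul_conj, normSq_eq_norm_sq]
  have key : ∀ᶠ ξ : ℝ in 𝓝[≠] x₀, ξ ∈ Set.Ioo α β ∧ AnalyticAt ℂ ψ ξ ∧ AnalyticAt ℂ M ξ := by
    filter_upwards [(hnhds x₀ hx₀).filter_mono nhdsWithin_le_nhds,
      (tendsto_ofReal_nhdsNE x₀).eventually (hψ x₀).eventually_analyticAt,
      (tendsto_ofReal_nhdsNE x₀).eventually (hM x₀).eventually_analyticAt] with ξ h1 h2 h3
    exact ⟨h1, h2, h3⟩
  have hψ' : ∀ ξ : ℝ, ξ ∈ Set.Ioo α β → AnalyticAt ℂ ψ ξ →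
      deriv ψ ξ = (deriv (deriv a) ξ * a ξ - deriv a ξ * deriv a ξ) / a ξ ^ 2 :=
    fun ξ hξ h1 => deriv_eq_of_real h1 ((hnhds ξ hξ).mono fun y hy => (h y hy).1)
      ((d2 ξ hξ).fun_div (d1 ξ hξ) (ha0 ξ hξ))
  have hM' : ∀ ξ : ℝ, ξ ∈ Set.Ioo α β → AnalyticAt ℂ M ξ →
      deriv M ξ = deriv a ξ * starRingEnd ℂ (a ξ) + a ξ * starRingEnd ℂ (deriv a ξ) :=
    fun ξ hξ h1 => deriv_eq_of_real h1
      ((hnhds ξ hξ).mono fun y hy => (h y hy).2.trans (hm y)) ((d1 ξ hξ).fun_mul (d1 ξ hξ).star)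
  have hM'' : ∀ ξ : ℝ, ξ ∈ Set.Ioo α β → AnalyticAt ℂ M ξ →
      deriv (deriv M) ξ = (deriv (deriv a) ξ * starRingEnd ℂ (a ξ)
          + deriv a ξ * starRingEnd ℂ (deriv a ξ))
        + (deriv a ξ * starRingEnd ℂ (deriv a ξ)
          + a ξ * starRingEnd ℂ (deriv (deriv a) ξ)) := fun ξ hξ h1 => by
    refine deriv_eq_of_real h1.deriv ?_
      (((d2 ξ hξ).fun_mul (d1 ξ hξ).star).fun_add ((d1 ξ hξ).fun_mul (d2 ξ hξ).star))
    filter_upwards [hnhds ξ hξ,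
      continuous_ofReal.continuousAt.eventually h1.eventually_analyticAt] with y h2 h3
    exact hM' y h2 h3
  have ode : ∀ ξ ∈ Set.Ioo α β, P.p * deriv (deriv a) ξ - I * P.c * deriv a ξ + P.ω * a ξ
      + P.q * (‖a ξ‖ ^ 2 : ℝ) * a ξ + P.r * ((‖a ξ‖ ^ 2 : ℝ) : ℂ) ^ 2 * a ξ - I * P.γ * a ξ = 0 :=
    fun ξ hξ => profile_equation (d1 ξ hξ).differentiableAt (hA ξ 0 (by simpa using hξ))
  have mc : ∀ b : ℂ, Meromorphic fun _ : ℂ => b := fun b z => MeromorphicAt.const b z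
  have hψ2 : Meromorphic fun z => ψ z ^ 2 := fun z => (hψ z).fun_pow 2
  have hM2 : Meromorphic fun z => M z ^ 2 := fun z => (hM z).fun_pow 2
  refine ⟨hψ, hM, fun h0 => ?_, ?_, ?_⟩
  · obtain ⟨ξ, h1, h2⟩ := (((tendsto_ofReal_nhdsNE x₀).eventually
      (nhdsNE_of_codiscrete h0 x₀)).and key).exists
    rw [(h ξ h2.1).2] at h1
    have h3 := ha0 ξ h2.1
    simp [h3] at h1
  · refine eventuallyEq_zero_of_real (x := x₀) ?_ ?_
    · exact ((((((mc P.p).fun_mul (hψ.deriv.fun_add hψ2)).fun_add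
        ((mc P.q).fun_mul hM)).fun_add ((mc P.r).fun_mul hM2)).fun_sub
        ((mc (I * P.c)).fun_mul hψ)).fun_add (mc P.ω)).fun_sub (mc (I * P.γ))
    · filter_upwards [key] with ξ hξ
      have h1 := ha0 ξ hξ.1
      have h2 := ode ξ hξ.1
      rw [hψ' ξ hξ.1 hξ.2.1, (h ξ hξ.1).1, (h ξ hξ.1).2]
      field_simp
      linear_combination a ξ * h2
  · refine eventuallyEq_zero_of_real (x := x₀) ?_ ?_
    · exact ((((mc (starRingEnd ℂ P.p)).fun_mul
        (((hM.deriv.deriv.fun_sub (((mc 2).fun_mul hψ).fun_mul hM.deriv)).fun_sub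
        (hψ.deriv.fun_mul hM)).fun_add (hψ2.fun_mul hM))).fun_add
        ((((mc (starRingEnd ℂ P.q)).fun_mul hM).fun_add
        ((mc (starRingEnd ℂ P.r)).fun_mul hM2)).fun_mul hM)).fun_add
        ((mc (I * P.c)).fun_mul (hM.deriv.fun_sub (hψ.fun_mul hM)))).fun_add
        ((mc (P.ω + I * P.γ)).fun_mul hM)
    · filter_upwards [key] with ξ hξ
      have h1 := ha0 ξ hξ.1
      have h2 := congrArg (starRingEnd ℂ) (ode ξ hξ.1)
      simp only [map_add, map_sub, map_mul, map_pow, conj_I, conj_ofReal, map_zero] at h2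
      rw [hm] at h2
      rw [hψ' ξ hξ.1 hξ.2.1, hM' ξ hξ.1 hξ.2.2, hM'' ξ hξ.1 hξ.2.2, (h ξ hξ.1).1, (h ξ hξ.1).2, hm]
      field_simp
      linear_combination a ξ ^ 2 * h2

end Params

end CGL5

theorem mainTheorem5 (P : CGL5.Params) :
    -- travelling waves of the partial differential equation yield meromorphic waves
    (∀ (a : ℝ → ℂ) (α β : ℝ) (ψ M : ℂ → ℂ), α < β →
      ContDiffOn ℝ 2 a (Set.Ioo α β) → (∀ ξ ∈ Set.Ioo α β, a ξ ≠ 0) →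
      (∀ x t : ℝ, x - P.c * t ∈ Set.Ioo α β → P.SolvesPDEAt (P.amplitude a) x t) →
      Meromorphic ψ → Meromorphic M →
      (∀ ξ ∈ Set.Ioo α β, ψ (ξ : ℂ) = deriv a ξ / a ξ ∧ M (ξ : ℂ) = ((‖a ξ‖ ^ 2 : ℝ) : ℂ)) →
      P.IsMeromorphicWave ψ M) ∧
    -- existence of an elliptic wave is equivalent to the constraints
    ((∃ ψ M : ℂ → ℂ, P.IsEllipticWave ψ M) ↔ P.Constraints) ∧
    -- uniqueness up to translation
    (∀ ψ₁ M₁ ψ₂ M₂ : ℂ → ℂ, P.IsEllipticWave ψ₁ M₁ → P.IsEllipticWave ψ₂ M₂ →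
      ∃ τ : ℂ, (ψ₂ =ᶠ[Filter.codiscrete ℂ] fun ξ => ψ₁ (τ + ξ)) ∧
        M₂ =ᶠ[Filter.codiscrete ℂ] fun ξ => M₁ (τ + ξ)) ∧
    -- closed form, for a suitable choice of the origin of `ξ`
    (∀ ψ M : ℂ → ℂ, P.IsEllipticWave ψ M →
      ∃ (ξ₀ : ℂ) (Lψ LM : PeriodPair) (x : Fin 3 → ℂ) (y : Fin 4 → ℂ),
        x 0 = 0 ∧ (∀ k, y k ∉ LM.lattice) ∧
        CGL5.HasSimplePoles (fun ξ => ψ (ξ₀ + ξ)) Lψ x CGL5.Params.residueψ ∧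
        CGL5.HasSimplePoles (fun ξ => M (ξ₀ + ξ)) LM y P.residueM ∧
        (∀ᶠ ξ in Filter.codiscrete ℂ,
          ψ (ξ₀ + ξ) - Complex.I * (P.c * P.sr / 2) =
            P.c * P.si / 2 + CGL5.weierstrassZeta Lψ ξ
              + ∑ k ∈ ({1, 2} : Finset (Fin 3)), CGL5.Params.residueψ k *
                  (CGL5.weierstrassZeta Lψ (ξ - x k) + CGL5.weierstrassZeta Lψ (x k))) ∧
        (∀ᶠ ξ in Filter.codiscrete ℂ,
          M (ξ₀ + ξ) = ∑ k : Fin 4, P.residueM k *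
            (CGL5.weierstrassZeta LM (ξ - y k) + CGL5.weierstrassZeta LM (y k)))) :=
  ⟨fun _ _ _ _ _ hαβ ha ha0 hA hψ hM h =>
    CGL5.Params.isMeromorphicWave_of_travelling_wave hαβ ha ha0 hA hψ hM h,
    CGL5.Params.exists_isEllipticWave_iff, fun _ _ _ _ h₁ h₂ => h₁.eq_translate h₂,
    fun _ _ h => h.closed_form⟩
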